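/- **Setting.** Fix $I$ classes, $\lambda_i,\mu_i>0$ with $\sum_{i=1}^I\rho_i=1$, $\rho_i=\lambda_i/\mu_i$, reals $\hat\lambda_i,\hat\mu_i$, and $\hat x_0\in\mathbb R_+^I$. Put $\theta=(\mu_1^{-1},\dots,\mu_I^{-1})$, $\hat m=(\hat\lambda_i-\rho_i\hat\mu_i)_i$, $\sigma=\mathrm{Diag}(\lambda_1^{1/2},\dots,\lambda_I^{1/2})$. Let $C(x)=\sum_iC_i(x_i)$ with $C_i:\mathbb R_+\to\mathbb R_+$ strictly increasing, strictly convex, $C^1$, $C_i(0)=C_i'(0)=0$; let $g_{j,i}:\mathbb R\to\mathbb R$ ($j\in\{A,S\}$, $i\le I$) be convex and non-decreasing; let $\varrho:\mathbb R_+\to\mathbb R_+$ be non-increasing. Assume that for some $\bar p\ge p\ge1$, $c_0,c_2,c_3>0$, $c_1\in\mathbb R$: $C_i(x)\le c_0(1+x^p)$ for $x\ge0$; $|g_{j,i}(x)|\le c_3(1+|x|^{\bar p})$ for $x\in\mathbb R$; $g_{j,i}(x)\ge c_1+c_2x^{\bar p}$ for $x\ge 0$; and $\int_0^\infty\varrho(t)t^{\bar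 p}dt<\infty$. **Minimizer.** An admissible control is a tuple $(\Omega,\mathcal F,\{\mathcal F_t\},\mathbb P,\hat B,\hat Y)$: a filtered probability space carrying independent one-dimensional standard $\mathcal F_t$-Brownian motions $\hat B_{j,i}$ with continuous paths, and an $\mathbb R^I$-valued $\mathcal F_t$-adapted RCLL process $\hat Y$ such that $\theta\cdot\hat Y$ is nonnegative and nondecreasing and the state $\hat X=\hat L+\hat Y$ stays in $\mathbb R_+^I$, where $\hat L(t)=\hat x_0+\hat mt+\sigma(\hat B_A(t)-\hat B_S(t))$. The set of these controls is $\mathcal A$. **Maximizer.** On a given such space, $\mathcal Q$ is the set of probability measures $\mathbb Q$ on $(\Omega,\mathcal F)$ under which the $\hat B_{j,i}$ are independent and for which there are $\mathcal F_t$-progressively measurable $\hat\psi_{j,i}$ with $\int_0^t\hat\psi_{j,i}^2ds<\infty$ $\mathbb P$-a.s. such that, for all $(j,i)$ and $t\ge0$, the law $\mathbb Q_{j,i}$ of $\hat B_{j,i}$ under $\mathbb Q$ has, on paths up to time $t$, a density with respect to the law $\mathbb P_{j,i}$ of $\hat B_{j,i}$ under $\mathbb P$, which evaluated along $\hat B_{j,i}$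 is $\mathbb P$-a.s. $$\frac{d\mathbb Q_{j,i}}{d\mathbb P_{j,i}}(t)=\exp\Big\{\int_0^t\hat\psi_{j,i}\,d\hat B_{j,i}-\tfrac12\int_0^t\hat\psi_{j,i}^2ds\Big\},$$ with $\mathbb E^{\mathbb P}\int_0^\infty\varrho\,\hat\psi_{j,i}^2ds<\infty$ and $\mathbb E^{\mathbb P}e^{\frac12\int_0^t\hat\psi_{j,i}^2ds}<\infty$ for all $t\in\mathrm{supp}(\varrho)$. **Game.** Let $$J(\hat Y,\mathbb Q)=\mathbb E^{\mathbb Q}\Big[\int_0^\infty\varrho(t)C(\hat X(t))dt\Big]-\sum_{j,i}\mathcal L_{j,i},\qquad \mathcal L_{j,i}=\mathbb E^{\mathbb Q_{j,i}}\Big[\int_0^\infty\varrho(t)\,g_{j,i}\Big(\log\frac{d\mathbb Q_{j,i}}{d\mathbb P_{j,i}}(t)\Big)dt\Big],$$ with values in $[-\infty,\infty]$ and $J=-\infty$ when the total penalty is $+\infty$, and let $V=\inf_{\hat Y\in\mathcal A}\sup_{\mathbb Q\in\mathcal Q}J(\hat Y,\mathbb Q)$, the infimum being over all admissible tuples, on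 all filtered probability spaces. **Proposition.** There is a continuous $f:\mathbb R_+\to\mathbb R_+^I$ with $$\theta\cdot f(w)=w,\qquad C(f(w))=\inf\{C(q):q\in\mathbb R_+^I,\ \theta\cdot q=w\}\qquad(w\ge0).$$ For every such $f$ and every filtered probability space with Brownian motions as above, let $\Gamma[l](t)=l(t)-\inf_{s\in[0,t]}(l(s)\wedge0)$, $\hat X_f(t)=f(\Gamma[\theta\cdot\hat L](t))$ and $\hat Y_f=\hat X_f-\hat L$. Then $(\Omega,\mathcal F,\{\mathcal F_t\},\mathbb P,\hat B,\hat Y_f)$ is an admissible control for the minimizer, and it is optimal: $$V=\sup_{\mathbb Q\in\mathcal Q}J(\hat Y_f,\mathbb Q).$$ -/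

import Mathlib

open MeasureTheory ProbabilityTheory Filter Topology Set
open scoped NNReal ENNReal Matrix

universe u

noncomputable section

/-! ### Simple processes, the Itô integral, filtered Brownian motion -/

/-- A bounded simple process adapted to `F`:
`∑ k < n, ξ k * 1_{(τ k, τ (k+1)]}` with deterministic times `τ 0 ≤ τ 1 ≤ ⋯` and bounded
`F (τ k)`-measurable random variables `ξ k`. -/
structure SimpleProc {Ω : Type u} {m : MeasurableSpace Ω} (F : Filtration ℝ≥0 m) where
  n : ℕ
  τ : ℕ → ℝ≥0
  ξ : ℕ → Ω → ℝ
  mono : Monotone τ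
  meas : ∀ k, Measurable[F (τ k)] (ξ k)
  bdd : ∃ c : ℝ, ∀ k ω, |ξ k ω| ≤ c

/-- The value of a simple process at time `s`. -/
def SimpleProc.eval {Ω : Type u} {m : MeasurableSpace Ω} {F : Filtration ℝ≥0 m}
    (H : SimpleProc F) (s : ℝ≥0) (ω : Ω) : ℝ :=
  ∑ k ∈ Finset.range H.n, (Ioc (H.τ k) (H.τ (k + 1))).indicator (fun _ => H.ξ k ω) s

/-- The elementary stochastic integral `∫₀ᵗ H dB` of a simple process. -/
def SimpleProc.integral {Ω : Type u} {m : MeasurableSpace Ω} {F : Filtration ℝ≥0 m}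
    (H : SimpleProc F) (B : ℝ≥0 → Ω → ℝ) (t : ℝ≥0) (ω : Ω) : ℝ :=
  ∑ k ∈ Finset.range H.n, H.ξ k ω * (B (min (H.τ (k + 1)) t) ω - B (min (H.τ k) t) ω)

/-- Lebesgue measure on the time axis `[0, ∞)`. -/
def timeMeasure : Measure ℝ≥0 := (volume : Measure ℝ).comap (fun t : ℝ≥0 => (t : ℝ))

/-- `∫₀ᵗ ψ(s)² ds`, with values in `[0, ∞]`. -/
def energy {Ω : Type u} (ψ : ℝ≥0 → Ω → ℝ) (t : ℝ≥0) (ω : Ω) : ℝ≥0∞ :=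
  ∫⁻ s in Iic t, ENNReal.ofReal (ψ s ω ^ 2) ∂timeMeasure

/-- The random variable `J` is (a version of) the Itô integral `∫₀ᵗ ψ dB`: it is the limit in
probability of elementary integrals of simple processes `H n` for which
`∫₀ᵗ |H n - ψ|² ds → 0` in probability. -/
def IsItoIntegral {Ω : Type u} {m : MeasurableSpace Ω} (P : Measure Ω) (F : Filtration ℝ≥0 m)
    (B ψ : ℝ≥0 → Ω → ℝ) (t : ℝ≥0) (J : Ω → ℝ) : Prop :=
  ∃ H : ℕ → SimpleProc F,
    (∀ ε : ℝ≥0∞, 0 < ε →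
      Tendsto (fun n => P {ω | ε ≤ energy (fun s ω => (H n).eval s ω - ψ s ω) t ω})
        atTop (𝓝 0)) ∧
    TendstoInMeasure P (fun n => (H n).integral B t) atTop J

/-- `B` is a one-dimensional standard Brownian motion relative to the filtration `F`:
a standard Brownian motion with continuous paths, adapted, and with increments after time `s`
independent of `F s`. -/
structure IsFilteredBrownian {Ω : Type u} {m : MeasurableSpace Ω} (P : Measure Ω)
    (F : Filtration ℝ≥0 m) (B : ℝ≥0 → Ω → ℝ) : Prop where
  brownian : IsBrownianReal B P
  continuous_path : ∀ ω, Continuous fun t => B t ω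
  adapted : Adapted F B
  indep_increment : ∀ s t, s ≤ t →
    Indep (F s) (MeasurableSpace.comap (fun ω => B t ω - B s ω) inferInstance) P

/-- Right-continuous paths with finite left limits. -/
def IsRCLL {E : Type*} [TopologicalSpace E] (x : ℝ≥0 → E) : Prop :=
  ∀ t, ContinuousWithinAt x (Ici t) t ∧ ∃ l, Tendsto x (𝓝[<] t) (𝓝 l)

/-- The one-dimensional Skorokhod map `Γ[l](t) = l(t) - inf {l(s) ∧ 0 : s ∈ [0, t]}`. -/
def skorokhodMap (l : ℝ≥0 → ℝ) (t : ℝ≥0) : ℝ :=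
  l t - sInf ((fun s => min (l s) 0) '' Iic t)

/-! ### Densities of path laws and the divergence -/

/-- The path of a process up to time `t`. -/
def pathUpTo {Ω : Type u} (B : ℝ≥0 → Ω → ℝ) (t : ℝ≥0) (ω : Ω) : Iic t → ℝ :=
  fun s => B s ω

/-- The law under `Q` of the path of `B` up to time `t`. -/
def lawUpTo {Ω : Type u} [MeasurableSpace Ω] (Q : Measure Ω) (B : ℝ≥0 → Ω → ℝ) (t : ℝ≥0) :
    Measure (Iic t → ℝ) :=
  Q.map (pathUpTo B t)

/-- The density at time `t` of the law of `B` under `Q` with respect to its law under `P`,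
as a function of the path up to time `t`. -/
def pathDensity {Ω : Type u} [MeasurableSpace Ω] (Q P : Measure Ω) (B : ℝ≥0 → Ω → ℝ)
    (t : ℝ≥0) : (Iic t → ℝ) → ℝ≥0∞ :=
  (lawUpTo Q B t).rnDeriv (lawUpTo P B t)

/-- The divergence `𝓛(Q_B ‖ P_B) = E^{Q_B}[∫₀^∞ ϱ(t) g(log (dQ_B/dP_B)(t)) dt]` between the laws
`Q_B`, `P_B` of the process `B` under `Q` and under `P`, as the difference of the integrals of the
positive and of the negative part. The density at time `t` is only determined up to a null set
depending on `t`, so the expectation is taken at each time before integrating in time (Tonelli). -/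
def divergence {Ω : Type u} [MeasurableSpace Ω] (ϱ : ℝ≥0 → ℝ≥0) (g : ℝ → ℝ)
    (Q P : Measure Ω) (B : ℝ≥0 → Ω → ℝ) : EReal :=
  ((∫⁻ t, (ϱ t : ℝ≥0∞) * ∫⁻ w, ENNReal.ofReal (g (Real.log (pathDensity Q P B t w).toReal))
      ∂(lawUpTo Q B t) ∂timeMeasure : ℝ≥0∞) : EReal) -
  ((∫⁻ t, (ϱ t : ℝ≥0∞) * ∫⁻ w, ENNReal.ofReal (-g (Real.log (pathDensity Q P B t w).toReal))
      ∂(lawUpTo Q B t) ∂timeMeasure : ℝ≥0∞) : EReal)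

/-! ### The game -/

/-- The two sources of randomness attached to each class: arrivals and services. -/
inductive Source where
  | A
  | S
  deriving DecidableEq

instance Source.instFintype : Fintype Source :=
  ⟨{Source.A, Source.S}, by intro x; cases x <;> simp⟩

/-- The data of the limiting game with `I` classes. -/
structure GameData (I : ℕ) where
  /-- first-order arrival rates `λ_i` -/
  lam : Fin I → ℝ
  /-- first-order service rates `μ_i` -/
  mu : Fin I → ℝ
  /-- second-order arrival rates -/
  lamHat : Fin I → ℝ
  /-- second-order service rates -/
  muHat : Fin I → ℝ
  /-- initial state -/
  x₀ : Fin I → ℝ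
  /-- holding cost of each class; only its values on `[0, ∞)` matter -/
  Cc : Fin I → ℝ → ℝ
  /-- divergence functions -/
  g : Source × Fin I → ℝ → ℝ
  /-- discount function -/
  ϱ : ℝ≥0 → ℝ≥0

namespace GameData

variable {I : ℕ} (D : GameData I)

/-- Traffic intensities `ρ_i = λ_i / μ_i`. -/
def traffic (i : Fin I) : ℝ := D.lam i / D.mu i

/-- The workload vector `θ = (1/μ_1, …, 1/μ_I)`. -/
def θ (i : Fin I) : ℝ := (D.mu i)⁻¹

/-- The drift vector. -/
def drift (i : Fin I) : ℝ := D.lamHat i - D.traffic i * D.muHat i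

/-- The diffusion matrix `Diag(λ_1^{1/2}, …, λ_I^{1/2})`. -/
def σ : Matrix (Fin I) (Fin I) ℝ := Matrix.diagonal fun i => Real.sqrt (D.lam i)

/-- The total holding cost `C(x) = ∑ i, C_i(x_i)`. -/
def C (x : Fin I → ℝ) : ℝ := ∑ i, D.Cc i (x i)

/-- The standing assumptions on the data. -/
structure Standing : Prop where
  lam_pos : ∀ i, 0 < D.lam i
  mu_pos : ∀ i, 0 < D.mu i
  critical : ∑ i, D.traffic i = 1
  x₀_nonneg : ∀ i, 0 ≤ D.x₀ i
  cost_strictMono : ∀ i, StrictMonoOn (D.Cc i) (Ici 0)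
  cost_strictConvex : ∀ i, StrictConvexOn ℝ (Ici 0) (D.Cc i)
  cost_C1 : ∀ i, ContDiffOn ℝ 1 (D.Cc i) (Ici 0)
  cost_zero : ∀ i, D.Cc i 0 = 0
  cost_deriv_zero : ∀ i, derivWithin (D.Cc i) (Ici 0) 0 = 0
  g_convex : ∀ k, ConvexOn ℝ univ (D.g k)
  g_mono : ∀ k, Monotone (D.g k)
  discount_anti : Antitone D.ϱ
  growth : ∃ p pbar c₀ c₁ c₂ c₃ : ℝ, 1 ≤ p ∧ p ≤ pbar ∧ 0 < c₀ ∧ 0 < c₂ ∧ 0 < c₃ ∧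
    (∀ i, ∀ x, 0 ≤ x → D.Cc i x ≤ c₀ * (1 + x ^ p)) ∧
    (∀ k x, |D.g k x| ≤ c₃ * (1 + |x| ^ pbar)) ∧
    (∀ k x, 0 ≤ x → c₁ + c₂ * x ^ pbar ≤ D.g k x) ∧
    ∫⁻ t, (D.ϱ t : ℝ≥0∞) * (t : ℝ≥0∞) ^ pbar ∂timeMeasure < ⊤

/-- `f` is a (continuous) minimizing curve: for each workload `w ≥ 0`, `f w` is a state of workload
`w` of minimal holding cost. Only the values of `f` on `[0, ∞)` matter. -/
structure IsMinimizingCurve (f : ℝ → Fin I → ℝ) : Prop where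
  continuousOn : ContinuousOn f (Ici 0)
  nonneg : ∀ w, 0 ≤ w → ∀ i, 0 ≤ f w i
  workload : ∀ w, 0 ≤ w → D.θ ⬝ᵥ f w = w
  minimal : ∀ w, 0 ≤ w →
    IsGLB (D.C '' {q : Fin I → ℝ | (∀ i, 0 ≤ q i) ∧ D.θ ⬝ᵥ q = w}) (D.C (f w))

end GameData

/-- A filtered probability space carrying `2 I` independent one-dimensional standard Brownian
motions relative to its filtration, one for each source and each class. -/
structure GameBasis (I : ℕ) : Type (u + 1) where
  Ω : Type u
  [mΩ : MeasurableSpace Ω]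
  P : Measure Ω
  [isProb : IsProbabilityMeasure P]
  F : Filtration ℝ≥0 mΩ
  B : Source × Fin I → ℝ≥0 → Ω → ℝ
  brownian : ∀ k, IsFilteredBrownian P F (B k)
  indep : iIndepFun (fun k (ω : Ω) (t : ℝ≥0) => B k t ω) P

attribute [instance] GameBasis.mΩ GameBasis.isProb

namespace GameData

variable {I : ℕ} (D : GameData I) (S : GameBasis.{u} I)

/-- The uncontrolled process `L̂(t) = x̂₀ + m̂ t + σ (B̂_A(t) - B̂_S(t))`. -/
def free (t : ℝ≥0) (ω : S.Ω) : Fin I → ℝ :=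
  D.x₀ + (t : ℝ) • D.drift + D.σ *ᵥ (fun i => S.B (.A, i) t ω - S.B (.S, i) t ω)

/-- The state process `X̂ = L̂ + Ŷ`. -/
def state (Y : ℝ≥0 → S.Ω → Fin I → ℝ) (t : ℝ≥0) (ω : S.Ω) : Fin I → ℝ :=
  D.free S t ω + Y t ω

/-- `(S, Y)` is an admissible control for the minimizer. The last condition is the state constraint
`X̂(t) ∈ ℝ₊^I`, the domain of the holding cost. -/
structure IsMinimizerControl (Y : ℝ≥0 → S.Ω → Fin I → ℝ) : Prop where
  adapted : Adapted S.F Y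
  rcll : ∀ ω, IsRCLL fun t => Y t ω
  workload_nonneg : ∀ ω t, 0 ≤ D.θ ⬝ᵥ Y t ω
  workload_mono : ∀ ω, Monotone fun t => D.θ ⬝ᵥ Y t ω
  state_nonneg : ∀ ω t i, 0 ≤ D.state S Y t ω i

/-- `Q` is an admissible control for the maximizer, with Girsanov kernel `ψ`. -/
structure IsMaximizerControlWith (Q : Measure S.Ω) (ψ : Source × Fin I → ℝ≥0 → S.Ω → ℝ) :
    Prop where
  isProb : IsProbabilityMeasure Q
  progressive : ∀ k, IsProgressive S.F (ψ k)
  /-- `∫₀ᵗ ψ² ds` is finite, so that the stochastic exponential makes sense. -/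
  energy_finite : ∀ k t, ∀ᵐ ω ∂S.P, energy (ψ k) t ω < ⊤
  /-- the law of `B k` under `Q` has at each time `t` a density with respect to the law of `B k`
  under `P`, and along `B k` it equals `exp (∫₀ᵗ ψ dB - (1/2) ∫₀ᵗ ψ² ds)` -/
  absCont : ∀ k t, lawUpTo Q (S.B k) t ≪ lawUpTo S.P (S.B k) t
  density : ∀ k t, ∃ J : S.Ω → ℝ, IsItoIntegral S.P S.F (S.B k) (ψ k) t J ∧
    ∀ᵐ ω ∂S.P, pathDensity Q S.P (S.B k) t (pathUpTo (S.B k) t ω) =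
      ENNReal.ofReal (Real.exp (J ω - (1 / 2) * (energy (ψ k) t ω).toReal))
  discounted_energy : ∀ k, ∫⁻ ω, ∫⁻ s, (D.ϱ s : ℝ≥0∞) * ENNReal.ofReal (ψ k s ω ^ 2)
    ∂timeMeasure ∂S.P < ⊤
  /-- Novikov's condition on the support of the discount function -/
  novikov : ∀ k, ∀ t ∈ tsupport D.ϱ,
    ∫⁻ ω, ENNReal.ofReal (Real.exp ((1 / 2) * (energy (ψ k) t ω).toReal)) ∂S.P < ⊤
  indep : iIndepFun (fun k (ω : S.Ω) (t : ℝ≥0) => S.B k t ω) Q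

/-- The set `𝒬` of admissible controls for the maximizer. -/
def maximizerControls : Set (Measure S.Ω) :=
  {Q | ∃ ψ, D.IsMaximizerControlWith S Q ψ}

/-- The cost `J(Ŷ, Q)`. -/
def cost (Y : ℝ≥0 → S.Ω → Fin I → ℝ) (Q : Measure S.Ω) : EReal :=
  ((∫⁻ ω, ∫⁻ t, (D.ϱ t : ℝ≥0∞) * ENNReal.ofReal (D.C (D.state S Y t ω))
      ∂timeMeasure ∂Q : ℝ≥0∞) : EReal) -
    ∑ k, divergence D.ϱ (D.g k) Q S.P (S.B k)

/-- The worst-case cost `sup_{Q ∈ 𝒬} J(Ŷ, Q)` of a control of the minimizer. -/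
def worstCost (Y : ℝ≥0 → S.Ω → Fin I → ℝ) : EReal :=
  ⨆ Q ∈ D.maximizerControls S, D.cost S Y Q

/-- The value of the game `V = inf_Ŷ sup_Q J(Ŷ, Q)`; the infimum ranges over all filtered
probability spaces with Brownian motions and all admissible `Ŷ` on them. -/
def value : EReal :=
  ⨅ (S : GameBasis.{u} I) (Y : ℝ≥0 → S.Ω → Fin I → ℝ) (_ : D.IsMinimizerControl S Y),
    D.worstCost S Y

/-- The state `X̂_f = f(Γ[θ · L̂])` under the `f`-reflecting control. -/
def reflectedState (f : ℝ → Fin I → ℝ) (t : ℝ≥0) (ω : S.Ω) : Fin I → ℝ :=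
  f (skorokhodMap (fun s => D.θ ⬝ᵥ D.free S s ω) t)

/-- The `f`-reflecting control `Ŷ_f = X̂_f - L̂`. -/
def reflectingControl (f : ℝ → Fin I → ℝ) (t : ℝ≥0) (ω : S.Ω) : Fin I → ℝ :=
  D.reflectedState S f t ω - D.free S t ω

end GameData

end

/-!
The proof has a pathwise half and a half about laws of Brownian motion.

*Pathwise half.* The workload `θ · X̂` of any admissible control is the free workload `θ · L̂` plus
a nonnegative nondecreasing process and stays nonnegative, so it dominates the reflected workload
`Γ[θ · L̂]` (`skorokhodMap_le`). The minimal cost of a given workload is nondecreasing in the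
workload, hence `C (X̂_f t) ≤ C (X̂ t)` for every path and every time: on a fixed space no control
beats the `f`-reflecting one against any fixed measure
(`GameData.IsMinimizingCurve.worstCost_reflecting_le`). The curve `f` exists because strict
convexity makes the minimizer on each simplex `θ · q = w` unique, and compactness then makes it
continuous.

*Half about laws.* The spaces may differ, so one also needs that the worst-case cost of the
reflecting control is the same on all of them (`worstCost_reflecting_le_worstCost`). That cost is
a functional of the driving Brownian paths, but the maximizer on one space may use a filtration
which is unavailable on another. Since only the laws of the single Brownian motions enter the
penalty and these motions stay independent, a maximizer's measure is encoded, up to time `T`, by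
`2 I` path densities. They are evaluated along the Brownian motions of the other space
(`exists_transfer`). Stopping the densities at `T` only lowers the penalty: with
`Φ z = z g (log z) + K (1 + z)`, which is convex and nonnegative (`isPenalty_penaltyFn`), the
divergence is up to a constant the discounted integral of the expectations of `Φ` along the density
process (`divergence_eq`), and these increase in time by Jensen's inequality.

The transferred densities need not be stochastic exponentials of admissible kernels. They are
approximated by the stochastic exponentials of bounded simple processes of the Brownian path
(`exists_controls_approx`), which satisfy every integrability requirement. A density is first
truncated between two positive constants, which by convexity increases the penalty by an
arbitrarily small amount (`exists_stochExp_penalty_le`). A bounded density is then an `L²` limit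
of trigonometric polynomials of the path (`exists_trig_near_of_bounds`). For such a function the
martingale it generates has an explicit first-order expansion `Z + H Δ + R` over the steps of a
fine grid, and the discrete Gronwall inequality compares it with the stochastic exponential of
`H / Z` (`exists_stochExp_near`). No martingale representation theorem is needed. Along a
sufficiently fast sequence the densities converge almost surely, so Fatou's lemma bounds the gain
up to time `T`, and monotone convergence lets `T` tend to infinity.
-/

/-! ### Entropy-type penalty functions -/

/-- The penalty functions used to measure a density: convex, continuous and nonnegative on
`[0, ∞)`, with at most quadratic growth. -/
structure IsPenalty (Φ : ℝ → ℝ) : Prop where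
  convex : ConvexOn ℝ (Ici 0) Φ
  cont : ContinuousOn Φ (Ici 0)
  nonneg : ∀ x, 0 ≤ x → 0 ≤ Φ x
  growth : ∃ c, 0 ≤ c ∧ ∀ x, 0 ≤ x → Φ x ≤ c * (1 + x ^ 2)

lemma IsPenalty.le_add {Φ : ℝ → ℝ} (h : IsPenalty Φ) {y z : ℝ} (hy : 0 ≤ y) (hyz : y ≤ z) :
    Φ y ≤ Φ 0 + Φ z := by
  have h0 := h.nonneg 0 le_rfl
  have hz := h.nonneg z (hy.trans hyz)
  have := h.convex.le_on_segment (x := 0) (y := z) (z := y) (by simp) (hy.trans hyz)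
    (by rw [segment_eq_Icc (hy.trans hyz)]; exact ⟨hy, hyz⟩)
  rcases max_cases (Φ 0) (Φ z) with h' | h' <;> linarith [h'.1, this]

/-- Near a compact subinterval of `(0, ∞)` a penalty function has a one-sided modulus of
continuity that is linear for small and quadratic for large deviations. -/
lemma IsPenalty.local_bound {Φ : ℝ → ℝ} (h : IsPenalty Φ) {a b : ℝ} (ha : 0 < a) :
    ∃ L, 0 ≤ L ∧ ∀ z ∈ Icc a b, ∀ x, 0 ≤ x → Φ x ≤ Φ z + L * (|x - z| + (x - z) ^ 2) := by
  obtain ⟨c, hc, hgr⟩ := h.growth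
  obtain ⟨M, hM⟩ := (isCompact_Icc (a := (0 : ℝ)) (b := b + 1)).bddAbove_image
    (f := Φ) (h.cont.mono fun x hx => hx.1)
  have h0 := h.nonneg 0 le_rfl
  refine ⟨Φ 0 / a + |M| + c * (3 + 2 * b ^ 2), by positivity, fun z hz x hx => ?_⟩
  have hz0 : 0 < z := ha.trans_le hz.1
  have hΦz := h.nonneg z hz0.le
  have hA : 0 ≤ |x - z| + (x - z) ^ 2 := by positivity
  have hexp : (Φ 0 / a + |M| + c * (3 + 2 * b ^ 2)) * (|x - z| + (x - z) ^ 2) =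
    Φ 0 / a * (|x - z| + (x - z) ^ 2) + |M| * (|x - z| + (x - z) ^ 2) +
      c * (3 + 2 * b ^ 2) * (|x - z| + (x - z) ^ 2) := by ring
  have p1 : 0 ≤ Φ 0 / a * (|x - z| + (x - z) ^ 2) := by positivity
  have p2 : 0 ≤ |M| * (|x - z| + (x - z) ^ 2) := by positivity
  have p3 : 0 ≤ c * (3 + 2 * b ^ 2) * (|x - z| + (x - z) ^ 2) := by positivity
  rcases le_total x z with hxz | hxz
  · have hcv := h.convex.2 (show (0 : ℝ) ∈ Ici 0 by simp) (show z ∈ Ici 0 from hz0.le)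
      (show 0 ≤ 1 - x / z by rw [sub_nonneg, div_le_one hz0]; exact hxz)
      (show 0 ≤ x / z by positivity) (by ring)
    have e : (1 - x / z) • (0 : ℝ) + (x / z) • z = x := by
      simp; field_simp
    rw [e] at hcv
    simp only [smul_eq_mul] at hcv
    have k1 : x / z * Φ z ≤ Φ z := by
      have : x / z ≤ 1 := by rw [div_le_one hz0]; exact hxz
      nlinarith
    have k2 : (1 - x / z) * Φ 0 ≤ Φ 0 / a * |x - z| := by
      rw [abs_of_nonpos (by linarith)]
      have : 1 - x / z = (z - x) / z := by field_simp
      rw [this, neg_sub, div_mul_eq_mul_div, div_mul_eq_mul_div, mul_comm (Φ 0)]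
      exact div_le_div_of_nonneg_left (mul_nonneg (by linarith) h0) ha hz.1
    have k3 : Φ 0 / a * |x - z| ≤ Φ 0 / a * (|x - z| + (x - z) ^ 2) := by
      gcongr; nlinarith [sq_nonneg (x - z)]
    linarith
  · rcases le_total (x - z) 1 with h1 | h1
    · have hcv := h.convex.2 (show z ∈ Ici 0 from hz0.le)
        (show z + 1 ∈ Ici 0 by simp; linarith)
        (show 0 ≤ 1 - (x - z) by linarith) (show 0 ≤ x - z by linarith) (by ring)
      have e : (1 - (x - z)) • z + (x - z) • (z + 1) = x := by
        simp only [smul_eq_mul]; ring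
      rw [e] at hcv
      simp only [smul_eq_mul] at hcv
      have hM' : Φ (z + 1) ≤ |M| :=
        (hM ⟨z + 1, ⟨by linarith, by linarith [hz.2]⟩, rfl⟩).trans (le_abs_self M)
      have k1 : (1 - (x - z)) * Φ z ≤ Φ z := by nlinarith
      have k2 : (x - z) * Φ (z + 1) ≤ |M| * (|x - z| + (x - z) ^ 2) := by
        rw [abs_of_nonneg (by linarith : 0 ≤ x - z)]
        have := mul_le_mul_of_nonneg_left hM' (by linarith : 0 ≤ x - z)
        have : 0 ≤ |M| * (x - z) ^ 2 := by positivity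
        nlinarith
      linarith
    · have k1 := hgr x hx
      have k2 : 1 + x ^ 2 ≤ (3 + 2 * b ^ 2) * (x - z) ^ 2 := by
        have e1 : x ^ 2 ≤ 2 * (x - z) ^ 2 + 2 * z ^ 2 := by nlinarith [sq_nonneg (x - 2 * z)]
        have e2 : z ^ 2 ≤ b ^ 2 := by nlinarith [hz.2]
        have e3 : 1 ≤ (x - z) ^ 2 := by nlinarith
        nlinarith [sq_nonneg b]
      have k3 : c * (1 + x ^ 2) ≤ c * (3 + 2 * b ^ 2) * (|x - z| + (x - z) ^ 2) := by
        calc c * (1 + x ^ 2) ≤ c * ((3 + 2 * b ^ 2) * (x - z) ^ 2) := by gcongr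
          _ = c * (3 + 2 * b ^ 2) * (x - z) ^ 2 := by ring
          _ ≤ _ := by gcongr; nlinarith [abs_nonneg (x - z)]
      linarith

lemma exists_subgradient {g : ℝ → ℝ} (hg : ConvexOn ℝ univ g) (hm : Monotone g) (x : ℝ) :
    ∃ a, 0 ≤ a ∧ ∀ u, g x + a * (u - x) ≤ g u := by
  have key : ∀ u, g x + derivWithin g (Ioi x) x * (u - x) ≤ g u := by
    intro u
    rcases lt_trichotomy u x with h | h | h
    · have h1 := hg.slope_le_leftDeriv_of_mem_interior (x := u) (y := x) (by simp) (by simp) h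
      have h2 := hg.leftDeriv_le_rightDeriv_of_mem_interior (x := x) (by simp)
      have h3 := h1.trans h2
      rw [slope_def_field, div_le_iff₀ (by linarith)] at h3
      linarith
    · simp [h]
    · have h1 := hg.rightDeriv_le_slope_of_mem_interior (x := x) (y := u) (by simp) (by simp) h
      rw [slope_def_field, le_div_iff₀ (by linarith)] at h1
      linarith
  refine ⟨_, ?_, key⟩
  by_contra! h
  have h1 := key (x - 1)
  have h2 := hm (show x - 1 ≤ x by linarith)
  linarith

/-- If `g` is convex and nondecreasing, then the associated divergence integrand `z g(log z)` is
convex: it is a supremum of functions `z (a log z + b)` with `a ≥ 0`. -/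
lemma convexOn_mul_comp_log {g : ℝ → ℝ} (hg : ConvexOn ℝ univ g) (hm : Monotone g) :
    ConvexOn ℝ (Ici 0) fun z => z * g (Real.log z) := by
  refine ⟨convex_Ici 0, fun x hx y hy s t hs ht hst => ?_⟩
  simp only [mem_Ici, smul_eq_mul] at *
  set z := s * x + t * y with hz
  obtain ⟨a, ha, hsub⟩ := exists_subgradient hg hm (Real.log z)
  have hcv := Real.convexOn_mul_log.2 hx hy hs ht hst
  simp only [smul_eq_mul] at hcv
  rw [← hz] at hcv
  have h1 := mul_le_mul_of_nonneg_left (hsub (Real.log x)) (mul_nonneg hs hx)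
  have h2 := mul_le_mul_of_nonneg_left (hsub (Real.log y)) (mul_nonneg ht hy)
  have h3 := mul_le_mul_of_nonneg_left hcv ha
  have e : z * g (Real.log z) = s * x * g (Real.log z) + t * y * g (Real.log z) := by
    rw [hz]; ring
  have e2 : a * (z * Real.log z) = s * x * (a * Real.log z) + t * y * (a * Real.log z) := by
    rw [hz]; ring
  nlinarith

/-- The penalty function of the divergence with integrand `g`: `z g(log z)`, made nonnegative by
adding a multiple of `1 + z`. -/
noncomputable def penaltyFn (g : ℝ → ℝ) (K z : ℝ) : ℝ := z * g (Real.log z) + K * (1 + z)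

lemma isPenalty_penaltyFn {g : ℝ → ℝ} (hg : ConvexOn ℝ univ g) (hm : Monotone g) {c p : ℝ}
    (hgr : ∀ x, |g x| ≤ c * (1 + |x| ^ p)) :
    ∃ K, 0 ≤ K ∧ IsPenalty (penaltyFn g K) := by
  obtain ⟨a, ha, hsub⟩ := exists_subgradient hg hm 0
  have hlow : ∀ z, 0 ≤ z → g 0 * z + a * (z * Real.log z) ≤ z * g (Real.log z) := by
    intro z hz
    have := mul_le_mul_of_nonneg_left (hsub (Real.log z)) hz
    nlinarith
  have hgc : Continuous g := continuousOn_univ.1 (hg.continuousOn isOpen_univ)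
  have hcv := convexOn_mul_comp_log hg hm
  have hct : ContinuousOn (penaltyFn g (|g 0| + a)) (Ici 0) := by
    have hbase : ContinuousOn (fun z => z * g (Real.log z)) (Ici 0) := by
      intro z hz
      rcases eq_or_lt_of_le (show (0 : ℝ) ≤ z from hz) with rfl | hz0
      -- continuity at `0`: the function lies between `g 0 y + a y log y` and `y g 0` there
      · have up : ∀ᶠ y in 𝓝[Ici 0] (0 : ℝ), y * g (Real.log y) ≤ y * g 0 := by
          have : ∀ᶠ y in 𝓝[Ici 0] (0 : ℝ), y < 1 :=
            nhdsWithin_le_nhds (eventually_lt_nhds one_pos)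
          filter_upwards [this, self_mem_nhdsWithin] with y hy hy0
          exact mul_le_mul_of_nonneg_left (hm (Real.log_nonpos hy0 hy.le)) hy0
        have lo : ∀ᶠ y in 𝓝[Ici 0] (0 : ℝ),
            g 0 * y + a * (y * Real.log y) ≤ y * g (Real.log y) := by
          filter_upwards [self_mem_nhdsWithin] with y hy0 using hlow y hy0
        have t1 : Tendsto (fun y : ℝ => g 0 * y + a * (y * Real.log y)) (𝓝[Ici 0] 0) (𝓝 0) := by
          have : Continuous (fun y : ℝ => g 0 * y + a * (y * Real.log y)) :=
            (continuous_const.mul continuous_id).add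
              (continuous_const.mul Real.continuous_mul_log)
          have := (this.tendsto 0).mono_left (nhdsWithin_le_nhds (s := Ici 0))
          simpa using this
        have t2 : Tendsto (fun y : ℝ => y * g 0) (𝓝[Ici 0] 0) (𝓝 0) := by
          have : Continuous (fun y : ℝ => y * g 0) := by fun_prop
          have := (this.tendsto 0).mono_left (nhdsWithin_le_nhds (s := Ici 0))
          simpa using this
        have := tendsto_of_tendsto_of_tendsto_of_le_of_le' t1 t2 lo up
        simpa [ContinuousWithinAt] using this
      · exact (continuousAt_id.mul
          (hgc.continuousAt.comp (Real.continuousAt_log hz0.ne'))).continuousWithinAt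
    exact hbase.add (by fun_prop)
  refine ⟨|g 0| + a, by positivity, ?_, hct, ?_, ?_⟩
  · refine hcv.add ?_
    refine ⟨convex_Ici 0, fun x _ y _ s t _ _ hst => le_of_eq ?_⟩
    simp only [smul_eq_mul]
    linear_combination (-(|g 0| + a)) * hst
  · intro z hz
    have h1 := hlow z hz
    have h2 : -1 ≤ z * Real.log z := by
      rcases eq_or_lt_of_le hz with rfl | hz0
      · simp
      · have := Real.one_sub_inv_le_log_of_pos hz0
        have h3 := mul_le_mul_of_nonneg_left this hz
        rw [mul_sub, mul_inv_cancel₀ hz0.ne'] at h3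
        linarith
    have h3 := neg_abs_le (g 0)
    have h4 := abs_nonneg (g 0)
    unfold penaltyFn
    nlinarith
  -- quadratic growth: `|g (log z)|` is at most linear in `z`, since powers of `log z` are `o(z)`
  · have hev := ((isLittleO_log_rpow_rpow_atTop p one_pos).bound (c := 1) one_pos)
    obtain ⟨N, hN⟩ := (hev.and (eventually_ge_atTop 1)).exists_forall_of_atTop
    obtain ⟨M, hM⟩ := (isCompact_Icc (a := (0 : ℝ)) (b := N)).bddAbove_image
      (f := penaltyFn g (|g 0| + a)) (hct.mono fun x hx => hx.1)
    set K := |g 0| + a with hK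
    have hK0 : 0 ≤ K := by positivity
    refine ⟨|M| + 2 * |c| + 2 * K, by positivity, fun z hz => ?_⟩
    rcases le_total z N with h | h
    · have h1 := (hM ⟨z, ⟨hz, h⟩, rfl⟩).trans (le_abs_self M)
      have : |M| * 1 ≤ |M| * (1 + z ^ 2) := by gcongr; nlinarith [sq_nonneg z]
      have : 0 ≤ (2 * |c| + 2 * K) * (1 + z ^ 2) := by positivity
      nlinarith
    · obtain ⟨h1, h2⟩ := hN z h
      have hlog : 0 ≤ Real.log z := Real.log_nonneg h2
      rw [Real.norm_of_nonneg (by positivity), Real.norm_of_nonneg (by positivity), one_mul,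
        Real.rpow_one] at h1
      have h3 := (le_abs_self _).trans (hgr (Real.log z))
      rw [abs_of_nonneg hlog] at h3
      have h4 : c * (1 + Real.log z ^ p) ≤ |c| * (1 + z) := by
        have : 0 ≤ Real.log z ^ p := by positivity
        calc c * (1 + Real.log z ^ p) ≤ |c| * (1 + Real.log z ^ p) := by
              gcongr; exact le_abs_self c
          _ ≤ _ := by gcongr
      have h5 : z * g (Real.log z) ≤ z * (|c| * (1 + z)) := by
        gcongr; exact h3.trans h4
      have hc := abs_nonneg c
      have hMM := abs_nonneg M
      have e1 : z * (1 + z) ≤ 2 * (1 + z ^ 2) := by nlinarith [sq_nonneg (z - 1)]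
      have e2 : 1 + z ≤ 2 * (1 + z ^ 2) := by nlinarith [sq_nonneg (z - 1)]
      have e3 : |c| * (z * (1 + z)) ≤ |c| * (2 * (1 + z ^ 2)) := by gcongr
      have e4 : K * (1 + z) ≤ K * (2 * (1 + z ^ 2)) := by gcongr
      have e5 : 0 ≤ |M| * (1 + z ^ 2) := by positivity
      unfold penaltyFn
      nlinarith

/-! ### Lebesgue measure on the time axis -/

lemma measurableEmbedding_nnreal_coe : MeasurableEmbedding ((↑) : ℝ≥0 → ℝ) :=
  MeasurableEmbedding.subtype_coe measurableSet_Ici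

instance sigmaFinite_timeMeasure : SigmaFinite timeMeasure :=
  SigmaFinite.of_map _ measurableEmbedding_nnreal_coe.measurable.aemeasurable (by
    rw [timeMeasure, measurableEmbedding_nnreal_coe.map_comap]; infer_instance)

lemma timeMeasure_Ioc (a b : ℝ≥0) : timeMeasure (Ioc a b) = ENNReal.ofReal (b - a) := by
  rw [timeMeasure, measurableEmbedding_nnreal_coe.comap_apply]
  have : ((↑) : ℝ≥0 → ℝ) '' Ioc a b = Ioc (a : ℝ) b := by
    ext x
    constructor
    · rintro ⟨y, ⟨h1, h2⟩, rfl⟩; exact ⟨by exact_mod_cast h1, by exact_mod_cast h2⟩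
    · rintro ⟨h1, h2⟩
      exact ⟨⟨x, a.2.trans h1.le⟩, ⟨by exact_mod_cast h1, by exact_mod_cast h2⟩, rfl⟩
  rw [this, Real.volume_Ioc]

lemma timeMeasure_singleton (a : ℝ≥0) : timeMeasure {a} = 0 := by
  rw [timeMeasure, measurableEmbedding_nnreal_coe.comap_apply]
  simp

/-! ### The filtration generated by a process -/

section Path

variable {Ω : Type u} {m : MeasurableSpace Ω}

lemma measurable_pathUpTo {B : ℝ≥0 → Ω → ℝ} (hB : ∀ t, Measurable (B t)) (t : ℝ≥0) :
    Measurable (pathUpTo B t) := measurable_pi_lambda _ fun s => hB s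

/-- The filtration generated by a process; its time-`t` σ-algebra is generated by the path up to
time `t`. -/
def pathFiltration (B : ℝ≥0 → Ω → ℝ) (hB : ∀ t, Measurable (B t)) : Filtration ℝ≥0 m where
  seq t := MeasurableSpace.comap (pathUpTo B t) inferInstance
  mono' s t hst := by
    refine Measurable.comap_le ?_
    have h : Measurable[MeasurableSpace.comap (pathUpTo B t) inferInstance] (pathUpTo B t) :=
      comap_measurable _
    refine @measurable_pi_lambda _ _ _ (_) _ _ fun r => ?_
    exact (measurable_pi_apply (⟨r, r.2.trans hst⟩ : Iic t)).comp h
  le' t := (measurable_pathUpTo hB t).comap_le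

lemma measurable_pathFiltration {B : ℝ≥0 → Ω → ℝ} (hB : ∀ t, Measurable (B t)) {s t : ℝ≥0}
    (hst : s ≤ t) : Measurable[pathFiltration B hB t] (B s) := by
  have h : Measurable[MeasurableSpace.comap (pathUpTo B t) inferInstance] (pathUpTo B t) :=
    comap_measurable _
  exact (measurable_pi_apply (⟨s, hst⟩ : Iic t)).comp h

lemma pathFiltration_le {B : ℝ≥0 → Ω → ℝ} (hB : ∀ t, Measurable (B t)) {F : Filtration ℝ≥0 m}
    (hF : Adapted F B) (t : ℝ≥0) : pathFiltration B hB t ≤ F t := by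
  refine Measurable.comap_le ?_
  exact @measurable_pi_lambda _ _ _ (_) _ _ fun s => (hF s).mono (F.mono s.2) le_rfl

lemma IsFilteredBrownian.measurable {P : Measure Ω} {F : Filtration ℝ≥0 m} {B : ℝ≥0 → Ω → ℝ}
    (h : IsFilteredBrownian P F B) (t : ℝ≥0) : Measurable (B t) :=
  (h.adapted t).mono (F.le t) le_rfl

lemma IsFilteredBrownian.toPath {P : Measure Ω} {F : Filtration ℝ≥0 m} {B : ℝ≥0 → Ω → ℝ}
    (h : IsFilteredBrownian P F B) : IsFilteredBrownian P (pathFiltration B h.measurable) B where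
  brownian := h.brownian
  continuous_path := h.continuous_path
  adapted _ := measurable_pathFiltration _ le_rfl
  indep_increment s t hst :=
    indep_of_indep_of_le_left (h.indep_increment s t hst)
      (pathFiltration_le h.measurable h.adapted s)

lemma IsFilteredBrownian.map_increment {P : Measure Ω} {F : Filtration ℝ≥0 m}
    {B : ℝ≥0 → Ω → ℝ} (h : IsFilteredBrownian P F B) {s t : ℝ≥0} (hst : s ≤ t) :
    P.map (fun ω => B t ω - B s ω) = gaussianReal 0 (t - s) := by
  have := (h.brownian.toIsPreBrownianReal.hasLaw_sub t s).map_eq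
  have e : nndist (t : ℝ) (s : ℝ) = t - s := by
    ext
    rw [NNReal.coe_sub hst, coe_nndist, Real.dist_eq, abs_of_nonneg]
    rw [sub_nonneg]; exact_mod_cast hst
  rw [← e]
  exact this

lemma IsFilteredBrownian.map_prod {P : Measure Ω} [IsProbabilityMeasure P]
    {F : Filtration ℝ≥0 m} {B : ℝ≥0 → Ω → ℝ} (h : IsFilteredBrownian P F B) {s t : ℝ≥0}
    (hst : s ≤ t) {E : Type*} [MeasurableSpace E] {V : Ω → E} (hV : Measurable[F s] V) :
    P.map (fun ω => (V ω, B t ω - B s ω)) = (P.map V).prod (gaussianReal 0 (t - s)) := by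
  rw [← h.map_increment hst]
  refine (indepFun_iff_map_prod_eq_prod_map_map (hV.mono (F.le s) le_rfl).aemeasurable
    ((h.measurable t).sub (h.measurable s)).aemeasurable).1 ?_
  rw [IndepFun_iff_Indep]
  exact indep_of_indep_of_le_left (h.indep_increment s t hst) hV.comap_le

/-- Integration over a Brownian increment, conditionally on the past. -/
lemma IsFilteredBrownian.lintegral_increment {P : Measure Ω} [IsProbabilityMeasure P]
    {F : Filtration ℝ≥0 m} {B : ℝ≥0 → Ω → ℝ} (h : IsFilteredBrownian P F B) {s t : ℝ≥0}
    (hst : s ≤ t) {E : Type*} [MeasurableSpace E] {V : Ω → E} (hV : Measurable[F s] V)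
    {f : E → ℝ → ℝ≥0∞} (hf : Measurable (Function.uncurry f)) :
    ∫⁻ ω, f (V ω) (B t ω - B s ω) ∂P = ∫⁻ ω, ∫⁻ y, f (V ω) y ∂(gaussianReal 0 (t - s)) ∂P := by
  have hV' : Measurable V := hV.mono (F.le s) le_rfl
  have e := h.map_prod hst hV
  have h1 : ∫⁻ ω, f (V ω) (B t ω - B s ω) ∂P
      = ∫⁻ p, Function.uncurry f p ∂(P.map (fun ω => (V ω, B t ω - B s ω))) :=
    (lintegral_map hf (hV'.prodMk ((h.measurable t).sub (h.measurable s)))).symm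
  rw [h1, e, lintegral_prod _ hf.aemeasurable, lintegral_map hf.lintegral_prod_right' hV']
  rfl

lemma IsFilteredBrownian.integral_increment {P : Measure Ω} [IsProbabilityMeasure P]
    {F : Filtration ℝ≥0 m} {B : ℝ≥0 → Ω → ℝ} (h : IsFilteredBrownian P F B) {s t : ℝ≥0}
    (hst : s ≤ t) {E : Type*} [MeasurableSpace E] {V : Ω → E} (hV : Measurable[F s] V)
    {f : E → ℝ → ℝ} (hf : Measurable (Function.uncurry f))
    (hi : Integrable (fun ω => f (V ω) (B t ω - B s ω)) P) :
    ∫ ω, f (V ω) (B t ω - B s ω) ∂P = ∫ ω, ∫ y, f (V ω) y ∂(gaussianReal 0 (t - s)) ∂P := by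
  have hV' : Measurable V := hV.mono (F.le s) le_rfl
  have hm : Measurable (fun ω => (V ω, B t ω - B s ω)) :=
    hV'.prodMk ((h.measurable t).sub (h.measurable s))
  have e := h.map_prod hst hV
  have h1 : ∫ ω, f (V ω) (B t ω - B s ω) ∂P
      = ∫ p, Function.uncurry f p ∂(P.map (fun ω => (V ω, B t ω - B s ω))) :=
    (integral_map hm.aemeasurable hf.aestronglyMeasurable).symm
  have hi' : Integrable (Function.uncurry f) (P.map (fun ω => (V ω, B t ω - B s ω))) :=
    (integrable_map_measure hf.aestronglyMeasurable hm.aemeasurable).2 hi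
  rw [h1, e, integral_prod _ (e ▸ hi'), integral_map hV'.aemeasurable]
  · rfl
  · exact (hf.stronglyMeasurable.integral_prod_right').aestronglyMeasurable

/-! ### Densities on the path σ-algebras -/

/-- A density of `Q` on the path σ-algebra at time `t` is the density of the path law. -/
lemma pathDensity_of_forall {Q P : Measure Ω} [IsFiniteMeasure Q] [IsFiniteMeasure P]
    {B : ℝ≥0 → Ω → ℝ} (hB : ∀ t, Measurable (B t)) {t : ℝ≥0} {W : Ω → ℝ≥0∞}
    (hW : Measurable[pathFiltration B hB t] W)
    (hQ : ∀ A, MeasurableSet[pathFiltration B hB t] A → Q A = ∫⁻ ω in A, W ω ∂P) :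
    lawUpTo Q B t ≪ lawUpTo P B t ∧
      ∀ᵐ ω ∂P, pathDensity Q P B t (pathUpTo B t ω) = W ω := by
  have hp := measurable_pathUpTo hB t
  obtain ⟨w, hw, rfl⟩ := Measurable.exists_eq_measurable_comp (f := pathUpTo B t) hW
  have e : lawUpTo Q B t = (lawUpTo P B t).withDensity w := by
    ext A hA
    rw [withDensity_apply _ hA, lawUpTo, lawUpTo, Measure.map_apply hp hA,
      hQ _ ⟨A, hA, rfl⟩, setLIntegral_map hA hw hp]
    rfl
  have : IsFiniteMeasure (lawUpTo P B t) := by unfold lawUpTo; infer_instance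
  have : SigmaFinite (lawUpTo P B t) := inferInstance
  refine ⟨e ▸ withDensity_absolutelyContinuous _ _, ?_⟩
  have h1 : pathDensity Q P B t =ᵐ[lawUpTo P B t] w := by
    unfold pathDensity
    rw [e]
    exact Measure.rnDeriv_withDensity _ hw
  exact ae_of_ae_map hp.aemeasurable h1

lemma measurable_pathDensity {Q P : Measure Ω} {B : ℝ≥0 → Ω → ℝ} (t : ℝ≥0) :
    Measurable (pathDensity Q P B t) := Measure.measurable_rnDeriv _ _

lemma measure_eq_setLIntegral_pathDensity {Q P : Measure Ω} [IsFiniteMeasure Q]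
    [IsFiniteMeasure P] {B : ℝ≥0 → Ω → ℝ} (hB : ∀ t, Measurable (B t)) {t : ℝ≥0}
    (hac : lawUpTo Q B t ≪ lawUpTo P B t) {A : Set Ω}
    (hA : MeasurableSet[pathFiltration B hB t] A) :
    Q A = ∫⁻ ω in A, pathDensity Q P B t (pathUpTo B t ω) ∂P := by
  have hp := measurable_pathUpTo hB t
  obtain ⟨A', hA', rfl⟩ := hA
  have : IsFiniteMeasure (lawUpTo P B t) := by unfold lawUpTo; infer_instance
  have : IsFiniteMeasure (lawUpTo Q B t) := by unfold lawUpTo; infer_instance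
  have h := Measure.withDensity_rnDeriv_eq _ _ hac
  have h1 : lawUpTo Q B t A' = Q (pathUpTo B t ⁻¹' A') := Measure.map_apply hp hA'
  rw [← h1, ← h, withDensity_apply _ hA']
  exact setLIntegral_map hA' (measurable_pathDensity t) hp

/-- If `Q` has density `Z` on the path σ-algebra at time `t`, then the density of the path law
is the conditional expectation of `Z`. -/
lemma pathDensity_eq_condExp {Q P : Measure Ω} [IsFiniteMeasure Q] [IsFiniteMeasure P]
    {B : ℝ≥0 → Ω → ℝ} (hB : ∀ t, Measurable (B t)) {t : ℝ≥0} {Z : Ω → ℝ}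
    (hZ0 : 0 ≤ Z) (hZ : Integrable Z P)
    (hQ : ∀ A, MeasurableSet[pathFiltration B hB t] A →
      Q A = ∫⁻ ω in A, ENNReal.ofReal (Z ω) ∂P) :
    lawUpTo Q B t ≪ lawUpTo P B t ∧
      ∀ᵐ ω ∂P, pathDensity Q P B t (pathUpTo B t ω) =
        ENNReal.ofReal ((P[Z | pathFiltration B hB t]) ω) := by
  have hle : (pathFiltration B hB t : MeasurableSpace Ω) ≤ m := (pathFiltration B hB).le t
  refine pathDensity_of_forall hB (W := fun ω => ENNReal.ofReal ((P[Z | pathFiltration B hB t]) ω))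
    (ENNReal.measurable_ofReal.comp stronglyMeasurable_condExp.measurable) fun A hA => ?_
  have h0 : 0 ≤ᵐ[P] P[Z | pathFiltration B hB t] := condExp_nonneg (ae_of_all _ hZ0)
  rw [hQ A hA, ← ofReal_integral_eq_lintegral_ofReal hZ.integrableOn
      (ae_of_all _ hZ0), ← ofReal_integral_eq_lintegral_ofReal integrable_condExp.integrableOn
      (ae_restrict_of_ae h0), setIntegral_condExp hle hZ hA]

end Path

/-! ### Exponential martingales of simple processes -/

lemma lintegral_exp_gaussian (c : ℝ) (v : ℝ≥0) :
    ∫⁻ y, ENNReal.ofReal (Real.exp (c * y - 1 / 2 * c ^ 2 * v)) ∂(gaussianReal 0 v) = 1 := by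
  have h1 : ∀ y, Real.exp (c * y - 1 / 2 * c ^ 2 * v)
      = Real.exp (-(1 / 2 * c ^ 2 * v)) * Real.exp (c * y) := by
    intro y; rw [← Real.exp_add]; ring_nf
  have hi : Integrable (fun y => Real.exp (c * y)) (gaussianReal 0 v) :=
    integrable_exp_mul_gaussianReal c
  simp_rw [h1]
  rw [← ofReal_integral_eq_lintegral_ofReal (hi.const_mul _) (ae_of_all _ fun y => by positivity),
    integral_const_mul]
  have h2 : ∫ y, Real.exp (c * y) ∂(gaussianReal 0 v) = Real.exp (v * c ^ 2 / 2) := by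
    have := congrFun (mgf_id_gaussianReal (μ := 0) (v := v)) c
    simpa [mgf] using this
  rw [h2, ← Real.exp_add]
  ring_nf
  simp

namespace SimpleProc

variable {Ω : Type u} {m : MeasurableSpace Ω} {F : Filtration ℝ≥0 m}

/-- The exponent `∫₀ᵗ H dB - (1/2) ∫₀ᵗ H² ds`, restricted to the first `n` steps of `H`. -/
noncomputable def exponent (H : SimpleProc F) (B : ℝ≥0 → Ω → ℝ) (n : ℕ) (t : ℝ≥0) (ω : Ω) : ℝ :=
  ∑ k ∈ Finset.range n, (H.ξ k ω * (B (min (H.τ (k + 1)) t) ω - B (min (H.τ k) t) ω) -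
    1 / 2 * H.ξ k ω ^ 2 * ((min (H.τ (k + 1)) t : ℝ≥0) - (min (H.τ k) t : ℝ≥0) : ℝ))

/-- The stochastic exponential `exp (∫₀ᵗ H dB - (1/2) ∫₀ᵗ H² ds)`. -/
noncomputable def stochExp (H : SimpleProc F) (B : ℝ≥0 → Ω → ℝ) (t : ℝ≥0) (ω : Ω) : ℝ :=
  Real.exp (H.exponent B H.n t ω)

lemma exponent_succ (H : SimpleProc F) (B : ℝ≥0 → Ω → ℝ) (n : ℕ) (t : ℝ≥0) (ω : Ω) :
    H.exponent B (n + 1) t ω = H.exponent B n t ω +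
      (H.ξ n ω * (B (min (H.τ (n + 1)) t) ω - B (min (H.τ n) t) ω) -
    1 / 2 * H.ξ n ω ^ 2 * ((min (H.τ (n + 1)) t : ℝ≥0) - (min (H.τ n) t : ℝ≥0) : ℝ)) :=
  Finset.sum_range_succ _ _

lemma exponent_of_le (H : SimpleProc F) (B : ℝ≥0 → Ω → ℝ) {n : ℕ} {t : ℝ≥0} (h : H.τ n ≤ t)
    (ω : Ω) : H.exponent B n t ω = H.exponent B n (H.τ n) ω := by
  refine Finset.sum_congr rfl fun k hk => ?_
  have hk' : k + 1 ≤ n := Finset.mem_range.1 hk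
  have h1 := H.mono hk'
  have h2 := H.mono (k.le_succ.trans hk')
  rw [min_eq_left (h1.trans h), min_eq_left (h2.trans h), min_eq_left h1, min_eq_left h2]

lemma exponent_zero_time (H : SimpleProc F) (B : ℝ≥0 → Ω → ℝ) (n : ℕ) (ω : Ω) :
    H.exponent B n 0 ω = 0 := by
  refine Finset.sum_eq_zero fun k _ => ?_
  simp

lemma measurable_exponent (H : SimpleProc F) {B : ℝ≥0 → Ω → ℝ} (hB : Adapted F B) (n : ℕ)
    (t : ℝ≥0) : Measurable[F t] (H.exponent B n t) := by
  refine Finset.measurable_fun_sum _ fun k _ => ?_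
  rcases le_total (H.τ k) t with h | h
  · have h1 : Measurable[F t] (H.ξ k) := (H.meas k).mono (F.mono h) le_rfl
    have h2 : Measurable[F t] (B (min (H.τ (k + 1)) t)) :=
      (hB _).mono (F.mono (min_le_right _ _)) le_rfl
    have h3 : Measurable[F t] (B (min (H.τ k) t)) :=
      (hB _).mono (F.mono (min_le_right _ _)) le_rfl
    exact (h1.mul (h2.sub h3)).sub (((h1.pow_const 2).const_mul _).mul_const _)
  · have h' : t ≤ H.τ (k + 1) := h.trans (H.mono k.le_succ)
    rw [min_eq_right h, min_eq_right h']
    simp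

lemma lintegral_exp_step {P : Measure Ω} [IsProbabilityMeasure P] {B : ℝ≥0 → Ω → ℝ}
    (h : IsFilteredBrownian P F B) {a b : ℝ≥0} (hab : a ≤ b) {X : Ω → ℝ≥0∞} {ξ : Ω → ℝ}
    (hX : Measurable[F a] X) (hξ : Measurable[F a] ξ) :
    ∫⁻ ω, X ω * ENNReal.ofReal (Real.exp (ξ ω * (B b ω - B a ω) -
      1 / 2 * ξ ω ^ 2 * ((b : ℝ) - a))) ∂P = ∫⁻ ω, X ω ∂P := by
  have h1 := h.lintegral_increment hab (V := fun ω => (X ω, ξ ω)) (hX.prodMk hξ)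
    (f := fun p y => p.1 * ENNReal.ofReal (Real.exp (p.2 * y -
      1 / 2 * p.2 ^ 2 * ((b - a : ℝ≥0) : ℝ)))) (by unfold Function.uncurry; fun_prop)
  rw [← NNReal.coe_sub hab]
  rw [h1]
  refine lintegral_congr fun ω => ?_
  rw [lintegral_const_mul _ (by fun_prop), lintegral_exp_gaussian, mul_one]

/-- The exponential martingale property of simple processes. -/
lemma lintegral_mul_exponent (H : SimpleProc F) {P : Measure Ω} [IsProbabilityMeasure P]
    {B : ℝ≥0 → Ω → ℝ} (h : IsFilteredBrownian P F B) (n : ℕ) :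
    ∀ {s t : ℝ≥0}, s ≤ t → ∀ {X : Ω → ℝ≥0∞}, Measurable[F s] X →
    ∫⁻ ω, X ω * ENNReal.ofReal (Real.exp (H.exponent B n t ω)) ∂P =
      ∫⁻ ω, X ω * ENNReal.ofReal (Real.exp (H.exponent B n s ω)) ∂P := by
  induction n with
  | zero => intros; simp [exponent]
  | succ n ih =>
    intro s t hst X hX
    have hmn : H.τ n ≤ H.τ (n + 1) := H.mono n.le_succ
    simp_rw [exponent_succ, Real.exp_add, ENNReal.ofReal_mul (Real.exp_nonneg _), ← mul_assoc]
    have hmE : ∀ r, Measurable[F r] fun ω => ENNReal.ofReal (Real.exp (H.exponent B n r ω)) :=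
      fun r => (H.measurable_exponent h.adapted n r).exp.ennreal_ofReal
    rcases le_total t (H.τ n) with h1 | h1
    · have h2 := hst.trans h1
      rw [min_eq_right h1, min_eq_right h2, min_eq_right (h1.trans hmn),
        min_eq_right (h2.trans hmn)]
      simpa using ih hst hX
    rcases le_total s (H.τ n) with h2 | h2
    · rw [min_eq_right h2, min_eq_right (h2.trans hmn), min_eq_left h1]
      have h3 := lintegral_exp_step h (a := H.τ n) (b := min (H.τ (n + 1)) t) (le_min hmn h1)
        (X := fun ω => X ω * ENNReal.ofReal (Real.exp (H.exponent B n t ω))) (ξ := H.ξ n)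
        (by
          simp_rw [H.exponent_of_le B h1]
          exact (hX.mono (F.mono h2) le_rfl).mul (hmE _)) (H.meas n)
      rw [h3, ih hst hX]
      simp
    · have e1 : ∀ ω, H.exponent B n t ω = H.exponent B n s ω := fun ω => by
        rw [H.exponent_of_le B h1, H.exponent_of_le B h2]
      simp_rw [e1]
      rw [min_eq_left h1, min_eq_left h2]
      rcases le_total (H.τ (n + 1)) s with h3 | h3
      · rw [min_eq_left h3, min_eq_left (h3.trans hst)]
      · rw [min_eq_right h3]
        have hξ : Measurable[F s] (H.ξ n) := (H.meas n).mono (F.mono h2) le_rfl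
        have h4 := lintegral_exp_step h (a := s) (b := min (H.τ (n + 1)) t) (le_min h3 hst)
          (X := fun ω => X ω * ENNReal.ofReal (Real.exp (H.exponent B n s ω)) *
            ENNReal.ofReal (Real.exp (H.ξ n ω * (B s ω - B (H.τ n) ω) -
              1 / 2 * H.ξ n ω ^ 2 * ((s : ℝ) - H.τ n)))) (ξ := H.ξ n)
          (by
            refine (hX.mul (hmE s)).mul (Measurable.ennreal_ofReal (Measurable.exp ?_))
            exact (hξ.mul ((h.adapted s).sub ((h.adapted _).mono (F.mono h2) le_rfl))).sub
              (((hξ.pow_const 2).const_mul _).mul_const _)) hξ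
        rw [← h4]
        refine lintegral_congr fun ω => ?_
        rw [mul_assoc (X ω * _), ← ENNReal.ofReal_mul (Real.exp_nonneg _), ← Real.exp_add]
        congr 3
        ring

lemma measurable_stochExp (H : SimpleProc F) {B : ℝ≥0 → Ω → ℝ} (hB : Adapted F B)
    (t : ℝ≥0) : Measurable[F t] (H.stochExp B t) :=
  (H.measurable_exponent hB _ t).exp

lemma lintegral_mul_stochExp (H : SimpleProc F) {P : Measure Ω} [IsProbabilityMeasure P]
    {B : ℝ≥0 → Ω → ℝ} (h : IsFilteredBrownian P F B) {s t : ℝ≥0} (hst : s ≤ t) {X : Ω → ℝ≥0∞}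
    (hX : Measurable[F s] X) :
    ∫⁻ ω, X ω * ENNReal.ofReal (H.stochExp B t ω) ∂P =
      ∫⁻ ω, X ω * ENNReal.ofReal (H.stochExp B s ω) ∂P :=
  H.lintegral_mul_exponent h H.n hst hX

lemma lintegral_stochExp (H : SimpleProc F) {P : Measure Ω} [IsProbabilityMeasure P]
    {B : ℝ≥0 → Ω → ℝ} (h : IsFilteredBrownian P F B) (t : ℝ≥0) :
    ∫⁻ ω, ENNReal.ofReal (H.stochExp B t ω) ∂P = 1 := by
  have := H.lintegral_mul_stochExp h (zero_le : 0 ≤ t) (X := fun _ => 1) measurable_const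
  simpa [stochExp, exponent_zero_time] using this

lemma stochExp_of_le (H : SimpleProc F) (B : ℝ≥0 → Ω → ℝ) {t : ℝ≥0} (h : H.τ H.n ≤ t) (ω : Ω) :
    H.stochExp B t ω = H.stochExp B (H.τ H.n) ω := by
  unfold stochExp; rw [H.exponent_of_le B h]

lemma sq_eval (H : SimpleProc F) (s : ℝ≥0) (ω : Ω) :
    H.eval s ω ^ 2 = ∑ k ∈ Finset.range H.n,
      (Ioc (H.τ k) (H.τ (k + 1))).indicator (fun _ => H.ξ k ω ^ 2) s := by
  unfold eval
  by_cases hs : ∃ k ∈ Finset.range H.n, s ∈ Ioc (H.τ k) (H.τ (k + 1))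
  · obtain ⟨k, hk, hks⟩ := hs
    have hne : ∀ j ∈ Finset.range H.n, j ≠ k → s ∉ Ioc (H.τ j) (H.τ (j + 1)) := by
      intro j _ hjk hj
      exact Set.disjoint_left.1 (H.mono.pairwise_disjoint_on_Ioc_succ hjk) hj hks
    rw [Finset.sum_eq_single_of_mem k hk fun j hj hjk => indicator_of_notMem (hne j hj hjk) _,
      Finset.sum_eq_single_of_mem k hk fun j hj hjk => indicator_of_notMem (hne j hj hjk) _,
      indicator_of_mem hks, indicator_of_mem hks]
  · push Not at hs
    rw [Finset.sum_eq_zero fun k hk => indicator_of_notMem (hs k hk) _,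
      Finset.sum_eq_zero fun k hk => indicator_of_notMem (hs k hk) _]
    simp

lemma energy_eval (H : SimpleProc F) (t : ℝ≥0) (ω : Ω) :
    energy H.eval t ω = ENNReal.ofReal (∑ k ∈ Finset.range H.n,
      H.ξ k ω ^ 2 * ((min (H.τ (k + 1)) t : ℝ≥0) - (min (H.τ k) t : ℝ≥0) : ℝ)) := by
  have hnn : ∀ k, 0 ≤ ((min (H.τ (k + 1)) t : ℝ≥0) - (min (H.τ k) t : ℝ≥0) : ℝ) := fun k => by
    rw [sub_nonneg]; exact_mod_cast min_le_min_right t (H.mono k.le_succ)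
  unfold energy
  rw [ENNReal.ofReal_sum_of_nonneg fun k _ => mul_nonneg (sq_nonneg _) (hnn k)]
  simp_rw [H.sq_eval]
  have : ∀ s, ENNReal.ofReal (∑ k ∈ Finset.range H.n,
      (Ioc (H.τ k) (H.τ (k + 1))).indicator (fun _ => H.ξ k ω ^ 2) s)
      = ∑ k ∈ Finset.range H.n,
      (Ioc (H.τ k) (H.τ (k + 1))).indicator (fun _ => ENNReal.ofReal (H.ξ k ω ^ 2)) s := by
    intro s
    rw [ENNReal.ofReal_sum_of_nonneg fun k _ => indicator_nonneg (fun _ _ => sq_nonneg _) _]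
    refine Finset.sum_congr rfl fun k _ => ?_
    by_cases hs : s ∈ Ioc (H.τ k) (H.τ (k + 1)) <;> simp [hs]
  simp_rw [this]
  rw [lintegral_finsetSum _ fun k _ => measurable_const.indicator measurableSet_Ioc]
  refine Finset.sum_congr rfl fun k _ => ?_
  rw [lintegral_indicator_const measurableSet_Ioc, ENNReal.ofReal_mul (sq_nonneg _),
    Measure.restrict_apply measurableSet_Ioc]
  congr 1
  have e : Ioc (H.τ k) (H.τ (k + 1)) ∩ Iic t = Ioc (H.τ k) (min (H.τ (k + 1)) t) := by
    ext x; simp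
  rw [e, timeMeasure_Ioc]
  rcases le_total (H.τ k) t with h | h
  · rw [min_eq_left h]
  · have h' : t ≤ H.τ (k + 1) := h.trans (H.mono k.le_succ)
    rw [min_eq_right h, min_eq_right h', sub_self, ENNReal.ofReal_zero,
      ENNReal.ofReal_eq_zero.2]
    rw [sub_nonpos]; exact_mod_cast h

lemma stochExp_eq (H : SimpleProc F) (B : ℝ≥0 → Ω → ℝ) (t : ℝ≥0) (ω : Ω) :
    H.stochExp B t ω =
      Real.exp (H.integral B t ω - 1 / 2 * (energy H.eval t ω).toReal) := by
  have hnn : ∀ k, 0 ≤ ((min (H.τ (k + 1)) t : ℝ≥0) - (min (H.τ k) t : ℝ≥0) : ℝ) := fun k => by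
    rw [sub_nonneg]; exact_mod_cast min_le_min_right t (H.mono k.le_succ)
  rw [H.energy_eval, ENNReal.toReal_ofReal
    (Finset.sum_nonneg fun k _ => mul_nonneg (sq_nonneg _) (hnn k))]
  unfold stochExp exponent integral
  rw [Finset.sum_sub_distrib, Finset.mul_sum]
  congr 2
  exact Finset.sum_congr rfl fun k _ => by ring

lemma isItoIntegral (H : SimpleProc F) (P : Measure Ω) (B : ℝ≥0 → Ω → ℝ) (t : ℝ≥0) :
    IsItoIntegral P F B H.eval t (H.integral B t) := by
  refine ⟨fun _ => H, fun ε hε => ?_, ?_⟩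
  · have : ∀ ω, energy (fun s ω => H.eval s ω - H.eval s ω) t ω = 0 := fun ω => by
      simp [energy]
    simp_rw [this]
    have e : {ω : Ω | ε ≤ 0} = ∅ := by
      ext; simp [hε.ne']
    rw [e, measure_empty]
    exact tendsto_const_nhds
  · intro ε hε
    simp [hε.ne']

lemma isProgressive_eval (H : SimpleProc F) : IsProgressive F H.eval := by
  have : H.eval = fun s ω => ∑ k ∈ Finset.range H.n,
    (fun s ω => (Ioc (H.τ k) (H.τ (k + 1))).indicator (fun _ => H.ξ k ω) s) s ω := rfl
  rw [this]
  refine IsProgressive.finsetSum fun k _ i => ?_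
  rcases le_total i (H.τ k) with h | h
  · have : (fun p : Iic i × Ω => (Ioc (H.τ k) (H.τ (k + 1))).indicator (fun _ => H.ξ k p.2)
        (p.1 : ℝ≥0)) = fun _ => 0 := by
      funext p
      exact indicator_of_notMem (fun hp => (hp.1.trans_le (p.1.2.trans h)).false) _
    rw [this]
    exact measurable_const
  · have hξ : Measurable[F i] (H.ξ k) := (H.meas k).mono (F.mono h) le_rfl
    have : (fun p : Iic i × Ω => (Ioc (H.τ k) (H.τ (k + 1))).indicator (fun _ => H.ξ k p.2)
        (p.1 : ℝ≥0)) = {p : Iic i × Ω | (p.1 : ℝ≥0) ∈ Ioc (H.τ k) (H.τ (k + 1))}.indicator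
          fun p => H.ξ k p.2 := by
      funext p
      rfl
    rw [this]
    refine Measurable.indicator ?_ ?_
    · exact hξ.comp (@measurable_snd _ _ _ (F i))
    · exact (measurable_subtype_coe.comp (@measurable_fst _ _ _ (F i))) measurableSet_Ioc

/-- A simple process is simple for every larger filtration. -/
def ofLE {G : Filtration ℝ≥0 m} (hFG : ∀ t, F t ≤ G t) (H : SimpleProc F) : SimpleProc G where
  n := H.n
  τ := H.τ
  ξ := H.ξ
  mono := H.mono
  meas k := (H.meas k).mono (hFG _) le_rfl
  bdd := H.bdd

lemma energy_eval_le (H : SimpleProc F) : ∃ c : ℝ, 0 ≤ c ∧ (∀ s ω, H.eval s ω ^ 2 ≤ c) ∧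
    ∀ t ω, energy H.eval t ω ≤ ENNReal.ofReal c := by
  obtain ⟨c, hc⟩ := H.bdd
  have hsq : ∀ k ω, H.ξ k ω ^ 2 ≤ c ^ 2 := fun k ω => by
    have := hc k ω
    rw [← sq_abs]
    gcongr
  refine ⟨∑ k ∈ Finset.range H.n, c ^ 2 * (1 + (H.τ (k + 1) : ℝ)), ?_, fun s ω => ?_,
    fun t ω => ?_⟩
  · exact Finset.sum_nonneg fun k _ => by positivity
  · rw [H.sq_eval]
    refine Finset.sum_le_sum fun k _ => ?_
    have h0 : 0 ≤ c ^ 2 * (1 + (H.τ (k + 1) : ℝ)) := by positivity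
    refine (indicator_le_self' (fun _ _ => sq_nonneg _) s).trans ((hsq k ω).trans ?_)
    nlinarith [sq_nonneg c, (H.τ (k + 1)).2]
  · rw [H.energy_eval]
    refine ENNReal.ofReal_le_ofReal (Finset.sum_le_sum fun k _ => ?_)
    have hnn : 0 ≤ ((min (H.τ (k + 1)) t : ℝ≥0) - (min (H.τ k) t : ℝ≥0) : ℝ) := by
      rw [sub_nonneg]; exact_mod_cast min_le_min_right t (H.mono k.le_succ)
    have h1 : ((min (H.τ (k + 1)) t : ℝ≥0) : ℝ) ≤ H.τ (k + 1) := by exact_mod_cast min_le_left _ _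
    have h2 : (0 : ℝ) ≤ (min (H.τ k) t : ℝ≥0) := NNReal.coe_nonneg _
    exact mul_le_mul (hsq k ω) (by linarith) hnn (sq_nonneg c)

end SimpleProc

/-! ### Gaussian integrals of trigonometric and exponential functions -/

lemma integrable_fun_sub {α : Type*} {_ : MeasurableSpace α} {μ : Measure α} {f g : α → ℝ}
    (hf : Integrable f μ) (hg : Integrable g μ) : Integrable (fun x => f x - g x) μ := hf.sub hg

lemma exp_sub_one_sub_le {x : ℝ} (hx : 0 ≤ x) : Real.exp x - 1 - x ≤ x ^ 2 * Real.exp x := by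
  have h1 : 1 - x ≤ Real.exp (-x) := by linarith [Real.add_one_le_exp (-x)]
  have h2 : Real.exp x * Real.exp (-x) = 1 := by rw [← Real.exp_add]; simp
  have h3 := Real.exp_pos x
  have h4 : (1 - x) * Real.exp x ≤ 1 := by nlinarith
  nlinarith

lemma integrable_mul_cexp_gaussian (z : ℂ) (v : ℝ≥0) :
    Integrable (fun y : ℝ => (y : ℂ) * Complex.exp (z * y)) (gaussianReal 0 v) := by
  have h := integrable_pow_mul_cexp_of_re_mem_interior_integrableExpSet
    (X := id) (μ := gaussianReal 0 v) (z := z) (by simp [integrableExpSet_id_gaussianReal]) 1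
  simpa using h

lemma integrable_cexp_gaussian (z : ℂ) (v : ℝ≥0) :
    Integrable (fun y : ℝ => Complex.exp (z * y)) (gaussianReal 0 v) := by
  have h := integrable_pow_mul_cexp_of_re_mem_interior_integrableExpSet
    (X := id) (μ := gaussianReal 0 v) (z := z) (by simp [integrableExpSet_id_gaussianReal]) 0
  simpa using h

lemma integral_cexp_gaussian (z : ℂ) (v : ℝ≥0) :
    ∫ y : ℝ, Complex.exp (z * y) ∂(gaussianReal 0 v) = Complex.exp (v * z ^ 2 / 2) := by
  have := complexMGF_id_gaussianReal (μ := 0) (v := v) z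
  simpa [complexMGF] using this

lemma integral_mul_cexp_gaussian (z : ℂ) (v : ℝ≥0) :
    ∫ y : ℝ, (y : ℂ) * Complex.exp (z * y) ∂(gaussianReal 0 v) =
      v * z * Complex.exp (v * z ^ 2 / 2) := by
  have h1 := hasDerivAt_complexMGF (X := id) (μ := gaussianReal 0 v) (z := z)
    (by simp [integrableExpSet_id_gaussianReal])
  have h2 : complexMGF id (gaussianReal 0 v) = fun z => Complex.exp (v * z ^ 2 / 2) := by
    funext z
    simpa using complexMGF_id_gaussianReal (μ := 0) (v := v) z
  rw [h2] at h1
  have h3 : HasDerivAt (fun z : ℂ => Complex.exp (v * z ^ 2 / 2))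
      (Complex.exp (v * z ^ 2 / 2) * (v * (2 * z) / 2)) z := by
    have := (((hasDerivAt_pow 2 z).const_mul (v : ℂ)).div_const 2).cexp
    simpa using this
  have := h1.unique h3
  simp only [id] at this
  rw [this]
  ring

lemma integral_cos_gaussian (b : ℝ) (v : ℝ≥0) :
    ∫ y, Real.cos (b * y) ∂(gaussianReal 0 v) = Real.exp (-(b ^ 2 * v) / 2) := by
  have h2 := congrArg Complex.re (integral_cexp_gaussian (b * Complex.I) v)
  have h3 := integral_re (integrable_cexp_gaussian (b * Complex.I) v)
  have e : (v : ℂ) * (b * Complex.I) ^ 2 / 2 = ((-(b ^ 2 * v) / 2 : ℝ) : ℂ) := by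
    push_cast; rw [mul_pow, Complex.I_sq]; ring
  rw [e, Complex.exp_ofReal_re] at h2
  rw [← h2]
  refine Eq.trans (integral_congr_ae (ae_of_all _ fun y => ?_)) h3
  simp [Complex.exp_re]

lemma integral_sin_gaussian (b : ℝ) (v : ℝ≥0) :
    ∫ y, Real.sin (b * y) ∂(gaussianReal 0 v) = 0 := by
  have h2 := congrArg Complex.im (integral_cexp_gaussian (b * Complex.I) v)
  have h3 := integral_im (integrable_cexp_gaussian (b * Complex.I) v)
  have e : (v : ℂ) * (b * Complex.I) ^ 2 / 2 = ((-(b ^ 2 * v) / 2 : ℝ) : ℂ) := by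
    push_cast; rw [mul_pow, Complex.I_sq]; ring
  rw [e, Complex.exp_ofReal_im] at h2
  refine Eq.trans (integral_congr_ae (ae_of_all _ fun y => ?_)) (h3.trans h2)
  simp [Complex.exp_im]

lemma integral_mul_sin_gaussian (b : ℝ) (v : ℝ≥0) :
    ∫ y, y * Real.sin (b * y) ∂(gaussianReal 0 v) = v * b * Real.exp (-(b ^ 2 * v) / 2) := by
  have h2 := congrArg Complex.im (integral_mul_cexp_gaussian (b * Complex.I) v)
  have h3 := integral_im (integrable_mul_cexp_gaussian (b * Complex.I) v)
  have e : (v : ℂ) * (b * Complex.I) ^ 2 / 2 = ((-(b ^ 2 * v) / 2 : ℝ) : ℂ) := by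
    push_cast; rw [mul_pow, Complex.I_sq]; ring
  rw [e, ← Complex.ofReal_exp] at h2
  have e2 : ((v : ℂ) * (b * Complex.I) * (Real.exp (-(b ^ 2 * v) / 2) : ℝ)).im
      = v * b * Real.exp (-(b ^ 2 * v) / 2) := by
    rw [Complex.im_mul_ofReal]; simp
  rw [e2] at h2
  rw [← h2]
  refine Eq.trans (integral_congr_ae (ae_of_all _ fun y => ?_)) h3
  simp [Complex.exp_im, Complex.mul_im]

lemma integral_exp_gaussian (c : ℝ) (v : ℝ≥0) :
    ∫ y, Real.exp (c * y) ∂(gaussianReal 0 v) = Real.exp (c ^ 2 * v / 2) := by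
  have := congrFun (mgf_id_gaussianReal (μ := 0) (v := v)) c
  simpa [mgf, mul_comm] using this

lemma integral_mul_exp_gaussian (c : ℝ) (v : ℝ≥0) :
    ∫ y, y * Real.exp (c * y) ∂(gaussianReal 0 v) = v * c * Real.exp (c ^ 2 * v / 2) := by
  have h2 := congrArg Complex.re (integral_mul_cexp_gaussian c v)
  have h3 := integral_re (integrable_mul_cexp_gaussian c v)
  have e : (v : ℂ) * (c : ℂ) * Complex.exp (v * (c : ℂ) ^ 2 / 2)
      = ((v * c * Real.exp (c ^ 2 * v / 2) : ℝ) : ℂ) := by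
    push_cast; ring_nf
  rw [e, Complex.ofReal_re] at h2
  rw [← h2]
  refine Eq.trans (integral_congr_ae (ae_of_all _ fun y => ?_)) h3
  simp [← Complex.ofReal_mul, ← Complex.ofReal_exp]

lemma integrable_mul_exp_gaussian (c : ℝ) (v : ℝ≥0) :
    Integrable (fun y => y * Real.exp (c * y)) (gaussianReal 0 v) := by
  refine (integrable_mul_cexp_gaussian c v).re.congr (ae_of_all _ fun y => ?_)
  simp [← Complex.ofReal_mul, ← Complex.ofReal_exp]

lemma integrable_id_gaussian (v : ℝ≥0) : Integrable (fun y : ℝ => y) (gaussianReal 0 v) := by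
  simpa using integrable_mul_exp_gaussian 0 v

lemma integrable_sq_gaussian (v : ℝ≥0) : Integrable (fun y : ℝ => y ^ 2) (gaussianReal 0 v) := by
  have := (memLp_id_gaussianReal (μ := 0) (v := v) 2).integrable_sq
  simpa using this

lemma integral_id_gaussian (v : ℝ≥0) : ∫ y, y ∂(gaussianReal 0 v) = 0 := by
  simp

lemma integral_sq_gaussian (v : ℝ≥0) : ∫ y, y ^ 2 ∂(gaussianReal 0 v) = v := by
  have h := variance_eq_integral (μ := gaussianReal 0 v) (X := id) (by fun_prop)
  rw [variance_id_gaussianReal] at h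
  simpa using h.symm

lemma integrable_cos_gaussian (b : ℝ) (v : ℝ≥0) :
    Integrable (fun y => Real.cos (b * y)) (gaussianReal 0 v) :=
  Integrable.of_bound (by fun_prop) 1 (ae_of_all _ fun y => Real.abs_cos_le_one _)

lemma integrable_sin_gaussian (b : ℝ) (v : ℝ≥0) :
    Integrable (fun y => Real.sin (b * y)) (gaussianReal 0 v) :=
  Integrable.of_bound (by fun_prop) 1 (ae_of_all _ fun y => Real.abs_sin_le_one _)

lemma integrable_mul_sin_gaussian (b : ℝ) (v : ℝ≥0) :
    Integrable (fun y => y * Real.sin (b * y)) (gaussianReal 0 v) :=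
  (integrable_id_gaussian v).mul_bdd (c := 1) (by fun_prop)
    (ae_of_all _ fun y => Real.abs_sin_le_one _)

/-- Remainder of the second-order expansion of the cosine of a Gaussian increment. -/
noncomputable def cosRem (b : ℝ) (v : ℝ≥0) (y : ℝ) : ℝ :=
  Real.exp (b ^ 2 * v / 2) * Real.cos (b * y) - 1

/-- Remainder of the second-order expansion of the sine of a Gaussian increment. -/
noncomputable def sinRem (b : ℝ) (v : ℝ≥0) (y : ℝ) : ℝ :=
  Real.exp (b ^ 2 * v / 2) * Real.sin (b * y) - b * y

/-- Remainder of the expansion of the exponential martingale over one increment. -/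
noncomputable def expRem (c : ℝ) (v : ℝ≥0) (y : ℝ) : ℝ :=
  Real.exp (c * y - 1 / 2 * c ^ 2 * v) - 1 - c * y

lemma integral_cosRem (b : ℝ) (v : ℝ≥0) : ∫ y, cosRem b v y ∂(gaussianReal 0 v) = 0 := by
  unfold cosRem
  rw [integral_sub ((integrable_cos_gaussian b v).const_mul _) (integrable_const _),
    integral_const_mul, integral_cos_gaussian, ← Real.exp_add]
  ring_nf
  simp

lemma integral_sinRem (b : ℝ) (v : ℝ≥0) : ∫ y, sinRem b v y ∂(gaussianReal 0 v) = 0 := by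
  unfold sinRem
  rw [integral_sub ((integrable_sin_gaussian b v).const_mul _)
    ((integrable_id_gaussian v).const_mul _), integral_const_mul, integral_const_mul,
    integral_sin_gaussian, integral_id_gaussian]
  simp

lemma integral_expRem (c : ℝ) (v : ℝ≥0) : ∫ y, expRem c v y ∂(gaussianReal 0 v) = 0 := by
  have h1 : ∀ y, expRem c v y
      = Real.exp (-(1 / 2 * c ^ 2 * v)) * Real.exp (c * y) - 1 - c * y := by
    intro y; unfold expRem; rw [← Real.exp_add]; ring_nf
  simp_rw [h1]
  have i1 : Integrable (fun y => Real.exp (-(1 / 2 * c ^ 2 * v)) * Real.exp (c * y))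
    (gaussianReal 0 v) := (integrable_exp_mul_gaussianReal c).const_mul _
  have i2 : Integrable (fun y => c * y) (gaussianReal 0 v) :=
    (integrable_id_gaussian v).const_mul _
  rw [integral_sub (integrable_fun_sub i1 (integrable_const _)) i2,
    integral_sub i1 (integrable_const _), integral_const_mul, integral_const_mul,
    integral_exp_gaussian, integral_id_gaussian,
    ← Real.exp_add]
  ring_nf
  simp

lemma sq_expRem (c : ℝ) (v : ℝ≥0) (y : ℝ) : expRem c v y ^ 2 =
    Real.exp (-(c ^ 2 * v)) * Real.exp (2 * c * y) + 1 + c ^ 2 * y ^ 2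
      - 2 * Real.exp (-(c ^ 2 * v / 2)) * Real.exp (c * y)
      - 2 * c * Real.exp (-(c ^ 2 * v / 2)) * (y * Real.exp (c * y)) + 2 * c * y := by
  have e1 : Real.exp (c * y - 1 / 2 * c ^ 2 * v)
      = Real.exp (-(c ^ 2 * v / 2)) * Real.exp (c * y) := by rw [← Real.exp_add]; ring_nf
  have e2 : Real.exp (-(c ^ 2 * v)) * Real.exp (2 * c * y)
      = (Real.exp (-(c ^ 2 * v / 2)) * Real.exp (c * y)) ^ 2 := by
    rw [← Real.exp_add, ← Real.exp_add, ← Real.exp_nat_mul]; push_cast; ring_nf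
  unfold expRem
  rw [e1, e2]
  ring

lemma integrable_sq_expRem (c : ℝ) (v : ℝ≥0) :
    Integrable (fun y => expRem c v y ^ 2) (gaussianReal 0 v) := by
  simp_rw [sq_expRem]
  have i1 := integrable_exp_mul_gaussianReal (μ := 0) (v := v) (2 * c)
  have i2 := integrable_exp_mul_gaussianReal (μ := 0) (v := v) c
  have i3 := integrable_mul_exp_gaussian c v
  have i4 := integrable_id_gaussian v
  have i5 := integrable_sq_gaussian v
  exact ((((((i1.const_mul _).add (integrable_const _)).add (i5.const_mul _)).sub
    (i2.const_mul _)).sub (i3.const_mul _)).add (i4.const_mul _))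

lemma integral_sq_expRem_le (c : ℝ) (v : ℝ≥0) :
    ∫ y, expRem c v y ^ 2 ∂(gaussianReal 0 v) ≤ (c ^ 2 * v) ^ 2 * Real.exp (c ^ 2 * v) := by
  simp_rw [sq_expRem]
  have i1 := (integrable_exp_mul_gaussianReal (μ := 0) (v := v) (2 * c)).const_mul
    (Real.exp (-(c ^ 2 * v)))
  have i2 := (integrable_exp_mul_gaussianReal (μ := 0) (v := v) c).const_mul
    (2 * Real.exp (-(c ^ 2 * v / 2)))
  have i3 := (integrable_mul_exp_gaussian c v).const_mul (2 * c * Real.exp (-(c ^ 2 * v / 2)))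
  have i4 := (integrable_id_gaussian v).const_mul (2 * c)
  have i5 := (integrable_sq_gaussian v).const_mul (c ^ 2)
  have i0 : Integrable (fun _ : ℝ => (1 : ℝ)) (gaussianReal 0 v) := integrable_const _
  have j1 := i1.fun_add i0
  have j2 := j1.fun_add i5
  have j3 := integrable_fun_sub j2 i2
  rw [integral_add (integrable_fun_sub j3 i3) i4, integral_sub j3 i3, integral_sub j2 i2,
    integral_add j1 i5, integral_add i1 i0]
  have j4 : ∫ y, 2 * c * y ∂(gaussianReal 0 v) = 0 := by
    rw [integral_const_mul, integral_id_gaussian, mul_zero]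
  rw [j4]
  simp only [integral_const_mul]
  rw [integral_exp_gaussian, integral_exp_gaussian, integral_mul_exp_gaussian,
    integral_sq_gaussian]
  have e1 : Real.exp (-(c ^ 2 * v)) * Real.exp ((2 * c) ^ 2 * v / 2) = Real.exp (c ^ 2 * v) := by
    rw [← Real.exp_add]; ring_nf
  have e2 : Real.exp (-(c ^ 2 * v / 2)) * Real.exp (c ^ 2 * v / 2) = 1 := by
    rw [← Real.exp_add]; simp
  have e3 : 2 * c * Real.exp (-(c ^ 2 * v / 2)) * (v * c * Real.exp (c ^ 2 * v / 2))
      = 2 * (c ^ 2 * v) * (Real.exp (-(c ^ 2 * v / 2)) * Real.exp (c ^ 2 * v / 2)) := by ring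
  have h := exp_sub_one_sub_le (x := c ^ 2 * v) (by positivity)
  rw [e1, mul_assoc 2 (Real.exp _), e2, e3, e2]
  simp
  linarith

lemma integral_sq_cosRem_le (b : ℝ) (v : ℝ≥0) :
    ∫ y, cosRem b v y ^ 2 ∂(gaussianReal 0 v) ≤ (b ^ 2 * v) ^ 2 * Real.exp (b ^ 2 * v) := by
  have e : ∀ y, cosRem b v y ^ 2 = Real.exp (b ^ 2 * v) / 2 * Real.cos (2 * b * y)
      + (Real.exp (b ^ 2 * v) / 2 + 1) - 2 * Real.exp (b ^ 2 * v / 2) * Real.cos (b * y) := by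
    intro y
    have e1 : Real.exp (b ^ 2 * v) = Real.exp (b ^ 2 * v / 2) ^ 2 := by
      rw [← Real.exp_nat_mul]; push_cast; ring_nf
    have e2 : Real.cos (2 * b * y) = 2 * Real.cos (b * y) ^ 2 - 1 := by
      rw [mul_assoc, Real.cos_two_mul]
    unfold cosRem
    rw [e1, e2]; ring
  simp_rw [e]
  have i1 := (integrable_cos_gaussian (2 * b) v).const_mul (Real.exp (b ^ 2 * v) / 2)
  have i2 := (integrable_cos_gaussian b v).const_mul (2 * Real.exp (b ^ 2 * v / 2))
  rw [integral_sub (i1.fun_add (integrable_const _)) i2, integral_add i1 (integrable_const _)]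
  simp only [integral_const_mul, integral_cos_gaussian]
  have e1 : Real.exp (b ^ 2 * v) / 2 * Real.exp (-((2 * b) ^ 2 * v) / 2)
      = Real.exp (-(b ^ 2 * v)) / 2 := by
    rw [div_mul_eq_mul_div, ← Real.exp_add]; ring_nf
  have e2 : 2 * Real.exp (b ^ 2 * v / 2) * Real.exp (-(b ^ 2 * v) / 2) = 2 := by
    rw [mul_assoc, ← Real.exp_add, ← add_div]; simp
  rw [e1, e2]
  have hx : 0 ≤ b ^ 2 * v := by positivity
  have h := exp_sub_one_sub_le hx
  have h2 := Real.self_le_sinh_iff.2 hx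
  rw [Real.sinh_eq] at h2
  simp
  linarith

lemma integral_sq_sinRem_le (b : ℝ) (v : ℝ≥0) :
    ∫ y, sinRem b v y ^ 2 ∂(gaussianReal 0 v) ≤ (b ^ 2 * v) ^ 2 * Real.exp (b ^ 2 * v) := by
  have e : ∀ y, sinRem b v y ^ 2 = Real.exp (b ^ 2 * v) / 2
      - Real.exp (b ^ 2 * v) / 2 * Real.cos (2 * b * y)
      - 2 * b * Real.exp (b ^ 2 * v / 2) * (y * Real.sin (b * y)) + b ^ 2 * y ^ 2 := by
    intro y
    have e1 : Real.exp (b ^ 2 * v) = Real.exp (b ^ 2 * v / 2) ^ 2 := by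
      rw [← Real.exp_nat_mul]; push_cast; ring_nf
    have e2 : Real.cos (2 * b * y) = 1 - 2 * Real.sin (b * y) ^ 2 := by
      rw [mul_assoc, Real.cos_two_mul, Real.cos_sq']; ring
    unfold sinRem
    rw [e1, e2]; ring
  simp_rw [e]
  have i1 := (integrable_cos_gaussian (2 * b) v).const_mul (Real.exp (b ^ 2 * v) / 2)
  have i2 := (integrable_mul_sin_gaussian b v).const_mul (2 * b * Real.exp (b ^ 2 * v / 2))
  have i3 := (integrable_sq_gaussian v).const_mul (b ^ 2)
  have i0 : Integrable (fun _ : ℝ => Real.exp (b ^ 2 * v) / 2) (gaussianReal 0 v) :=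
    integrable_const _
  have j1 := integrable_fun_sub i0 i1
  rw [integral_add (integrable_fun_sub j1 i2) i3, integral_sub j1 i2, integral_sub i0 i1]
  simp only [integral_const_mul, integral_cos_gaussian, integral_mul_sin_gaussian,
    integral_sq_gaussian]
  have e1 : Real.exp (b ^ 2 * v) / 2 * Real.exp (-((2 * b) ^ 2 * v) / 2)
      = Real.exp (-(b ^ 2 * v)) / 2 := by
    rw [div_mul_eq_mul_div, ← Real.exp_add]; ring_nf
  have e2 : Real.exp (b ^ 2 * v / 2) * Real.exp (-(b ^ 2 * v) / 2) = 1 := by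
    rw [← Real.exp_add, ← add_div]; simp
  have e3 : 2 * b * Real.exp (b ^ 2 * v / 2) * (v * b * Real.exp (-(b ^ 2 * v) / 2))
      = 2 * (b ^ 2 * v) * (Real.exp (b ^ 2 * v / 2) * Real.exp (-(b ^ 2 * v) / 2)) := by ring
  rw [e1, e3, e2]
  have hx : 0 ≤ b ^ 2 * v := by positivity
  have h := exp_sub_one_sub_le hx
  have h2 := Real.one_le_cosh (b ^ 2 * v)
  rw [Real.cosh_eq] at h2
  simp
  linarith

/-! ### Step expansions along dyadic grids -/

/-- The dyadic grid `j T / 2 ^ m`. -/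
noncomputable def grid (T : ℝ≥0) (m j : ℕ) : ℝ≥0 := T * j / 2 ^ m

lemma grid_mono (T : ℝ≥0) (m : ℕ) : Monotone (grid T m) := fun i j hij => by
  unfold grid; gcongr

lemma grid_zero (T : ℝ≥0) (m : ℕ) : grid T m 0 = 0 := by simp [grid]

lemma grid_last (T : ℝ≥0) (m : ℕ) : grid T m (2 ^ m) = T := by
  unfold grid; push_cast; field_simp

lemma grid_succ_sub (T : ℝ≥0) (m j : ℕ) : grid T m (j + 1) - grid T m j = T / 2 ^ m := by
  have : grid T m (j + 1) = grid T m j + T / 2 ^ m := by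
    unfold grid; push_cast; ring
  rw [this, add_tsub_cancel_left]

section Expansion

variable {Ω : Type u} {m : MeasurableSpace Ω}

/-- The random variable `h` is the terminal value of a bounded adapted process `Z` on every fine
dyadic grid of `[0, T]`, whose increments are `H ΔB` for a bounded adapted process `H`, up to
remainders orthogonal to the past and of second order in the mesh. -/
def HasStepExpansion (P : Measure Ω) (F : Filtration ℝ≥0 m) (B : ℝ≥0 → Ω → ℝ) (T : ℝ≥0)
    (h : Ω → ℝ) : Prop :=
  ∃ κ : ℝ, 0 ≤ κ ∧ ∃ m₀ : ℕ, ∀ k ≥ m₀, ∃ Z H : ℕ → Ω → ℝ,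
    (∀ j, Measurable[F (grid T k j)] (Z j)) ∧ (∀ j, Measurable[F (grid T k j)] (H j)) ∧
    (∀ j ω, |Z j ω| ≤ κ) ∧ (∀ j ω, |H j ω| ≤ κ) ∧ Z (2 ^ k) = h ∧
    ∀ j < 2 ^ k,
      (∀ X : Ω → ℝ, Measurable[F (grid T k j)] X → MemLp X 2 P →
        ∫ ω, X ω * (Z (j + 1) ω - Z j ω - H j ω * (B (grid T k (j + 1)) ω - B (grid T k j) ω)) ∂P
          = 0) ∧
      ∫ ω, (Z (j + 1) ω - Z j ω - H j ω * (B (grid T k (j + 1)) ω - B (grid T k j) ω)) ^ 2 ∂P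
        ≤ κ * (T / 2 ^ k : ℝ) ^ 2

variable {P : Measure Ω} {F : Filtration ℝ≥0 m} {B : ℝ≥0 → Ω → ℝ}
  {T : ℝ≥0}

lemma memLp_of_abs_le [IsProbabilityMeasure P] {f : Ω → ℝ} (hf : Measurable f) {κ : ℝ}
    (h : ∀ ω, |f ω| ≤ κ) (p : ℝ≥0∞) :
    MemLp f p P := MemLp.of_bound hf.aestronglyMeasurable κ (ae_of_all _ h)

lemma IsFilteredBrownian.memLp_increment (h : IsFilteredBrownian P F B) {s t : ℝ≥0}
    (hst : s ≤ t) : MemLp (fun ω => B t ω - B s ω) 2 P := by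
  have h1 := memLp_id_gaussianReal (μ := 0) (v := t - s) 2
  rw [← h.map_increment hst] at h1
  exact (memLp_map_measure_iff aestronglyMeasurable_id
    ((h.measurable t).sub (h.measurable s)).aemeasurable).1 h1

lemma memLp_expansion_rem [IsProbabilityMeasure P] (h : IsFilteredBrownian P F B) {k j : ℕ}
    {Z H : ℕ → Ω → ℝ} {κ : ℝ}
    (hZ : ∀ j, Measurable[F (grid T k j)] (Z j)) (hH : ∀ j, Measurable[F (grid T k j)] (H j))
    (hZb : ∀ j ω, |Z j ω| ≤ κ) (hHb : ∀ j ω, |H j ω| ≤ κ) :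
    MemLp (fun ω => Z (j + 1) ω - Z j ω -
      H j ω * (B (grid T k (j + 1)) ω - B (grid T k j) ω)) 2 P := by
  have hm : ∀ j, Measurable (Z j) := fun j => (hZ j).mono (F.le _) le_rfl
  have hm' : Measurable (H j) := (hH j).mono (F.le _) le_rfl
  refine ((memLp_of_abs_le (hm _) (hZb _) 2).sub (memLp_of_abs_le (hm _) (hZb _) 2)).sub ?_
  have := (h.memLp_increment (grid_mono T k j.le_succ)).mul (p := ⊤) (r := 2)
    (memLp_of_abs_le hm' (hHb j) ⊤)
  exact this

lemma HasStepExpansion.add [IsProbabilityMeasure P] (hB : IsFilteredBrownian P F B) {f g : Ω → ℝ}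
    (hf : HasStepExpansion P F B T f) (hg : HasStepExpansion P F B T g) :
    HasStepExpansion P F B T (f + g) := by
  obtain ⟨κ, hκ, m₁, hf⟩ := hf
  obtain ⟨κ', hκ', m₂, hg⟩ := hg
  refine ⟨2 * κ + 2 * κ', by positivity, max m₁ m₂, fun k hk => ?_⟩
  obtain ⟨Z, H, a1, a2, a3, a4, a5, a6⟩ := hf k (le_trans (le_max_left _ _) hk)
  obtain ⟨Z', H', b1, b2, b3, b4, b5, b6⟩ := hg k (le_trans (le_max_right _ _) hk)
  refine ⟨fun j => Z j + Z' j, fun j => H j + H' j, fun j => (a1 j).add (b1 j),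
    fun j => (a2 j).add (b2 j), fun j ω => ?_, fun j ω => ?_, by simp only [a5, b5],
    fun j hj => ⟨fun X hX hX2 => ?_, ?_⟩⟩
  · have := abs_add_le (Z j ω) (Z' j ω)
    simp only [Pi.add_apply]; linarith [a3 j ω, b3 j ω]
  · have := abs_add_le (H j ω) (H' j ω)
    simp only [Pi.add_apply]; linarith [a4 j ω, b4 j ω]
  · have r1 := memLp_expansion_rem hB (j := j) a1 a2 a3 a4
    have r2 := memLp_expansion_rem hB (j := j) b1 b2 b3 b4
    have e1 := (a6 j hj).1 X hX hX2
    have e2 := (b6 j hj).1 X hX hX2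
    have := integral_add (hX2.integrable_mul r1) (hX2.integrable_mul r2)
    simp only [Pi.mul_apply] at this
    rw [e1, e2, add_zero] at this
    rw [← this]
    refine integral_congr_ae (ae_of_all _ fun ω => ?_)
    simp only [Pi.add_apply]; ring
  · have r1 := memLp_expansion_rem hB (j := j) a1 a2 a3 a4
    have r2 := memLp_expansion_rem hB (j := j) b1 b2 b3 b4
    have := integral_mono (μ := P) (f := fun ω =>
        ((Z (j + 1) + Z' (j + 1)) ω - (Z j + Z' j) ω - (H j + H' j) ω *
        (B (grid T k (j + 1)) ω - B (grid T k j) ω)) ^ 2) (g := fun ω =>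
        2 * (Z (j + 1) ω - Z j ω - H j ω * (B (grid T k (j + 1)) ω - B (grid T k j) ω)) ^ 2 +
        2 * (Z' (j + 1) ω - Z' j ω - H' j ω * (B (grid T k (j + 1)) ω - B (grid T k j) ω)) ^ 2)
      ?_ ?_ ?_
    · refine this.trans ?_
      rw [integral_add (r1.integrable_sq.const_mul 2) (r2.integrable_sq.const_mul 2),
        integral_const_mul, integral_const_mul]
      have e1 := (a6 j hj).2
      have e2 := (b6 j hj).2
      nlinarith
    · refine (r1.add r2).integrable_sq.congr (ae_of_all _ fun ω => ?_)
      simp only [Pi.add_apply]; ring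
    · exact (r1.integrable_sq.const_mul 2).add (r2.integrable_sq.const_mul 2)
    · intro ω
      simp only [Pi.add_apply]
      set x := Z (j + 1) ω - Z j ω - H j ω * (B (grid T k (j + 1)) ω - B (grid T k j) ω)
      set y := Z' (j + 1) ω - Z' j ω - H' j ω * (B (grid T k (j + 1)) ω - B (grid T k j) ω)
      have e : Z (j + 1) ω + Z' (j + 1) ω - (Z j ω + Z' j ω) - (H j ω + H' j ω) *
        (B (grid T k (j + 1)) ω - B (grid T k j) ω) = x + y := by ring
      rw [e]
      nlinarith [sq_nonneg (x - y)]

lemma HasStepExpansion.smul {f : Ω → ℝ} (c : ℝ)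
    (hf : HasStepExpansion P F B T f) : HasStepExpansion P F B T (c • f) := by
  obtain ⟨κ, hκ, m₁, hf⟩ := hf
  refine ⟨(|c| + c ^ 2) * κ, by positivity, m₁, fun k hk => ?_⟩
  obtain ⟨Z, H, a1, a2, a3, a4, a5, a6⟩ := hf k hk
  have hc : 0 ≤ c ^ 2 * κ := by positivity
  have hc' : 0 ≤ |c| * κ := by positivity
  refine ⟨fun j => c • Z j, fun j => c • H j, fun j => (a1 j).const_mul c,
    fun j => (a2 j).const_mul c, fun j ω => ?_, fun j ω => ?_, by simp only [a5],
    fun j hj => ⟨fun X hX hX2 => ?_, ?_⟩⟩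
  · simp only [Pi.smul_apply, smul_eq_mul, abs_mul]
    nlinarith [mul_le_mul_of_nonneg_left (a3 j ω) (abs_nonneg c)]
  · simp only [Pi.smul_apply, smul_eq_mul, abs_mul]
    nlinarith [mul_le_mul_of_nonneg_left (a4 j ω) (abs_nonneg c)]
  · have e1 := (a6 j hj).1 X hX hX2
    rw [← mul_zero c, ← e1, ← integral_const_mul]
    refine integral_congr_ae (ae_of_all _ fun ω => ?_)
    simp only [Pi.smul_apply, smul_eq_mul]; ring
  · have e1 := (a6 j hj).2
    have e : ∀ ω, ((c • Z (j + 1)) ω - (c • Z j) ω -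
        (c • H j) ω * (B (grid T k (j + 1)) ω - B (grid T k j) ω)) ^ 2 = c ^ 2 *
        (Z (j + 1) ω - Z j ω - H j ω * (B (grid T k (j + 1)) ω - B (grid T k j) ω)) ^ 2 := by
      intro ω; simp only [Pi.smul_apply, smul_eq_mul]; ring
    simp_rw [e]
    rw [integral_const_mul]
    have h1 := mul_le_mul_of_nonneg_left e1 (sq_nonneg c)
    have h2 : 0 ≤ |c| * κ * ((T : ℝ) / 2 ^ k) ^ 2 := by positivity
    nlinarith

/-- A time of `[0, T]` that belongs to every fine dyadic grid. -/
def IsDyadicTime (T l : ℝ≥0) : Prop :=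
  l ≤ T ∧ ∃ m₀ : ℕ, ∀ k ≥ m₀, ∀ j, l ≤ grid T k j ∨ grid T k (j + 1) ≤ l

lemma isDyadicTime_grid (T : ℝ≥0) {k i : ℕ} (hi : i ≤ 2 ^ k) : IsDyadicTime T (grid T k i) := by
  refine ⟨(grid_mono T k hi).trans_eq (grid_last T k), k, fun k' hk' j => ?_⟩
  obtain ⟨d, rfl⟩ := Nat.exists_eq_add_of_le hk'
  have e : grid T k i = grid T (k + d) (i * 2 ^ d) := by
    unfold grid; rw [pow_add]; push_cast; field_simp
  rw [e]
  rcases Nat.lt_or_ge j (i * 2 ^ d) with h | h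
  · exact Or.inr (grid_mono T _ h)
  · exact Or.inl (grid_mono T _ h)

/-- The linear phase `∑ a_l B_l`, with the path stopped at time `t`. -/
noncomputable def phase (B : ℝ≥0 → Ω → ℝ) (a : ℝ≥0 →₀ ℝ) (t : ℝ≥0) (ω : Ω) : ℝ :=
  a.sum fun l c => c * B (min l t) ω

lemma measurable_phase (hB : Adapted F B) (a : ℝ≥0 →₀ ℝ) (t : ℝ≥0) :
    Measurable[F t] (phase B a t) :=
  Finset.measurable_fun_sum _ fun l _ =>
    ((hB (min l t)).mono (F.mono (min_le_right _ _)) le_rfl).const_mul _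

/-- Cosines of linear phases of the path at dyadic times have step expansions. -/
lemma hasStepExpansion_cos [IsProbabilityMeasure P] (hB : IsFilteredBrownian P F B)
    (a : ℝ≥0 →₀ ℝ) (θ : ℝ) (ha : ∀ l ∈ a.support, IsDyadicTime T l) :
    HasStepExpansion P F B T fun ω => Real.cos (phase B a T ω + θ) := by
  classical
  choose! hle M hM using ha
  set A : ℝ := ∑ l ∈ a.support, |a l| with hA
  have hA0 : 0 ≤ A := Finset.sum_nonneg fun _ _ => abs_nonneg _
  refine ⟨1 + A + 4 * (A ^ 2) ^ 2 * Real.exp (A ^ 2 * T), by positivity, a.support.sup M,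
    fun k hk => ?_⟩
  have hgrid : ∀ l ∈ a.support, ∀ j, l ≤ grid T k j ∨ grid T k (j + 1) ≤ l := fun l hl j =>
    hM l hl k ((Finset.le_sup hl).trans hk) j
  set δ : ℝ≥0 := T / 2 ^ k with hδ
  have hδT : δ ≤ T := div_le_self zero_le (one_le_pow₀ one_le_two)
  -- `b j` is the coefficient of the increment over step `j` in the phase: every dyadic time of the
  -- phase lies at a grid point
  set b : ℕ → ℝ := fun j => ∑ l ∈ a.support, if grid T k j < l then a l else 0 with hb
  have hbA : ∀ j, |b j| ≤ A := fun j => by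
    refine (Finset.abs_sum_le_sum_abs _ _).trans (Finset.sum_le_sum fun l _ => ?_)
    split_ifs <;> simp
  have hbA2 : ∀ j, b j ^ 2 ≤ A ^ 2 := fun j => by rw [← sq_abs]; gcongr; exact hbA j
  -- `c j` compensates the damping of the remaining steps, so that `c j cos (φ j)` is the conditional
  -- expectation of the terminal value given the past of the grid point `j`
  set c : ℕ → ℝ := fun j => Real.exp (-(∑ i ∈ Finset.Ico j (2 ^ k), b i ^ 2 * δ / 2)) with hc
  have hc0 : ∀ j, 0 ≤ c j := fun j => (Real.exp_pos _).le
  have hc1 : ∀ j, c j ≤ 1 := fun j => by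
    refine Real.exp_le_one_iff.2 (neg_nonpos.2 (Finset.sum_nonneg fun i _ => by positivity))
  have hcs : ∀ j < 2 ^ k, c (j + 1) = c j * Real.exp (b j ^ 2 * δ / 2) := fun j hj => by
    simp only [hc]
    rw [Finset.sum_eq_sum_Ico_succ_bot hj, ← Real.exp_add]
    congr 1
    ring
  have hph : ∀ j ω, phase B a (grid T k (j + 1)) ω = phase B a (grid T k j) ω +
      b j * (B (grid T k (j + 1)) ω - B (grid T k j) ω) := fun j ω => by
    simp only [phase, Finsupp.sum, hb]
    rw [Finset.sum_mul, ← Finset.sum_add_distrib]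
    refine Finset.sum_congr rfl fun l hl => ?_
    have hjj := grid_mono T k j.le_succ
    rcases hgrid l hl j with h | h
    · rw [min_eq_left h, min_eq_left (h.trans hjj), if_neg (not_lt.2 h)]; ring
    · rw [min_eq_right h, min_eq_right (hjj.trans h)]
      split_ifs with h'
      · ring
      · have : grid T k (j + 1) = grid T k j := le_antisymm (h.trans (not_lt.1 h')) hjj
        rw [this]; ring
  set φ : ℕ → Ω → ℝ := fun j ω => phase B a (grid T k j) ω + θ with hφ
  have hmφ : ∀ j, Measurable[F (grid T k j)] (φ j) := fun j =>
    (measurable_phase hB.adapted a _).add_const θ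
  have hbd : A ≤ 1 + A + 4 * (A ^ 2) ^ 2 * Real.exp (A ^ 2 * T) := by
    have : 0 ≤ 4 * (A ^ 2) ^ 2 * Real.exp (A ^ 2 * T) := by positivity
    linarith
  have hbd1 : 1 ≤ 1 + A + 4 * (A ^ 2) ^ 2 * Real.exp (A ^ 2 * T) := by
    have : 0 ≤ 4 * (A ^ 2) ^ 2 * Real.exp (A ^ 2 * T) := by positivity
    linarith
  have hrem : ∀ j < 2 ^ k, ∀ ω, c (j + 1) * Real.cos (φ (j + 1) ω) - c j * Real.cos (φ j ω) -
      (-(b j * c j * Real.sin (φ j ω))) * (B (grid T k (j + 1)) ω - B (grid T k j) ω) =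
      c j * Real.cos (φ j ω) * cosRem (b j) δ (B (grid T k (j + 1)) ω - B (grid T k j) ω) -
      c j * Real.sin (φ j ω) * sinRem (b j) δ (B (grid T k (j + 1)) ω - B (grid T k j) ω) := by
    intro j hj ω
    have e : φ (j + 1) ω = φ j ω + b j * (B (grid T k (j + 1)) ω - B (grid T k j) ω) := by
      simp only [hφ, hph]; ring
    rw [e, Real.cos_add, hcs j hj]
    unfold cosRem sinRem
    ring
  have hδ' : ∀ j, grid T k (j + 1) - grid T k j = δ := fun j => grid_succ_sub T k j
  have hlaw : ∀ j, P.map (fun ω => B (grid T k (j + 1)) ω - B (grid T k j) ω)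
      = gaussianReal 0 δ := fun j => by
    rw [hB.map_increment (grid_mono T k j.le_succ), hδ']
  have hmΔ : ∀ j, Measurable (fun ω => B (grid T k (j + 1)) ω - B (grid T k j) ω) := fun j =>
    (hB.measurable _).sub (hB.measurable _)
  have hmc : ∀ β, Measurable (cosRem β δ) := fun β => by unfold cosRem; fun_prop
  have hms : ∀ β, Measurable (sinRem β δ) := fun β => by unfold sinRem; fun_prop
  have hLc : ∀ β, MemLp (cosRem β δ) 2 (gaussianReal 0 δ) := fun β => by
    refine MemLp.sub ?_ (memLp_const 1)
    exact (MemLp.of_bound (f := fun y => Real.cos (β * y)) (by fun_prop) 1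
      (ae_of_all _ fun y => Real.abs_cos_le_one _)).const_mul _
  have hLs : ∀ β, MemLp (sinRem β δ) 2 (gaussianReal 0 δ) := fun β => by
    refine MemLp.sub ?_ ((memLp_id_gaussianReal 2).const_mul _)
    exact (MemLp.of_bound (f := fun y => Real.sin (β * y)) (by fun_prop) 1
      (ae_of_all _ fun y => Real.abs_sin_le_one _)).const_mul _
  have hLc' : ∀ j, MemLp (fun ω => cosRem (b j) δ
      (B (grid T k (j + 1)) ω - B (grid T k j) ω)) 2 P := fun j => by
    refine (memLp_map_measure_iff (hmc _).aestronglyMeasurable (hmΔ j).aemeasurable).1 ?_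
    rw [hlaw]; exact hLc _
  have hLs' : ∀ j, MemLp (fun ω => sinRem (b j) δ
      (B (grid T k (j + 1)) ω - B (grid T k j) ω)) 2 P := fun j => by
    refine (memLp_map_measure_iff (hms _).aestronglyMeasurable (hmΔ j).aemeasurable).1 ?_
    rw [hlaw]; exact hLs _
  refine ⟨fun j ω => c j * Real.cos (φ j ω), fun j ω => -(b j * c j * Real.sin (φ j ω)),
    fun j => (hmφ j).cos.const_mul _, fun j => ((hmφ j).sin.const_mul _).neg,
    fun j ω => ?_, fun j ω => ?_, ?_, fun j hj => ⟨fun X hX hX2 => ?_, ?_⟩⟩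
  · rw [abs_mul, abs_of_nonneg (hc0 j)]
    exact (mul_le_one₀ (hc1 j) (abs_nonneg _) (Real.abs_cos_le_one _)).trans hbd1
  · rw [abs_neg, abs_mul, abs_mul, abs_of_nonneg (hc0 j)]
    refine le_trans ?_ hbd
    calc |b j| * c j * |Real.sin (φ j ω)| ≤ A * 1 * 1 := by
          gcongr
          · exact hbA j
          · exact hc1 j
          · exact Real.abs_sin_le_one _
      _ = A := by ring
  · funext ω
    simp [hc, hφ, grid_last]
  · simp_rw [hrem j hj]
    have h1 : ∀ {U : Ω → ℝ}, Measurable[F (grid T k j)] U → (∀ ω, |U ω| ≤ 1) →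
        ∀ {r : ℝ → ℝ}, Measurable r → ∫ y, r y ∂(gaussianReal 0 δ) = 0 →
        MemLp (fun ω => r (B (grid T k (j + 1)) ω - B (grid T k j) ω)) 2 P →
        Integrable (fun ω => X ω * U ω * r (B (grid T k (j + 1)) ω - B (grid T k j) ω)) P ∧
        ∫ ω, X ω * U ω * r (B (grid T k (j + 1)) ω - B (grid T k j) ω) ∂P = 0 := by
      intro U hU hU1 r hr hr0 hr2
      have hXU : MemLp (fun ω => X ω * U ω) 2 P := by
        refine hX2.mono ((hX.mul hU).mono (F.le _) le_rfl).aestronglyMeasurable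
          (ae_of_all _ fun ω => ?_)
        rw [Real.norm_eq_abs, Real.norm_eq_abs, abs_mul]
        exact mul_le_of_le_one_right (abs_nonneg _) (hU1 ω)
      have hi := hXU.integrable_mul hr2
      refine ⟨hi, ?_⟩
      have := hB.integral_increment (grid_mono T k j.le_succ) (V := fun ω => X ω * U ω)
        (hX.mul hU) (f := fun x y => x * r y) (by unfold Function.uncurry; fun_prop) hi
      rw [this]
      simp_rw [integral_const_mul, hδ', hr0, mul_zero]
      simp
    have hcb : ∀ ω, |c j * Real.cos (φ j ω)| ≤ 1 := fun ω => by
      rw [abs_mul, abs_of_nonneg (hc0 j)]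
      exact mul_le_one₀ (hc1 j) (abs_nonneg _) (Real.abs_cos_le_one _)
    have hsb : ∀ ω, |c j * Real.sin (φ j ω)| ≤ 1 := fun ω => by
      rw [abs_mul, abs_of_nonneg (hc0 j)]
      exact mul_le_one₀ (hc1 j) (abs_nonneg _) (Real.abs_sin_le_one _)
    have g1 := h1 ((hmφ j).cos.const_mul (c j)) hcb (hmc (b j)) (integral_cosRem _ _) (hLc' j)
    have g2 := h1 ((hmφ j).sin.const_mul (c j)) hsb (hms (b j)) (integral_sinRem _ _) (hLs' j)
    have := integral_sub g1.1 g2.1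
    rw [g1.2, g2.2, sub_zero] at this
    rw [← this]
    exact integral_congr_ae (ae_of_all _ fun ω => by ring)
  · have hpt : ∀ ω, (c (j + 1) * Real.cos (φ (j + 1) ω) - c j * Real.cos (φ j ω) -
      (-(b j * c j * Real.sin (φ j ω))) * (B (grid T k (j + 1)) ω - B (grid T k j) ω)) ^ 2 ≤
      2 * cosRem (b j) δ (B (grid T k (j + 1)) ω - B (grid T k j) ω) ^ 2 +
      2 * sinRem (b j) δ (B (grid T k (j + 1)) ω - B (grid T k j) ω) ^ 2 := by
      intro ω
      rw [hrem j hj]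
      set x := cosRem (b j) δ (B (grid T k (j + 1)) ω - B (grid T k j) ω)
      set y := sinRem (b j) δ (B (grid T k (j + 1)) ω - B (grid T k j) ω)
      have hC : (c j * Real.cos (φ j ω)) ^ 2 ≤ 1 := by
        rw [mul_pow]
        exact mul_le_one₀ (pow_le_one₀ (hc0 j) (hc1 j)) (sq_nonneg _) (Real.cos_sq_le_one _)
      have hS : (c j * Real.sin (φ j ω)) ^ 2 ≤ 1 := by
        rw [mul_pow]
        exact mul_le_one₀ (pow_le_one₀ (hc0 j) (hc1 j)) (sq_nonneg _) (Real.sin_sq_le_one _)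
      nlinarith [sq_nonneg (c j * Real.cos (φ j ω) * x + c j * Real.sin (φ j ω) * y),
        mul_le_mul_of_nonneg_right hC (sq_nonneg x), mul_le_mul_of_nonneg_right hS (sq_nonneg y)]
    have iC := (hLc' j).integrable_sq.const_mul 2
    have iS := (hLs' j).integrable_sq.const_mul 2
    refine (integral_mono_of_nonneg (ae_of_all _ fun ω => sq_nonneg _) (iC.add iS)
      (ae_of_all _ hpt)).trans ?_
    rw [integral_add' iC iS, integral_const_mul, integral_const_mul]
    have eC : ∫ ω, cosRem (b j) δ (B (grid T k (j + 1)) ω - B (grid T k j) ω) ^ 2 ∂P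
        = ∫ y, cosRem (b j) δ y ^ 2 ∂(gaussianReal 0 δ) := by
      rw [← hlaw j, integral_map (hmΔ j).aemeasurable
        ((hmc _).pow_const 2).aestronglyMeasurable]
    have eS : ∫ ω, sinRem (b j) δ (B (grid T k (j + 1)) ω - B (grid T k j) ω) ^ 2 ∂P
        = ∫ y, sinRem (b j) δ y ^ 2 ∂(gaussianReal 0 δ) := by
      rw [← hlaw j, integral_map (hmΔ j).aemeasurable
        ((hms _).pow_const 2).aestronglyMeasurable]
    rw [eC, eS]
    have q1 := integral_sq_cosRem_le (b j) δ
    have q2 := integral_sq_sinRem_le (b j) δ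
    have q3 : (b j ^ 2 * δ) ^ 2 * Real.exp (b j ^ 2 * δ)
        ≤ (A ^ 2 * δ) ^ 2 * Real.exp (A ^ 2 * T) := by
      have := hbA2 j
      have hδT' : (δ : ℝ) ≤ T := by exact_mod_cast hδT
      gcongr
    have e : ((T : ℝ) / 2 ^ k) = δ := by simp [hδ]
    rw [e]
    have q4 : 0 ≤ (1 + A) * (δ : ℝ) ^ 2 := by positivity
    nlinarith

end Expansion

/-! ### Density of trigonometric functions of the path -/

section Density

variable {Ω : Type u} {m : MeasurableSpace Ω}

/-- The span of the cosines of linear phases of the path at dyadic times of `[0, T]`. Sines are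
included through the constant shift of the phase. -/
def trigSpan (B : ℝ≥0 → Ω → ℝ) (T : ℝ≥0) : Submodule ℝ (Ω → ℝ) :=
  Submodule.span ℝ {f | ∃ (a : ℝ≥0 →₀ ℝ) (θ : ℝ), (∀ l ∈ a.support, IsDyadicTime T l) ∧
    f = fun ω => Real.cos (phase B a T ω + θ)}

lemma phase_add (B : ℝ≥0 → Ω → ℝ) (a b : ℝ≥0 →₀ ℝ) (t : ℝ≥0) (ω : Ω) :
    phase B (a + b) t ω = phase B a t ω + phase B b t ω :=
  Finsupp.sum_add_index' (fun _ => zero_mul _) (fun _ _ _ => add_mul _ _ _)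

lemma phase_neg (B : ℝ≥0 → Ω → ℝ) (a : ℝ≥0 →₀ ℝ) (t : ℝ≥0) (ω : Ω) :
    phase B (-a) t ω = -phase B a t ω := by
  have := phase_add B (-a) a t ω
  rw [neg_add_cancel] at this
  have h0 : phase B 0 t ω = 0 := Finsupp.sum_zero_index
  linarith

lemma cos_mem_trigSpan {B : ℝ≥0 → Ω → ℝ} {T : ℝ≥0} {a : ℝ≥0 →₀ ℝ}
    (ha : ∀ l ∈ a.support, IsDyadicTime T l) (θ : ℝ) :
    (fun ω => Real.cos (phase B a T ω + θ)) ∈ trigSpan B T :=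
  Submodule.subset_span ⟨a, θ, ha, rfl⟩

lemma const_mem_trigSpan (B : ℝ≥0 → Ω → ℝ) (T : ℝ≥0) (c : ℝ) :
    (fun _ => c) ∈ trigSpan B T := by
  have h := (trigSpan B T).smul_mem c
    (cos_mem_trigSpan (B := B) (T := T) (a := 0) (by simp) 0)
  convert h using 1
  funext ω
  simp [phase]

lemma mul_mem_trigSpan {B : ℝ≥0 → Ω → ℝ} {T : ℝ≥0} {f g : Ω → ℝ} (hf : f ∈ trigSpan B T)
    (hg : g ∈ trigSpan B T) : f * g ∈ trigSpan B T := by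
  classical
  induction hf using Submodule.span_induction with
  | zero => simp
  | add x y _ _ hx hy => rw [add_mul]; exact add_mem hx hy
  | smul c x _ hx => rw [smul_mul_assoc]; exact Submodule.smul_mem _ _ hx
  | mem x hx =>
    induction hg using Submodule.span_induction with
    | zero => simp
    | add y z _ _ hy hz => rw [mul_add]; exact add_mem hy hz
    | smul c y _ hy => rw [mul_smul_comm]; exact Submodule.smul_mem _ _ hy
    | mem y hy =>
      obtain ⟨a, θ, ha, rfl⟩ := hx
      obtain ⟨b, η, hb, rfl⟩ := hy
      have h1 : ∀ l ∈ (a + b).support, IsDyadicTime T l := fun l hl => by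
        rcases Finset.mem_union.1 (Finsupp.support_add hl) with h | h
        exacts [ha l h, hb l h]
      have h2 : ∀ l ∈ (a + -b).support, IsDyadicTime T l := fun l hl => by
        rcases Finset.mem_union.1 (Finsupp.support_add hl) with h | h
        · exact ha l h
        · rw [Finsupp.support_neg] at h; exact hb l h
      have := (trigSpan B T).smul_mem (1 / 2) (add_mem (cos_mem_trigSpan (B := B) h1 (θ + η))
        (cos_mem_trigSpan (B := B) h2 (θ - η)))
      convert this using 1
      funext ω
      simp only [Pi.mul_apply, Pi.smul_apply, Pi.add_apply, phase_add, phase_neg, smul_eq_mul]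
      have e1 : phase B a T ω + phase B b T ω + (θ + η)
        = (phase B a T ω + θ) + (phase B b T ω + η) := by ring
      have e2 : phase B a T ω + -phase B b T ω + (θ - η)
        = (phase B a T ω + θ) - (phase B b T ω + η) := by ring
      rw [e1, e2, Real.cos_add (phase B a T ω + θ) (phase B b T ω + η),
        Real.cos_sub (phase B a T ω + θ) (phase B b T ω + η)]
      ring

lemma polynomial_mem_trigSpan {B : ℝ≥0 → Ω → ℝ} {T : ℝ≥0} {f : Ω → ℝ} (hf : f ∈ trigSpan B T)
    (p : Polynomial ℝ) : (fun ω => p.eval (f ω)) ∈ trigSpan B T := by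
  induction p using Polynomial.induction_on' with
  | add p q hp hq =>
    have := add_mem hp hq
    convert this using 1
    funext ω; simp
  | monomial n c =>
    have hpow : ∀ n : ℕ, (fun ω => f ω ^ n) ∈ trigSpan B T := by
      intro n
      induction n with
      | zero => simpa using const_mem_trigSpan B T 1
      | succ n ih =>
        have := mul_mem_trigSpan ih hf
        convert this using 1
        funext ω; simp [pow_succ]
    have := (trigSpan B T).smul_mem c (hpow n)
    convert this using 1
    funext ω; simp

variable {P : Measure Ω} {F : Filtration ℝ≥0 m} {B : ℝ≥0 → Ω → ℝ} {T : ℝ≥0}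

lemma hasStepExpansion_of_mem [IsProbabilityMeasure P] (hB : IsFilteredBrownian P F B)
    {f : Ω → ℝ} (hf : f ∈ trigSpan B T) : HasStepExpansion P F B T f := by
  induction hf using Submodule.span_induction with
  | zero => simpa using (hasStepExpansion_cos hB 0 0 (T := T) (by simp)).smul 0
  | add x y _ _ hx hy => exact hx.add hB hy
  | smul c x _ hx => exact hx.smul c
  | mem x hx =>
    obtain ⟨a, θ, ha, rfl⟩ := hx
    exact hasStepExpansion_cos hB a θ ha

lemma HasStepExpansion.bounded {f : Ω → ℝ} (h : HasStepExpansion P F B T f) :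
    ∃ κ, 0 ≤ κ ∧ ∀ ω, |f ω| ≤ κ := by
  obtain ⟨κ, hκ, k, h⟩ := h
  obtain ⟨Z, H, -, -, h3, -, h5, -⟩ := h k le_rfl
  exact ⟨κ, hκ, fun ω => h5 ▸ h3 _ ω⟩

lemma HasStepExpansion.measurable {f : Ω → ℝ} (h : HasStepExpansion P F B T f) :
    Measurable[F T] f := by
  obtain ⟨κ, hκ, k, h⟩ := h
  obtain ⟨Z, H, h1, -, -, -, h5, -⟩ := h k le_rfl
  have := h1 (2 ^ k)
  rwa [h5, grid_last] at this

/-- The largest point of the dyadic grid of order `k` below `l`. -/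
noncomputable def dyadicFloor (T : ℝ≥0) (k : ℕ) (l : ℝ≥0) : ℝ≥0 := grid T k ⌊l / T * 2 ^ k⌋₊

lemma isDyadicTime_dyadicFloor {T l : ℝ≥0} (hl : l ≤ T) (k : ℕ) :
    IsDyadicTime T (dyadicFloor T k l) := by
  refine isDyadicTime_grid T ?_
  have h1 : l / T ≤ 1 := div_le_one_of_le₀ hl zero_le
  have h2 : l / T * 2 ^ k ≤ ((2 ^ k : ℕ) : ℝ≥0) := by
    push_cast; exact mul_le_of_le_one_left zero_le h1
  exact Nat.floor_le_of_le h2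

lemma tendsto_dyadicFloor {T l : ℝ≥0} (hl : l ≤ T) :
    Tendsto (fun k => dyadicFloor T k l) atTop (𝓝 l) := by
  rcases eq_or_ne T 0 with rfl | hT
  · have : l = 0 := le_antisymm hl zero_le
    simp [dyadicFloor, grid, this]
  · have h2 : Tendsto (fun k : ℕ => (2 : ℝ) ^ k) atTop atTop :=
      tendsto_pow_atTop_atTop_of_one_lt one_lt_two
    have h := (tendsto_nat_floor_mul_div_atTop (R := ℝ) (a := (l : ℝ) / T) (by positivity)).comp h2
    have h' := h.const_mul (T : ℝ)
    rw [mul_div_cancel₀ _ (NNReal.coe_ne_zero.2 hT)] at h'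
    refine NNReal.tendsto_coe.1 (h'.congr fun k => ?_)
    have e : ⌊(l : ℝ) / T * 2 ^ k⌋₊ = ⌊l / T * 2 ^ k⌋₊ :=
      eq_of_forall_le_iff fun n => by
        rw [Nat.le_floor_iff (by positivity), Nat.le_floor_iff zero_le, ← NNReal.coe_le_coe]
        simp
    simp [dyadicFloor, grid, mul_div_assoc, e]

/-- Orthogonality to cosines of phases at dyadic times extends to all times, by continuity of the
paths. -/
lemma integral_mul_cos_eq_zero [IsProbabilityMeasure P] (hB : IsFilteredBrownian P F B)
    {X : Ω → ℝ} (hX : Integrable X P) (h0 : ∀ f ∈ trigSpan B T, ∫ ω, X ω * f ω ∂P = 0)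
    (a : ℝ≥0 →₀ ℝ) (ha : ∀ l ∈ a.support, l ≤ T) (θ : ℝ) :
    ∫ ω, X ω * Real.cos (phase B a T ω + θ) ∂P = 0 := by
  classical
  set a' : ℕ → ℝ≥0 →₀ ℝ := fun k => Finsupp.mapDomain (dyadicFloor T k) a with ha'
  have hph : ∀ k ω, phase B (a' k) T ω
      = a.sum fun l c => c * B (min (dyadicFloor T k l) T) ω := fun k ω =>
    Finsupp.sum_mapDomain_index (fun _ => zero_mul _) (fun _ _ _ => add_mul _ _ _)
  have hz : ∀ k, ∫ ω, X ω * Real.cos (phase B (a' k) T ω + θ) ∂P = 0 := fun k => by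
    refine h0 _ (cos_mem_trigSpan (fun l hl => ?_) θ)
    obtain ⟨l', hl', rfl⟩ := Finset.mem_image.1 (Finsupp.mapDomain_support hl)
    exact isDyadicTime_dyadicFloor (ha l' hl') k
  have hlim : Tendsto (fun k => ∫ ω, X ω * Real.cos (phase B (a' k) T ω + θ) ∂P) atTop
      (𝓝 (∫ ω, X ω * Real.cos (phase B a T ω + θ) ∂P)) := by
    refine tendsto_integral_of_dominated_convergence (fun ω => |X ω|) (fun k => ?_) hX.abs
      (fun k => ae_of_all _ fun ω => ?_) (ae_of_all _ fun ω => ?_)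
    · refine hX.aestronglyMeasurable.mul (Measurable.aestronglyMeasurable ?_)
      exact (((measurable_phase hB.adapted _ _).mono (F.le _) le_rfl).add_const _).cos
    · rw [Real.norm_eq_abs, abs_mul]
      exact mul_le_of_le_one_right (abs_nonneg _) (Real.abs_cos_le_one _)
    · refine Tendsto.const_mul _ ((Real.continuous_cos.tendsto _).comp
        (Tendsto.add_const _ ?_))
      simp_rw [hph]
      refine tendsto_finsetSum _ fun l hl => Tendsto.const_mul _ ?_
      refine ((hB.continuous_path ω).tendsto _).comp ?_
      exact ((continuous_id.min continuous_const).tendsto l).comp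
        (tendsto_dyadicFloor (ha l hl))
  simp_rw [hz] at hlim
  exact (tendsto_nhds_unique tendsto_const_nhds hlim).symm

/-- A random variable orthogonal to all cosines of phases is orthogonal to every function of the
path. -/
lemma integral_mul_eq_zero_of_forall_cos [IsProbabilityMeasure P]
    (hB : IsFilteredBrownian P F B) {X : Ω → ℝ} (hXm : Measurable X) (hX : MemLp X 2 P)
    (h0 : ∀ (a : ℝ≥0 →₀ ℝ), (∀ l ∈ a.support, l ≤ T) → ∀ θ : ℝ,
      ∫ ω, X ω * Real.cos (phase B a T ω + θ) ∂P = 0)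
    {Z : Ω → ℝ} (hZ : Measurable[pathFiltration B hB.measurable T] Z) (hZ2 : MemLp Z 2 P) :
    ∫ ω, X ω * Z ω ∂P = 0 := by
  classical
  have hp := measurable_pathUpTo hB.measurable T
  have hXi : Integrable X P := hX.integrable one_le_two
  -- `μ 1` and `μ (-1)` have densities the positive and the negative part of `X`; their path laws agree
  -- because the finite-dimensional marginals have the same characteristic functions
  set μ : ℝ → Measure Ω := fun s => P.withDensity fun ω => ENNReal.ofReal (s * X ω) with hμ
  have hfin : ∀ s, IsFiniteMeasure (μ s) := fun s =>
    isFiniteMeasure_withDensity_ofReal (hXi.const_mul s).2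
  have hint : ∀ s {G : Type} [NormedAddCommGroup G] [NormedSpace ℝ G] (g : Ω → G),
      ∫ ω, g ω ∂(μ s) = ∫ ω, (max (s * X ω) 0) • g ω ∂P := fun s {G} _ _ g => by
    rw [hμ]
    simp only
    rw [integral_withDensity_eq_integral_toReal_smul (hXm.const_mul s).ennreal_ofReal
      (ae_of_all _ fun _ => ENNReal.ofReal_lt_top)]
    simp_rw [ENNReal.toReal_ofReal']
  have hsub : ∀ x : ℝ, max (1 * x) 0 - max (-1 * x) 0 = x := fun x => by
    rcases le_total x 0 with h | h
    · rw [max_eq_right (by linarith), max_eq_left (by linarith)]; ring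
    · rw [max_eq_left (by linarith), max_eq_right (by linarith)]; ring
  have hmax : ∀ s, MemLp (fun ω => max (s * X ω) 0) 2 P := fun s => (hX.const_mul s).pos_part
  have heq : (μ 1).map (pathUpTo B T) = (μ (-1)).map (pathUpTo B T) := by
    have key : ∀ J : Finset (Iic T), ((μ 1).map (pathUpTo B T)).map J.restrict
        = ((μ (-1)).map (pathUpTo B T)).map J.restrict := by
      intro J
      have hJ : Measurable (J.restrict (π := fun _ : Iic T => ℝ)) := Finset.measurable_restrict J
      rw [Measure.map_map hJ hp, Measure.map_map hJ hp]
      have f1 := Measure.isFiniteMeasure_map (μ 1) (J.restrict ∘ pathUpTo B T)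
      have f2 := Measure.isFiniteMeasure_map (μ (-1)) (J.restrict ∘ pathUpTo B T)
      refine Measure.ext_of_charFunDual (funext fun L => ?_)
      have hcont : Continuous fun x : (J → ℝ) => Complex.exp ((L x : ℂ) * Complex.I) := by
        fun_prop
      rw [charFunDual_apply, charFunDual_apply,
        integral_map (hJ.comp hp).aemeasurable hcont.aestronglyMeasurable,
        integral_map (hJ.comp hp).aemeasurable hcont.aestronglyMeasurable, hint, hint,
        ← sub_eq_zero]
      set a : ℝ≥0 →₀ ℝ := ∑ j : J, Finsupp.single ((j : Iic T) : ℝ≥0)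
        (L fun i => if j = i then 1 else 0) with ha
      have haT : ∀ l ∈ a.support, l ≤ T := by
        intro l hl
        obtain ⟨j, -, hj⟩ := Finset.mem_biUnion.1 (Finsupp.support_finsetSum hl)
        have := Finsupp.support_single_subset hj
        rw [Finset.mem_singleton] at this
        rw [this]; exact j.1.2
      have hL : ∀ ω, L ((J.restrict ∘ pathUpTo B T) ω) = phase B a T ω := by
        intro ω
        have e1 := LinearMap.pi_apply_eq_sum_univ (L : (J → ℝ) →ₗ[ℝ] ℝ)
          ((J.restrict ∘ pathUpTo B T) ω)
        have e2 : phase B a T ω = ∑ j : J, (L fun i => if j = i then 1 else 0) *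
            B (min ((j : Iic T) : ℝ≥0) T) ω := by
          unfold phase
          rw [ha, ← Finsupp.sum_finsetSum_index (fun _ => zero_mul _)
            (fun _ _ _ => add_mul _ _ _)]
          exact Finset.sum_congr rfl fun j _ => Finsupp.sum_single_index (zero_mul _)
        rw [e2]
        refine e1.trans (Finset.sum_congr rfl fun j _ => ?_)
        rw [min_eq_left j.1.2, smul_eq_mul, mul_comm]
        rfl
      simp_rw [hL]
      have hmph : Measurable (phase B a T) :=
        (measurable_phase hB.adapted a T).mono (F.le _) le_rfl
      have hcm : AEStronglyMeasurable
          (fun ω => Complex.exp ((phase B a T ω : ℂ) * Complex.I)) P :=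
        Measurable.aestronglyMeasurable (by fun_prop)
      have hi : ∀ s, Integrable (fun ω => (max (s * X ω) 0) •
          Complex.exp ((phase B a T ω : ℂ) * Complex.I)) P := fun s => by
        simp_rw [Complex.real_smul]
        refine ((hmax s).integrable one_le_two).ofReal.mul_bdd (c := 1) hcm
          (ae_of_all _ fun ω => ?_)
        rw [Complex.norm_exp_ofReal_mul_I]
      rw [← integral_sub (hi 1) (hi (-1))]
      have c1 := h0 a haT 0
      -- the phase shift by `-π / 2` turns the cosine into the sine
      have c2 := h0 a haT (-(Real.pi / 2))
      have ic : Integrable (fun ω => X ω * Real.cos (phase B a T ω + 0)) P :=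
        hXi.mul_bdd (c := 1) (Measurable.aestronglyMeasurable (by fun_prop))
          (ae_of_all _ fun ω => Real.abs_cos_le_one _)
      have is : Integrable (fun ω => X ω * Real.cos (phase B a T ω + -(Real.pi / 2))) P :=
        hXi.mul_bdd (c := 1) (Measurable.aestronglyMeasurable (by fun_prop))
          (ae_of_all _ fun ω => Real.abs_cos_le_one _)
      have e : ∀ ω, (max (1 * X ω) 0) • Complex.exp ((phase B a T ω : ℂ) * Complex.I) -
          (max (-1 * X ω) 0) • Complex.exp ((phase B a T ω : ℂ) * Complex.I) =
          ((X ω * Real.cos (phase B a T ω + 0) : ℝ) : ℂ) +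
          ((X ω * Real.cos (phase B a T ω + -(Real.pi / 2)) : ℝ) : ℂ) * Complex.I := by
        intro ω
        rw [← sub_smul, hsub, Complex.exp_mul_I, add_zero, ← sub_eq_add_neg,
          Real.cos_sub_pi_div_two, Complex.real_smul]
        push_cast
        ring
      simp_rw [e]
      rw [integral_add ic.ofReal (is.ofReal.mul_const _), integral_mul_const]
      erw [integral_complex_ofReal, integral_complex_ofReal]
      rw [c1, c2]
      simp
    have : ∀ s, IsFiniteMeasure ((μ s).map (pathUpTo B T)) := fun s => inferInstance
    exact IsProjectiveLimit.unique (P := fun J => ((μ (-1)).map (pathUpTo B T)).map J.restrict)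
      key (fun J => rfl)
  obtain ⟨z, hz, rfl⟩ := Measurable.exists_eq_measurable_comp (f := pathUpTo B T) hZ
  have e1 := integral_map (μ := μ 1) hp.aemeasurable hz.aestronglyMeasurable
  have e2 := integral_map (μ := μ (-1)) hp.aemeasurable hz.aestronglyMeasurable
  rw [heq, e2, hint, hint, ← sub_eq_zero] at e1
  simp only [smul_eq_mul] at e1
  have hi : ∀ s, Integrable (fun ω => max (s * X ω) 0 * z (pathUpTo B T ω)) P := fun s =>
    (hmax s).integrable_mul hZ2
  rw [← integral_sub (hi _) (hi _)] at e1
  rw [← neg_eq_zero, ← e1, ← integral_neg]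
  refine integral_congr_ae (ae_of_all _ fun ω => ?_)
  simp only [Function.comp]
  rw [← sub_mul]
  nth_rewrite 1 [← hsub (X ω)]
  ring

/-- Trigonometric functions of the path are dense among the square-integrable functions of the
path. -/
lemma exists_trig_near [IsProbabilityMeasure P] (hB : IsFilteredBrownian P F B)
    {Z : Ω → ℝ} (hZ : Measurable[pathFiltration B hB.measurable T] Z) (hZ2 : MemLp Z 2 P)
    {η : ℝ} (hη : 0 < η) : ∃ f ∈ trigSpan B T, ∫ ω, (f ω - Z ω) ^ 2 ∂P < η := by
  have htm : ∀ f ∈ trigSpan B T, MemLp f 2 P := fun f hf => by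
    have h := hasStepExpansion_of_mem hB hf
    obtain ⟨κ, -, hκ⟩ := h.bounded
    exact memLp_of_abs_le (h.measurable.mono (F.le _) le_rfl) hκ 2
  -- in `L²`, density of a subspace amounts to triviality of its orthogonal complement
  let V : Submodule ℝ (Lp ℝ 2 P) :=
    { carrier := {g | ∃ f ∈ trigSpan B T, g =ᵐ[P] f}
      add_mem' := by
        rintro g g' ⟨f, hf, hgf⟩ ⟨f', hf', hgf'⟩
        exact ⟨f + f', add_mem hf hf', (Lp.coeFn_add _ _).trans (hgf.add hgf')⟩
      zero_mem' := ⟨0, zero_mem _, Lp.coeFn_zero _ _ _⟩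
      smul_mem' := by
        rintro c g ⟨f, hf, hgf⟩
        exact ⟨c • f, Submodule.smul_mem _ _ hf,
          (Lp.coeFn_smul _ _).trans (hgf.const_smul c)⟩ }
  have hmem : hZ2.toLp Z ∈ V.topologicalClosure := by
    rw [← Submodule.orthogonal_orthogonal_eq_closure, Submodule.mem_orthogonal]
    intro x hx
    rw [Submodule.mem_orthogonal] at hx
    have hx0 : ∀ f ∈ trigSpan B T, ∫ ω, x ω * f ω ∂P = 0 := fun f hf => by
      have h1 := hx ((htm f hf).toLp f) ⟨f, hf, MemLp.coeFn_toLp _⟩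
      rw [L2.inner_def] at h1
      rw [← h1]
      refine integral_congr_ae ?_
      filter_upwards [(htm f hf).coeFn_toLp] with ω hω
      rw [hω]
      simp
    have hxm : Measurable (x : Ω → ℝ) := (Lp.stronglyMeasurable x).measurable
    have h2 := integral_mul_eq_zero_of_forall_cos hB hxm (Lp.memLp x)
      (fun a ha θ => integral_mul_cos_eq_zero hB ((Lp.memLp x).integrable one_le_two) hx0 a ha θ)
      hZ hZ2
    rw [L2.inner_def, ← h2]
    refine integral_congr_ae ?_
    filter_upwards [hZ2.coeFn_toLp] with ω hω
    rw [hω]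
    simp [mul_comm]
  obtain ⟨g, ⟨f, hf, hgf⟩, hg⟩ := Metric.mem_closure_iff.1 hmem (Real.sqrt η) (Real.sqrt_pos.2 hη)
  refine ⟨f, hf, ?_⟩
  rw [dist_eq_norm] at hg
  have h3 : ‖hZ2.toLp Z - g‖ ^ 2 < η := by
    rw [← Real.sq_sqrt hη.le]
    gcongr
  rw [← real_inner_self_eq_norm_sq, L2.inner_def] at h3
  refine lt_of_eq_of_lt (integral_congr_ae ?_) h3
  filter_upwards [hZ2.coeFn_toLp, hgf, Lp.coeFn_sub (hZ2.toLp Z) g] with ω h1 h2 h3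
  rw [h3]
  simp only [Pi.sub_apply, h1, h2, real_inner_self_eq_norm_sq, Real.norm_eq_abs, sq_abs]
  ring

/-- Approximation by trigonometric functions, preserving two-sided bounds: the bounds are enforced
by composing with a polynomial close to the truncation map. -/
lemma exists_trig_near_of_bounds [IsProbabilityMeasure P] (hB : IsFilteredBrownian P F B)
    {Z : Ω → ℝ} (hZ : Measurable[pathFiltration B hB.measurable T] Z) {a b : ℝ}
    (hab : ∀ ω, Z ω ∈ Icc a b) {η : ℝ} (hη : 0 < η) :
    ∃ f ∈ trigSpan B T, (∀ ω, f ω ∈ Icc (a - η) (b + η)) ∧ ∫ ω, (f ω - Z ω) ^ 2 ∂P < η := by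
  have hZm : Measurable Z := hZ.mono ((pathFiltration B hB.measurable).le T) le_rfl
  have hZ2 : MemLp Z 2 P := memLp_of_abs_le hZm (κ := |a| + |b|) (fun ω => by
    rw [abs_le]
    constructor
    · linarith [neg_abs_le a, abs_nonneg b, (hab ω).1]
    · linarith [le_abs_self b, abs_nonneg a, (hab ω).2]) 2
  obtain ⟨f, hf, hfZ⟩ := exists_trig_near hB hZ hZ2 (η := η / 4) (by linarith)
  have hfe := hasStepExpansion_of_mem hB hf
  obtain ⟨κ, hκ, hfκ⟩ := hfe.bounded
  have hfm : Measurable f := hfe.measurable.mono (F.le _) le_rfl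
  set ζ := min η (min 1 (η / 8)) with hζ
  have hζ0 : 0 < ζ := by simp only [hζ]; positivity
  have hζ1 : ζ ≤ 1 := (min_le_right _ _).trans (min_le_left _ _)
  have hζ8 : ζ ≤ η / 8 := (min_le_right _ _).trans (min_le_right _ _)
  have hζη : ζ ≤ η := min_le_left _ _
  obtain ⟨p, hp⟩ := exists_polynomial_near_of_continuousOn (-κ) κ (fun x => max a (min x b))
    (by fun_prop) ζ hζ0
  have hpf : ∀ ω, |p.eval (f ω) - max a (min (f ω) b)| < ζ := fun ω => hp _ (abs_le.1 (hfκ ω))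
  have hpm := polynomial_mem_trigSpan hf p
  have hne : ∀ ω, a ≤ b := fun ω => (hab ω).1.trans (hab ω).2
  refine ⟨_, hpm, fun ω => ?_, ?_⟩
  · have h1 := abs_lt.1 (hpf ω)
    have h2 : a ≤ max a (min (f ω) b) := le_max_left _ _
    have h3 : max a (min (f ω) b) ≤ b := max_le (hne ω) (min_le_right _ _)
    exact ⟨by linarith, by linarith⟩
  · have hpe := hasStepExpansion_of_mem hB hpm
    obtain ⟨κ', -, hκ'⟩ := hpe.bounded
    have hfL : MemLp f 2 P := memLp_of_abs_le hfm hfκ 2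
    have hpt : ∀ ω, (p.eval (f ω) - Z ω) ^ 2 ≤ 2 * ζ + 2 * (f ω - Z ω) ^ 2 := by
      intro ω
      have h1 := abs_lt.1 (hpf ω)
      have h2 : |max a (min (f ω) b) - Z ω| ≤ |f ω - Z ω| := by
        have e : max a (min (Z ω) b) = Z ω := by
          rw [min_eq_left (hab ω).2, max_eq_right (hab ω).1]
        nth_rewrite 1 [← e]
        refine (abs_max_sub_max_le_max _ _ _ _).trans ?_
        rw [sub_self, abs_zero]
        refine max_le (abs_nonneg _) ((abs_min_sub_min_le_max _ _ _ _).trans ?_)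
        rw [sub_self, abs_zero]
        exact max_le le_rfl (abs_nonneg _)
      have h3 := sq_le_sq' (by linarith [abs_nonneg (f ω - Z ω), (abs_le.1 h2).1])
        ((le_abs_self _).trans h2)
      rw [sq_abs] at h3
      have h4 : (p.eval (f ω) - max a (min (f ω) b)) ^ 2 ≤ ζ := by
        have := sq_lt_sq' h1.1 h1.2
        nlinarith
      nlinarith [sq_nonneg (p.eval (f ω) - max a (min (f ω) b) - (max a (min (f ω) b) - Z ω))]
    have hi := (hfL.sub hZ2).integrable_sq.const_mul 2
    have hi0 : Integrable (fun _ : Ω => 2 * ζ) P := integrable_const _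
    have := integral_mono_of_nonneg (μ := P) (ae_of_all _ fun ω => sq_nonneg _) (hi0.add hi)
      (ae_of_all _ hpt)
    refine this.trans_lt ?_
    rw [integral_add' hi0 hi, integral_const]
    simp only [Pi.sub_apply, probReal_univ, one_smul]
    rw [integral_const_mul]
    linarith

end Density

/-! ### Approximation of densities by exponentials of simple processes -/

section ApproxExp

variable {Ω : Type u} {m : MeasurableSpace Ω} {P : Measure Ω} {F : Filtration ℝ≥0 m}
  {B : ℝ≥0 → Ω → ℝ} {T : ℝ≥0}

/-- A function of a Brownian increment times a square-integrable variable of the past is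
square-integrable. -/
lemma IsFilteredBrownian.memLp_mul_increment [IsProbabilityMeasure P]
    (hB : IsFilteredBrownian P F B) {s t : ℝ≥0} (hst : s ≤ t) {V ψ : Ω → ℝ}
    (hV : Measurable[F s] V) (hV2 : MemLp V 2 P) (hψ : Measurable[F s] ψ) {c : ℝ}
    (hψc : ∀ ω, |ψ ω| ≤ c) {f : ℝ → ℝ → ℝ} (hf : Measurable (Function.uncurry f)) {K : ℝ}
    (hi : ∀ x, Integrable (fun y => f x y ^ 2) (gaussianReal 0 (t - s)))
    (hK : ∀ x, |x| ≤ c → ∫ y, f x y ^ 2 ∂(gaussianReal 0 (t - s)) ≤ K) :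
    MemLp (fun ω => V ω * f (ψ ω) (B t ω - B s ω)) 2 P ∧
      ∫ ω, (V ω * f (ψ ω) (B t ω - B s ω)) ^ 2 ∂P ≤ K * ∫ ω, V ω ^ 2 ∂P := by
  have hVm : Measurable V := hV.mono (F.le s) le_rfl
  have hψm : Measurable ψ := hψ.mono (F.le s) le_rfl
  have hΔ : Measurable fun ω => B t ω - B s ω := (hB.measurable t).sub (hB.measurable s)
  have hm : Measurable fun ω => V ω * f (ψ ω) (B t ω - B s ω) :=
    hVm.mul (hf.comp (hψm.prodMk hΔ))
  obtain ⟨ω₀⟩ : Nonempty Ω := P.nonempty_of_neZero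
  have hc0 : 0 ≤ c := (abs_nonneg _).trans (hψc ω₀)
  have hK0 : 0 ≤ K := le_trans (integral_nonneg fun y => sq_nonneg _)
    (hK 0 (by simpa using hc0))
  have h1 := hB.lintegral_increment hst (V := fun ω => (V ω, ψ ω)) (hV.prodMk hψ)
    (f := fun p y => ENNReal.ofReal (p.1 ^ 2) * ENNReal.ofReal (f p.2 y ^ 2)) (by
      have : Measurable fun q : (ℝ × ℝ) × ℝ => f q.1.2 q.2 :=
        hf.comp (by fun_prop : Measurable fun q : (ℝ × ℝ) × ℝ => (q.1.2, q.2))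
      unfold Function.uncurry
      fun_prop)
  have hfin : ∫⁻ ω, ENNReal.ofReal ((V ω * f (ψ ω) (B t ω - B s ω)) ^ 2) ∂P
      ≤ ENNReal.ofReal (K * ∫ ω, V ω ^ 2 ∂P) := by
    simp_rw [mul_pow, ENNReal.ofReal_mul (sq_nonneg (V _))]
    refine h1.le.trans ?_
    rw [ENNReal.ofReal_mul hK0, ofReal_integral_eq_lintegral_ofReal hV2.integrable_sq
      (ae_of_all _ fun _ => sq_nonneg _), ← lintegral_const_mul _ (by fun_prop)]
    refine lintegral_mono fun ω => ?_
    simp only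
    rw [lintegral_const_mul' _ _ ENNReal.ofReal_ne_top, mul_comm,
      ← ofReal_integral_eq_lintegral_ofReal (hi _) (ae_of_all _ fun _ => sq_nonneg _)]
    gcongr
    exact hK _ (hψc ω)
  have hint : Integrable (fun ω => (V ω * f (ψ ω) (B t ω - B s ω)) ^ 2) P := by
    refine ⟨(hm.pow_const 2).aestronglyMeasurable, ?_⟩
    rw [hasFiniteIntegral_iff_ofReal (ae_of_all _ fun _ => sq_nonneg _)]
    exact hfin.trans_lt ENNReal.ofReal_lt_top
  refine ⟨(memLp_two_iff_integrable_sq hm.aestronglyMeasurable).2 hint, ?_⟩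
  rw [← ofReal_integral_eq_lintegral_ofReal hint (ae_of_all _ fun _ => sq_nonneg _)] at hfin
  exact (ENNReal.ofReal_le_ofReal_iff
    (mul_nonneg hK0 (integral_nonneg fun _ => sq_nonneg _))).1 hfin

/-- A centred function of a Brownian increment is orthogonal to the past. -/
lemma IsFilteredBrownian.integral_mul_mul_increment [IsProbabilityMeasure P]
    (hB : IsFilteredBrownian P F B) {s t : ℝ≥0} (hst : s ≤ t) {X V ψ : Ω → ℝ}
    (hX : Measurable[F s] X) (hX2 : MemLp X 2 P)
    (hV : Measurable[F s] V) (hψ : Measurable[F s] ψ) {f : ℝ → ℝ → ℝ}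
    (hf : Measurable (Function.uncurry f))
    (h0 : ∀ x, ∫ y, f x y ∂(gaussianReal 0 (t - s)) = 0)
    (h2 : MemLp (fun ω => V ω * f (ψ ω) (B t ω - B s ω)) 2 P) :
    ∫ ω, X ω * (V ω * f (ψ ω) (B t ω - B s ω)) ∂P = 0 := by
  have h1 := hB.integral_increment hst (V := fun ω => (X ω, V ω, ψ ω))
    (hX.prodMk (hV.prodMk hψ)) (f := fun p y => p.1 * (p.2.1 * f p.2.2 y)) (by
      have : Measurable fun q : (ℝ × ℝ × ℝ) × ℝ => f q.1.2.2 q.2 :=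
        hf.comp (by fun_prop : Measurable fun q : (ℝ × ℝ × ℝ) × ℝ => (q.1.2.2, q.2))
      unfold Function.uncurry
      fun_prop) (hX2.integrable_mul h2)
  rw [h1]
  simp_rw [integral_const_mul, h0]
  simp

lemma le_of_affine_recursion {u : ℕ → ℝ} {α β : ℝ} (hα : 0 ≤ α) (hβ : 0 ≤ β) {N : ℕ}
    (h0 : u 0 ≤ 0) (h : ∀ j < N, u (j + 1) ≤ (1 + α) * u j + β) :
    ∀ j ≤ N, u j ≤ β * j * Real.exp (α * j) := by
  intro j
  induction j with
  | zero => intro _; simpa using h0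
  | succ j ih =>
    intro hj
    have h1 := ih (by omega)
    have h2 := h j (by omega)
    have h3 : (1 + α) ≤ Real.exp α := by linarith [Real.add_one_le_exp α]
    have h4 : (1 + α) * u j ≤ Real.exp α * (β * j * Real.exp (α * j)) :=
      (mul_le_mul_of_nonneg_left h1 (by positivity)).trans
        (mul_le_mul_of_nonneg_right h3 (by positivity))
    have h5 : (1 : ℝ) ≤ Real.exp (α * (j + 1)) := Real.one_le_exp (by positivity)
    have h6 : Real.exp α * Real.exp (α * j) = Real.exp (α * (j + 1)) := by
      rw [← Real.exp_add]; ring_nf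
    push_cast
    calc u (j + 1) ≤ Real.exp α * (β * j * Real.exp (α * j)) + β := by linarith
      _ = β * j * Real.exp (α * (j + 1)) + β * 1 := by rw [← h6]; ring
      _ ≤ β * j * Real.exp (α * (j + 1)) + β * Real.exp (α * (j + 1)) := by gcongr
      _ = β * (j + 1) * Real.exp (α * (j + 1)) := by ring

lemma integral_sq_add_eq_of_orthogonal [IsProbabilityMeasure P] {X Y : Ω → ℝ} (hX : MemLp X 2 P)
    (hY : MemLp Y 2 P) (h : ∫ ω, X ω * Y ω ∂P = 0) :
    ∫ ω, (X ω + Y ω) ^ 2 ∂P = ∫ ω, X ω ^ 2 ∂P + ∫ ω, Y ω ^ 2 ∂P := by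
  have i1 : Integrable (fun ω => X ω * Y ω) P := hX.integrable_mul hY
  have e : ∀ ω, (X ω + Y ω) ^ 2 = X ω ^ 2 + Y ω ^ 2 + 2 * (X ω * Y ω) := fun ω => by ring
  simp_rw [e]
  rw [integral_add (hX.integrable_sq.fun_add hY.integrable_sq) (i1.const_mul 2),
    integral_add hX.integrable_sq hY.integrable_sq, integral_const_mul, h]
  ring

set_option maxHeartbeats 1000000 in
/-- A positive random variable with a step expansion and mean one is a limit in `L²` of stochastic
exponentials of simple processes. The integrand is `H / Z`, where `H` and `Z` come from the
expansion; the squared distance between the exponential and `Z` satisfies a discrete Gronwall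
inequality along the grid. -/
lemma HasStepExpansion.exists_stochExp_near [IsProbabilityMeasure P]
    (hB : IsFilteredBrownian P F B)
    (hF0 : ∀ X : Ω → ℝ, Measurable[F 0] X → ∃ c, ∀ᵐ ω ∂P, X ω = c) {h : Ω → ℝ}
    (hh : HasStepExpansion P F B T h) (hE : ∫ ω, h ω ∂P = 1) {a : ℝ} (ha : 0 < a)
    (hlow : ∀ ω, a ≤ h ω) {η : ℝ} (hη : 0 < η) :
    ∃ H : SimpleProc F, H.τ H.n = T ∧ MemLp (H.stochExp B T) 2 P ∧
      ∫ ω, (H.stochExp B T ω - h ω) ^ 2 ∂P < η := by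
  obtain ⟨κ, hκ, m₀, hh⟩ := hh
  set c := κ / a with hc
  have hc0 : 0 ≤ c := by positivity
  set K := c ^ 4 * Real.exp (c ^ 2 * T) with hK
  have hK0 : 0 ≤ K := by positivity
  set C₁ := 3 * c ^ 2 + 6 * K * T with hC₁
  set C₂ := 6 * κ ^ 2 * K + 3 * κ with hC₂
  have hC₁0 : 0 ≤ C₁ := by positivity
  have hC₂0 : 0 ≤ C₂ := by positivity
  -- the mesh for which the Gronwall bound is below `η`
  obtain ⟨k, hk, hkη⟩ : ∃ k ≥ m₀, C₂ * T * Real.exp (C₁ * T) * (T / 2 ^ k) < η := by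
    have h1 : Tendsto (fun k : ℕ => C₂ * T * Real.exp (C₁ * T) * ((T : ℝ) / 2 ^ k)) atTop
        (𝓝 (C₂ * T * Real.exp (C₁ * T) * 0)) :=
      Tendsto.const_mul _ (tendsto_const_nhds.div_atTop
        (tendsto_pow_atTop_atTop_of_one_lt one_lt_two))
    rw [mul_zero] at h1
    obtain ⟨k, hk⟩ := ((eventually_ge_atTop m₀).and (h1.eventually_lt_const hη)).exists
    exact ⟨k, hk.1, hk.2⟩
  obtain ⟨Z, H, hZ, hH, hZb, hHb, hZh, hrem⟩ := hh k hk
  set τ := grid T k with hτ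
  have hτm : ∀ j, τ j ≤ τ (j + 1) := fun j => grid_mono T k j.le_succ
  set δ : ℝ := T / 2 ^ k with hδ
  have hδ0 : 0 ≤ δ := by positivity
  have hδT : δ ≤ T := div_le_self T.2 (one_le_pow₀ one_le_two)
  have hv : ∀ j, τ (j + 1) - τ j = T / 2 ^ k := grid_succ_sub T k
  have hvδ : ∀ j, ((τ (j + 1) - τ j : ℝ≥0) : ℝ) = δ := fun j => by rw [hv]; simp [hδ]
  set Δ : ℕ → Ω → ℝ := fun j ω => B (τ (j + 1)) ω - B (τ j) ω with hΔ
  set R : ℕ → Ω → ℝ := fun j ω => Z (j + 1) ω - Z j ω - H j ω * Δ j ω with hR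
  have hZm : ∀ j, Measurable (Z j) := fun j => (hZ j).mono (F.le _) le_rfl
  have hZ2 : ∀ j, MemLp (Z j) 2 P := fun j => memLp_of_abs_le (hZm j) (hZb j) 2
  have hH2 : ∀ j, MemLp (H j) 2 P := fun j =>
    memLp_of_abs_le ((hH j).mono (F.le _) le_rfl) (hHb j) 2
  have hR2 : ∀ j, MemLp (R j) 2 P := fun j => memLp_expansion_rem hB hZ hH hZb hHb
  -- linear functions of the increments
  have hlin : ∀ j {V : Ω → ℝ}, Measurable[F (τ j)] V → MemLp V 2 P →
      MemLp (fun ω => V ω * Δ j ω) 2 P ∧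
      ∀ {X : Ω → ℝ}, Measurable[F (τ j)] X → MemLp X 2 P →
        ∫ ω, X ω * (V ω * Δ j ω) ∂P = 0 := by
    intro j V hV hV2
    have h1 := hB.memLp_mul_increment (hτm j) hV hV2 (ψ := fun _ => 0) measurable_const (c := 0)
      (by simp) (f := fun _ y => y) measurable_snd (K := ∫ y, y ^ 2 ∂(gaussianReal 0 _))
      (fun _ => integrable_sq_gaussian _) (fun _ _ => le_rfl)
    refine ⟨h1.1, fun {X} hX hX2 => ?_⟩
    exact hB.integral_mul_mul_increment (hτm j) hX hX2 hV (ψ := fun _ => 0) measurable_const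
      (f := fun _ y => y) measurable_snd (fun _ => integral_id_gaussian _) h1.1
  have hstep : ∀ j < 2 ^ k, ∀ {X : Ω → ℝ}, Measurable[F (τ j)] X → MemLp X 2 P →
      ∫ ω, X ω * (Z (j + 1) ω - Z j ω) ∂P = 0 := by
    intro j hj X hX hX2
    have h1 := (hrem j hj).1 X hX hX2
    have h2 := (hlin j (hH j) (hH2 j)).2 hX hX2
    have i1 := hX2.integrable_mul (hR2 j)
    have i2 := hX2.integrable_mul (hlin j (hH j) (hH2 j)).1
    have h3 := integral_add i1 i2
    simp only [Pi.mul_apply] at h3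
    rw [h2] at h3
    have h4 : ∫ ω, X ω * R j ω ∂P = 0 := h1
    rw [h4, add_zero] at h3
    rw [← h3]
    refine integral_congr_ae (ae_of_all _ fun ω => ?_)
    simp only [hR]; ring
  -- `Z` is a martingale along the grid, with terminal value `h`
  have hZE : ∀ j ≤ 2 ^ k, ∫ ω, Z (2 ^ k - j) ω ∂P = 1 := by
    intro j
    induction j with
    | zero => intro _; rw [Nat.sub_zero, hZh, hE]
    | succ j ih =>
      intro hj
      have h1 := hstep (2 ^ k - (j + 1)) (by omega) (X := fun _ => 1) measurable_const
        (memLp_const _)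
      have e : 2 ^ k - (j + 1) + 1 = 2 ^ k - j := by omega
      rw [e] at h1
      simp only [one_mul] at h1
      rw [integral_sub ((hZ2 _).integrable one_le_two) ((hZ2 _).integrable one_le_two),
        ih (by omega)] at h1
      linarith
  have hZa : ∀ j ≤ 2 ^ k, ∀ᵐ ω ∂P, a ≤ Z (2 ^ k - j) ω := by
    intro j
    induction j with
    | zero => intro _; rw [Nat.sub_zero, hZh]; exact ae_of_all _ hlow
    | succ j ih =>
      intro hj
      set i := 2 ^ k - (j + 1) with hi
      have e : 2 ^ k - j = i + 1 := by omega
      have ih' := ih (by omega)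
      rw [e] at ih'
      have hS : MeasurableSet[F (τ i)] {ω | Z i ω < a} := measurableSet_lt (hZ i) measurable_const
      set X : Ω → ℝ := {ω | Z i ω < a}.indicator fun _ => 1 with hX
      have hXm : Measurable[F (τ i)] X := measurable_const.indicator hS
      have hX2 : MemLp X 2 P := memLp_of_abs_le (hXm.mono (F.le _) le_rfl) (κ := 1)
        (fun ω => by by_cases hω : ω ∈ {ω | Z i ω < a} <;> simp [hX, hω]) 2
      have h1 := hstep i (by omega) hXm hX2
      have h2 : 0 ≤ᵐ[P] fun ω => X ω * (Z (i + 1) ω - Z i ω) := by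
        filter_upwards [ih'] with ω hω
        by_cases hω' : ω ∈ {ω | Z i ω < a}
        · have h3 : Z i ω < a := hω'
          simp only [hX, indicator_of_mem hω', one_mul, Pi.zero_apply]; linarith
        · simp [hX, hω']
      rw [integral_eq_zero_iff_of_nonneg_ae h2
        (hX2.integrable_mul ((hZ2 _).sub (hZ2 _)))] at h1
      filter_upwards [h1, ih'] with ω h3 h4
      by_contra h5
      have h6 : ω ∈ {ω | Z i ω < a} := not_le.1 h5
      have h7 : Z i ω < a := h6
      simp only [hX, indicator_of_mem h6, one_mul, Pi.zero_apply] at h3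
      linarith
  have hZa' : ∀ j ≤ 2 ^ k, ∀ᵐ ω ∂P, a ≤ Z j ω := fun j hj => by
    have := hZa (2 ^ k - j) (by omega)
    rwa [Nat.sub_sub_self hj] at this
  have hZ0 : ∀ᵐ ω ∂P, Z 0 ω = 1 := by
    have h1 := hZ 0
    rw [hτ, grid_zero] at h1
    obtain ⟨x, hx⟩ := hF0 _ h1
    have h2 := hZE (2 ^ k) le_rfl
    rw [Nat.sub_self, integral_congr_ae hx] at h2
    simp only [integral_const, probReal_univ, one_smul] at h2
    rwa [h2] at hx
  -- the simple process
  set ψ : ℕ → Ω → ℝ := fun j ω => H j ω / max (Z j ω) a with hψ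
  have hψm : ∀ j, Measurable[F (τ j)] (ψ j) := fun j =>
    (hH j).div ((hZ j).max measurable_const)
  have hψc : ∀ j ω, |ψ j ω| ≤ c := fun j ω => by
    have h1 : 0 < max (Z j ω) a := lt_max_of_lt_right ha
    rw [hψ]; simp only
    rw [abs_div, abs_of_pos h1, hc]
    exact div_le_div₀ hκ (hHb j ω) ha (le_max_right _ _)
  let G : SimpleProc F :=
    { n := 2 ^ k
      τ := τ
      ξ := ψ
      mono := grid_mono T k
      meas := hψm
      bdd := ⟨c, hψc⟩ }
  set W : ℕ → Ω → ℝ := fun j ω => Real.exp (G.exponent B j (τ j) ω) with hW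
  have hWm : ∀ j, Measurable[F (τ j)] (W j) := fun j => (G.measurable_exponent hB.adapted j _).exp
  set e : ℕ → Ω → ℝ := fun j ω => expRem (ψ j ω) (τ (j + 1) - τ j) (Δ j ω) with he
  have hWs : ∀ j ω, W (j + 1) ω = W j ω + (W j ω * ψ j ω) * Δ j ω + W j ω * e j ω := by
    intro j ω
    have h1 : G.exponent B (j + 1) (τ (j + 1)) ω = G.exponent B j (τ j) ω +
        (ψ j ω * Δ j ω - 1 / 2 * ψ j ω ^ 2 * ((τ (j + 1) - τ j : ℝ≥0) : ℝ)) := by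
      rw [G.exponent_succ, G.exponent_of_le B (hτm j), NNReal.coe_sub (hτm j)]
      change _ + (ψ j ω * (B (min (τ (j + 1)) (τ (j + 1))) ω - B (min (τ j) (τ (j + 1))) ω) -
        1 / 2 * ψ j ω ^ 2 * ((min (τ (j + 1)) (τ (j + 1)) : ℝ≥0) -
          (min (τ j) (τ (j + 1)) : ℝ≥0) : ℝ)) = _
      rw [min_self, min_eq_left (hτm j)]
    simp only [hW, he, expRem]
    rw [h1, Real.exp_add]
    ring
  have hexp : Measurable (Function.uncurry fun x y => expRem x (T / 2 ^ k) y) := by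
    unfold Function.uncurry expRem; fun_prop
  have hmulψ : ∀ j {V : Ω → ℝ}, Measurable[F (τ j)] V → MemLp V 2 P →
      MemLp (fun ω => (V ω * ψ j ω) * Δ j ω) 2 P ∧
        ∫ ω, ((V ω * ψ j ω) * Δ j ω) ^ 2 ∂P ≤ c ^ 2 * δ * ∫ ω, V ω ^ 2 ∂P := by
    intro j V hV hV2
    have h1 := hB.memLp_mul_increment (hτm j) hV hV2 (hψm j) (hψc j) (f := fun x y => x * y)
      (by unfold Function.uncurry; fun_prop) (K := c ^ 2 * δ)
      (fun x => by simp_rw [mul_pow]; exact (integrable_sq_gaussian _).const_mul _)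
      (fun x hx => by
        simp_rw [mul_pow]
        rw [integral_const_mul, integral_sq_gaussian, hvδ, ← sq_abs]
        gcongr)
    simp only [← mul_assoc] at h1
    exact h1
  have hmule : ∀ j {V : Ω → ℝ}, Measurable[F (τ j)] V → MemLp V 2 P →
      MemLp (fun ω => V ω * e j ω) 2 P ∧
        ∫ ω, (V ω * e j ω) ^ 2 ∂P ≤ K * δ ^ 2 * ∫ ω, V ω ^ 2 ∂P := by
    intro j V hV hV2
    have h1 := hB.memLp_mul_increment (hτm j) hV hV2 (hψm j) (hψc j)
      (f := fun x y => expRem x (T / 2 ^ k) y) hexp (K := K * δ ^ 2)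
      (fun x => by rw [hv]; exact integrable_sq_expRem _ _)
      (fun x hx => by
        rw [hv]
        refine (integral_sq_expRem_le _ _).trans ?_
        have h2 : ((T / 2 ^ k : ℝ≥0) : ℝ) = δ := by simp [hδ]
        have h3 : x ^ 2 ≤ c ^ 2 := by rw [← sq_abs]; gcongr
        rw [h2, hK]
        calc (x ^ 2 * δ) ^ 2 * Real.exp (x ^ 2 * δ) ≤ (c ^ 2 * δ) ^ 2 * Real.exp (c ^ 2 * T) := by
              gcongr
          _ = _ := by ring)
    simp only [he, hv]
    exact h1
  have hW2 : ∀ j, MemLp (W j) 2 P := by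
    intro j
    induction j with
    | zero =>
      have : W 0 = fun _ => 1 := by
        funext ω; simp [hW, SimpleProc.exponent]
      rw [this]; exact memLp_const _
    | succ j ih =>
      have := (ih.add (hmulψ j (hWm j) ih).1).add (hmule j (hWm j) ih).1
      refine this.congr_norm ((hWm _).mono (F.le _) le_rfl).aestronglyMeasurable
        (ae_of_all _ fun ω => ?_)
      simp only [Pi.add_apply, hWs]
  have hWe0 : ∀ j {X : Ω → ℝ}, Measurable[F (τ j)] X → MemLp X 2 P →
      ∫ ω, X ω * (W j ω * e j ω) ∂P = 0 := by
    intro j X hX hX2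
    have h1 := (hmule j (hWm j) (hW2 j)).1
    simp only [he, hv] at h1 ⊢
    refine hB.integral_mul_mul_increment (hτm j) hX hX2 (hWm j) (hψm j)
      (f := fun x y => expRem x (T / 2 ^ k) y) hexp (fun x => ?_) h1
    rw [hv]; exact integral_expRem _ _
  -- the recursion for the distance
  set D : ℕ → Ω → ℝ := fun j ω => W j ω - Z j ω with hD
  have hDm : ∀ j, Measurable[F (τ j)] (D j) := fun j => (hWm j).sub (hZ j)
  have hD2 : ∀ j, MemLp (D j) 2 P := fun j => (hW2 j).sub (hZ2 j)
  set u : ℕ → ℝ := fun j => ∫ ω, D j ω ^ 2 ∂P with hu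
  have hu0 : u 0 ≤ 0 := by
    refine le_of_eq (integral_eq_zero_of_ae ?_)
    filter_upwards [hZ0] with ω hω
    simp [hD, hω, hW, SimpleProc.exponent]
  have hrec : ∀ j < 2 ^ k, u (j + 1) ≤ (1 + C₁ * δ) * u j + C₂ * δ ^ 2 := by
    intro j hj
    have m1 := (hmulψ j (hDm j) (hD2 j))
    have m2 := (hmule j (hWm j) (hW2 j))
    set A : Ω → ℝ := fun ω => (D j ω * ψ j ω) * Δ j ω + W j ω * e j ω - R j ω with hA
    have hA2 : MemLp A 2 P := (m1.1.add m2.1).sub (hR2 j)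
    have hDs : ∀ᵐ ω ∂P, D (j + 1) ω = D j ω + A ω := by
      filter_upwards [hZa' j hj.le] with ω hω
      have h1 : ψ j ω * Z j ω = H j ω := by
        simp only [hψ]
        rw [max_eq_left hω]
        exact div_mul_cancel₀ _ (ha.trans_le hω).ne'
      simp only [hD, hA, hR, hWs, ← h1]
      ring
    have horth : ∫ ω, D j ω * A ω ∂P = 0 := by
      have h1 : ∫ ω, D j ω * ((D j ω * ψ j ω) * Δ j ω) ∂P = 0 := by
        have hDψ : MemLp (fun ω => D j ω * ψ j ω) 2 P := by
          have := (hD2 j).mul (p := ⊤) (r := 2)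
            (memLp_of_abs_le ((hψm j).mono (F.le _) le_rfl) (hψc j) ⊤)
          refine this.congr_norm (((hDm j).mul (hψm j)).mono (F.le _) le_rfl).aestronglyMeasurable
            (ae_of_all _ fun ω => ?_)
          simp only [Pi.mul_apply, mul_comm]
        exact (hlin j ((hDm j).mul (hψm j)) hDψ).2 (hDm j) (hD2 j)
      have h2 := hWe0 j (hDm j) (hD2 j)
      have h3 : ∫ ω, D j ω * R j ω ∂P = 0 := (hrem j hj).1 _ (hDm j) (hD2 j)
      have i1 := (hD2 j).integrable_mul m1.1
      have i2 := (hD2 j).integrable_mul m2.1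
      have i3 := (hD2 j).integrable_mul (hR2 j)
      have h4 := integral_sub (i1.add i2) i3
      rw [integral_add' i1 i2] at h4
      simp only [Pi.mul_apply, Pi.add_apply] at h4
      rw [h1, h2, h3] at h4
      simp only [add_zero, sub_zero] at h4
      rw [← h4]
      refine integral_congr_ae (ae_of_all _ fun ω => ?_)
      simp only [hA]; ring
    have hAle : ∫ ω, A ω ^ 2 ∂P ≤ 3 * (c ^ 2 * δ * u j) + 3 * (K * δ ^ 2 * ∫ ω, W j ω ^ 2 ∂P)
        + 3 * (κ * δ ^ 2) := by
      have i1 := m1.1.integrable_sq.const_mul 3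
      have i2 := m2.1.integrable_sq.const_mul 3
      have i3 := (hR2 j).integrable_sq.const_mul 3
      have h1 := integral_mono (μ := P) hA2.integrable_sq ((i1.add i2).add i3) (fun ω => by
        simp only [hA, Pi.add_apply]
        set x := (D j ω * ψ j ω) * Δ j ω
        set y := W j ω * e j ω
        set z := R j ω
        nlinarith [sq_nonneg (x - y), sq_nonneg (x + z), sq_nonneg (y + z)])
      rw [integral_add' (i1.add i2) i3, integral_add' i1 i2] at h1
      simp only [integral_const_mul] at h1
      have h3 : ∫ ω, R j ω ^ 2 ∂P ≤ κ * δ ^ 2 := (hrem j hj).2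
      have h4 := m1.2
      have h5 := m2.2
      linarith
    have hWle : ∫ ω, W j ω ^ 2 ∂P ≤ 2 * u j + 2 * κ ^ 2 := by
      have h1 := integral_mono (μ := P) (hW2 j).integrable_sq
        (((hD2 j).integrable_sq.const_mul 2).add (integrable_const (2 * κ ^ 2))) (fun ω => by
        have h2 : Z j ω ^ 2 ≤ κ ^ 2 := by
          rw [← sq_abs]; have := hZb j ω; gcongr
        simp only [hD, Pi.add_apply]
        nlinarith [sq_nonneg (W j ω - 2 * Z j ω)])
      rw [integral_add' ((hD2 j).integrable_sq.const_mul 2) (integrable_const _)] at h1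
      simpa [integral_const_mul] using h1
    have hu' : u (j + 1) = u j + ∫ ω, A ω ^ 2 ∂P := by
      rw [← integral_sq_add_eq_of_orthogonal (hD2 j) hA2 horth]
      refine integral_congr_ae ?_
      filter_upwards [hDs] with ω hω
      simp only [hω]
    have huj : 0 ≤ u j := integral_nonneg fun _ => sq_nonneg _
    rw [hu']
    have h6 : K * δ ^ 2 * ∫ ω, W j ω ^ 2 ∂P ≤ K * δ ^ 2 * (2 * u j + 2 * κ ^ 2) := by gcongr
    have h7 : 6 * (K * δ * u j) * δ ≤ 6 * (K * δ * u j) * T := by gcongr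
    rw [hC₁, hC₂]
    nlinarith
  have hfin := le_of_affine_recursion (by positivity) (by positivity) hu0 hrec (2 ^ k) le_rfl
  have hδN : δ * 2 ^ k = T := by rw [hδ]; field_simp
  have hfin' : u (2 ^ k) < η := by
    refine lt_of_le_of_lt hfin (lt_of_eq_of_lt ?_ hkη)
    push_cast
    have e1 : C₁ * δ * 2 ^ k = C₁ * T := by rw [mul_assoc, hδN]
    rw [e1, ← hδN]
    ring
  have hτT : τ (2 ^ k) = T := grid_last T k
  have hWT : G.stochExp B T = W (2 ^ k) := by
    funext ω
    simp only [hW, hτT]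
    rfl
  refine ⟨G, hτT, hWT ▸ hW2 _, ?_⟩
  rw [hWT]
  simpa only [hu, hD, hZh] using hfin'

/-- A bounded density of the path of a Brownian motion, bounded away from zero, is a limit in `L²`
of stochastic exponentials of simple processes. -/
lemma exists_stochExp_near [IsProbabilityMeasure P] (hB : IsFilteredBrownian P F B) {Z : Ω → ℝ}
    (hZ : Measurable[pathFiltration B hB.measurable T] Z) {a b : ℝ} (ha : 0 < a)
    (hab : ∀ ω, Z ω ∈ Icc a b) (hE : ∫ ω, Z ω ∂P = 1) {η : ℝ} (hη : 0 < η) :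
    ∃ H : SimpleProc (pathFiltration B hB.measurable), H.τ H.n = T ∧
      MemLp (H.stochExp B T) 2 P ∧ ∫ ω, (H.stochExp B T ω - Z ω) ^ 2 ∂P < η := by
  -- the path at time `0` is almost surely the constant `0`
  have hF0 : ∀ X : Ω → ℝ, Measurable[pathFiltration B hB.measurable 0] X →
      ∃ c, ∀ᵐ ω ∂P, X ω = c := by
    intro X hX
    obtain ⟨x, hx, rfl⟩ := Measurable.exists_eq_measurable_comp (f := pathUpTo B 0) hX
    refine ⟨x fun _ => 0, ?_⟩
    filter_upwards [hB.brownian.toIsPreBrownianReal.eval_zero_ae_eq_zero] with ω hω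
    simp only [Function.comp]
    congr 1
    funext s
    have : (s : ℝ≥0) = 0 := le_antisymm s.2 zero_le
    simp [pathUpTo, this, hω]
  set ζ := min (a / 8) (min ((a / 8) ^ 2) (η / 16)) with hζ
  have hζ0 : 0 < ζ := by simp only [hζ]; positivity
  have hζ1 : ζ ≤ a / 8 := min_le_left _ _
  have hζ2 : ζ ≤ (a / 8) ^ 2 := (min_le_right _ _).trans (min_le_left _ _)
  have hζ3 : ζ ≤ η / 16 := (min_le_right _ _).trans (min_le_right _ _)
  obtain ⟨f, hf, hfb, hfZ⟩ := exists_trig_near_of_bounds hB.toPath hZ hab hζ0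
  have hfe := hasStepExpansion_of_mem hB.toPath hf
  obtain ⟨κ, -, hfκ⟩ := hfe.bounded
  have hfm : Measurable f := hfe.measurable.mono ((pathFiltration B hB.measurable).le _) le_rfl
  have hZm : Measurable Z := hZ.mono ((pathFiltration B hB.measurable).le T) le_rfl
  have hZ2 : MemLp Z 2 P := memLp_of_abs_le hZm (κ := b) (fun ω => by
    rw [abs_of_nonneg (ha.le.trans (hab ω).1)]; exact (hab ω).2) 2
  have hf2 : MemLp f 2 P := memLp_of_abs_le hfm hfκ 2
  have hd2 : MemLp (fun ω => f ω - Z ω) 2 P := hf2.sub hZ2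
  -- adding the constant `x` restores the mean one, at a cost controlled by Jensen's inequality
  set x := 1 - ∫ ω, f ω ∂P with hx
  have hxe : ∫ ω, (f ω - Z ω) ∂P = -x := by
    rw [integral_sub (hf2.integrable one_le_two) (hZ2.integrable one_le_two), hE, hx]; ring
  have hx2 : x ^ 2 ≤ ∫ ω, (f ω - Z ω) ^ 2 ∂P := by
    have h1 : 0 ≤ ∫ ω, (f ω - Z ω + x) ^ 2 ∂P := integral_nonneg fun _ => sq_nonneg _
    have e : ∀ ω, (f ω - Z ω + x) ^ 2 = (f ω - Z ω) ^ 2 + ((f ω - Z ω) * (2 * x) + x ^ 2) :=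
      fun ω => by ring
    simp_rw [e] at h1
    have i1 := (hd2.integrable one_le_two).mul_const (2 * x)
    rw [integral_add hd2.integrable_sq (i1.fun_add (integrable_const _)),
      integral_add i1 (integrable_const _), integral_mul_const, hxe] at h1
    simp only [integral_const, probReal_univ, one_smul] at h1
    nlinarith
  have hxa : |x| ≤ a / 8 := abs_le_of_sq_le_sq (by linarith) (by positivity)
  set h : Ω → ℝ := f + fun _ => x with hh
  have hhm : h ∈ trigSpan B T := add_mem hf (const_mem_trigSpan B T x)
  have hhE : ∫ ω, h ω ∂P = 1 := by
    rw [hh, integral_add' (hf2.integrable one_le_two) (integrable_const _)]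
    simp [hx]
  obtain ⟨H, hHT, hH2, hHh⟩ := (hasStepExpansion_of_mem hB.toPath hhm).exists_stochExp_near
    hB.toPath hF0 hhE (a := a / 2) (by positivity) (fun ω => by
      simp only [hh, Pi.add_apply]
      linarith [(hfb ω).1, (abs_le.1 hxa).1]) (η := η / 4) (by positivity)
  refine ⟨H, hHT, hH2, ?_⟩
  have hh2 : MemLp h 2 P := hf2.add (memLp_const _)
  have i1 := (hH2.sub hh2).integrable_sq.const_mul 2
  have i2 := hd2.integrable_sq.const_mul 4
  have i3 : Integrable (fun _ : Ω => 4 * x ^ 2) P := integrable_const _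
  have h1 := integral_mono (μ := P) (hH2.sub hZ2).integrable_sq ((i1.add i2).add i3) (fun ω => by
    simp only [hh, Pi.add_apply, Pi.sub_apply]
    nlinarith [sq_nonneg (H.stochExp B T ω - (f ω + x) - (f ω + x - Z ω)),
      sq_nonneg (f ω - Z ω - x)])
  rw [integral_add' (i1.add i2) i3, integral_add' i1 i2] at h1
  simp only [integral_const_mul, integral_const, probReal_univ, one_smul, Pi.sub_apply] at h1
  linarith

end ApproxExp

/-! ### Truncation of densities -/

/-- Decreasing the argument increases a penalty function in a controlled way. -/
lemma IsPenalty.modulus {Φ : ℝ → ℝ} (h : IsPenalty Φ) {ε : ℝ} (hε : 0 < ε) :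
    ∃ C, 0 ≤ C ∧ ∀ y z, 0 ≤ y → y ≤ z → Φ y ≤ Φ z + ε + C * (z - y) := by
  obtain ⟨δ, hδ, hδ'⟩ := Metric.continuousWithinAt_iff.1 (h.cont 0 (by simp)) (ε / 2) (by linarith)
  have h0 := h.nonneg 0 le_rfl
  have hnear : ∀ x, 0 ≤ x → x < δ → |Φ x - Φ 0| < ε / 2 := fun x hx hxδ => by
    have := hδ' (x := x) hx (by rw [Real.dist_eq, sub_zero, abs_of_nonneg hx]; exact hxδ)
    rwa [Real.dist_eq] at this
  refine ⟨Φ 0 / (δ / 2), by positivity, fun y z hy hyz => ?_⟩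
  have hz := h.nonneg z (hy.trans hyz)
  have hC : 0 ≤ Φ 0 / (δ / 2) := by positivity
  rcases lt_or_ge y (δ / 2) with h1 | h1
  · have a1 := abs_lt.1 (hnear y hy (by linarith))
    rcases lt_or_ge z δ with h2 | h2
    · have a2 := abs_lt.1 (hnear z (hy.trans hyz) h2)
      have := mul_nonneg hC (sub_nonneg.2 hyz)
      linarith
    · have : Φ 0 / (δ / 2) * (δ / 2) ≤ Φ 0 / (δ / 2) * (z - y) := by
        gcongr; linarith
      rw [div_mul_cancel₀ _ (by positivity)] at this
      linarith
  · rcases hyz.eq_or_lt with rfl | hyz'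
    · simp; linarith
    have hy0 : 0 < y := by linarith
    have hs := h.convex.slope_mono_adjacent (x := 0) (y := y) (z := z) (by simp)
      (hy.trans hyz) hy0 hyz'
    have h3 : -(Φ 0 / (δ / 2)) ≤ (Φ y - Φ 0) / (y - 0) := by
      rw [sub_zero, le_div_iff₀ hy0, ← neg_div, div_mul_eq_mul_div, div_le_iff₀ (by positivity)]
      have := h.nonneg y hy
      nlinarith
    have h4 := h3.trans hs
    rw [le_div_iff₀ (by linarith)] at h4
    linarith

section Truncation

variable {Ω : Type u} {m : MeasurableSpace Ω} {P : Measure Ω}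

lemma integral_sq_eq_eLpNorm {X : Ω → ℝ} (hX : MemLp X 2 P) :
    ∫ ω, X ω ^ 2 ∂P = (eLpNorm X 2 P).toReal ^ 2 := by
  have h3 : 0 ≤ ∫ ω, ‖X ω‖ ^ (2 : ℝ) ∂P := integral_nonneg fun _ => by positivity
  rw [hX.eLpNorm_eq_integral_rpow_norm (by simp) (by simp)]
  simp only [ENNReal.toReal_ofNat]
  rw [ENNReal.toReal_ofReal (by positivity), ← Real.rpow_natCast, ← Real.rpow_mul h3]
  norm_num

lemma integral_sq_condExp_le [IsProbabilityMeasure P] (𝓖 : MeasurableSpace Ω)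
    {X : Ω → ℝ} (hX : MemLp X 2 P) :
    MemLp (P[X | 𝓖]) 2 P ∧ ∫ ω, (P[X | 𝓖]) ω ^ 2 ∂P ≤ ∫ ω, X ω ^ 2 ∂P := by
  have h2 : MemLp (P[X | 𝓖]) 2 P := hX.condExp one_le_two
  refine ⟨h2, ?_⟩
  rw [integral_sq_eq_eLpNorm h2, integral_sq_eq_eLpNorm hX]
  exact pow_le_pow_left₀ ENNReal.toReal_nonneg
    (ENNReal.toReal_mono hX.eLpNorm_ne_top (eLpNorm_condExp_le_eLpNorm X one_le_two)) 2

lemma exists_integral_sub_min_lt [IsProbabilityMeasure P] {Z : Ω → ℝ} (hZi : Integrable Z P)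
    {e : ℝ} (he : 0 < e) : ∃ M : ℝ, 1 ≤ M ∧ ∫ ω, (Z ω - min (Z ω) M) ∂P < e := by
  have h1 : Tendsto (fun n : ℕ => ∫ ω, (Z ω - min (Z ω) n) ∂P) atTop (𝓝 (∫ _, (0 : ℝ) ∂P)) := by
    refine tendsto_integral_of_dominated_convergence (fun ω => |Z ω|)
      (fun n => (hZi.sub (hZi.inf (integrable_const _))).aestronglyMeasurable) hZi.abs
      (fun n => ae_of_all _ fun ω => ?_) (ae_of_all _ fun ω => ?_)
    · rcases le_total (Z ω) n with h | h
      · simp [min_eq_left h]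
      · rw [min_eq_right h, Real.norm_eq_abs, abs_of_nonneg (by linarith)]
        have : (0 : ℝ) ≤ n := n.cast_nonneg
        linarith [le_abs_self (Z ω)]
    · obtain ⟨N, hN⟩ := exists_nat_ge (Z ω)
      refine tendsto_const_nhds.congr' ?_
      filter_upwards [eventually_ge_atTop N] with n hn
      rw [min_eq_left (hN.trans (by exact_mod_cast hn)), sub_self]
  rw [integral_zero] at h1
  obtain ⟨n, hn1, hn2⟩ := ((h1.eventually_lt_const he).and (eventually_ge_atTop 1)).exists
  exact ⟨n, by exact_mod_cast hn2, hn1⟩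

/-- A density is close in `L¹` to a bounded density that is bounded away from zero and whose
conditional penalties are not much larger: truncate from above and add a small constant. -/
lemma exists_bounded_density [IsProbabilityMeasure P] {Φ : ℝ → ℝ} (hΦ : IsPenalty Φ) {Z : Ω → ℝ}
    (hZ0 : ∀ ω, 0 ≤ Z ω) (hZi : Integrable Z P) (hE : ∫ ω, Z ω ∂P = 1) {ε : ℝ} (hε : 0 < ε) :
    ∃ α γ M : ℝ, 0 < γ ∧ 0 ≤ α ∧ α ≤ 1 ∧ 1 ≤ M ∧ ∫ ω, (α * min (Z ω) M + γ) ∂P = 1 ∧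
      ∫ ω, |α * min (Z ω) M + γ - Z ω| ∂P < ε ∧
      ∀ 𝓖 : MeasurableSpace Ω, 𝓖 ≤ m →
        ∫⁻ ω, ENNReal.ofReal (Φ ((P[fun ω => α * min (Z ω) M + γ | 𝓖]) ω)) ∂P ≤
          ∫⁻ ω, ENNReal.ofReal (Φ ((P[Z | 𝓖]) ω)) ∂P + ENNReal.ofReal ε := by
  have h0 := hΦ.nonneg 0 le_rfl
  have h2 := hΦ.nonneg 2 (by norm_num)
  set c := Φ 0 + Φ 2 with hc
  have hc0 : 0 ≤ c := add_nonneg h0 h2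
  set l := min (1 / 2) (min (ε / 8) (ε / (4 * (c + 1)))) with hl
  have hl0 : 0 < l := by simp only [hl]; positivity
  have hl1 : l ≤ 1 / 2 := min_le_left _ _
  have hl2 : l ≤ ε / 8 := (min_le_right _ _).trans (min_le_left _ _)
  have hl3 : l * c ≤ ε / 4 := by
    have h1 : l ≤ ε / (4 * (c + 1)) := (min_le_right _ _).trans (min_le_right _ _)
    rw [le_div_iff₀ (by positivity)] at h1
    nlinarith
  obtain ⟨C, hC, hmod⟩ := hΦ.modulus (ε := ε / 4) (by linarith)
  obtain ⟨M, hM1, hM⟩ := exists_integral_sub_min_lt hZi (e := min l (ε / (4 * (C + 1))))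
    (lt_min hl0 (by positivity))
  set Y : Ω → ℝ := fun ω => min (Z ω) M with hY
  have hYi : Integrable Y P := hZi.inf (integrable_const _)
  have hY0 : ∀ ω, 0 ≤ Y ω := fun ω => le_min (hZ0 ω) (by linarith)
  have hYZ : ∀ ω, Y ω ≤ Z ω := fun ω => min_le_left _ _
  set e := ∫ ω, (Z ω - Y ω) ∂P with he
  have he0 : 0 ≤ e := integral_nonneg fun ω => sub_nonneg.2 (hYZ ω)
  have hel : e ≤ l := hM.le.trans (min_le_left _ _)
  have heC : C * e ≤ ε / 4 := by
    have h1 : e ≤ ε / (4 * (C + 1)) := hM.le.trans (min_le_right _ _)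
    rw [le_div_iff₀ (by positivity)] at h1
    nlinarith
  have hYE : ∫ ω, Y ω ∂P = 1 - e := by
    rw [he, integral_sub hZi hYi, hE]; ring
  -- the constant for which `(1 - l) Y + γ` has mean one; it equals `l (γ / l)` with `γ / l ≤ 2`, so
  -- that the result is a convex combination of `Y` and a number in `[0, 2]`
  set γ := l + (1 - l) * e with hγ
  have hγ0 : 0 < γ := by nlinarith
  have hγ2 : γ ≤ 2 * l := by nlinarith
  have hi := (hYi.const_mul (1 - l))
  refine ⟨1 - l, γ, M, hγ0, by linarith, by linarith, hM1, ?_, ?_, fun 𝓖 h𝓖 => ?_⟩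
  · change ∫ ω, ((1 - l) * Y ω + γ) ∂P = 1
    rw [integral_add hi (integrable_const _), integral_const_mul, hYE]
    simp [hγ]; ring
  · have h1 := integral_mono (μ := P) (f := fun ω => |(1 - l) * Y ω + γ - Z ω|)
      (g := fun ω => (Z ω - Y ω) + (l * Y ω + γ))
      ((hi.add (integrable_const _)).sub hZi).abs
      ((hZi.sub hYi).add ((hYi.const_mul l).add (integrable_const _))) (fun ω => by
        have := hY0 ω
        have := hYZ ω
        simp only
        rw [abs_le]
        constructor <;> nlinarith)
    have i1 : Integrable (fun ω => l * Y ω) P := hYi.const_mul l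
    rw [integral_add (integrable_fun_sub hZi hYi) (i1.fun_add (integrable_const _)),
      integral_add i1 (integrable_const _), integral_const_mul, hYE] at h1
    simp only [integral_const, probReal_univ, one_smul] at h1
    change ∫ ω, |(1 - l) * Y ω + γ - Z ω| ∂P < ε
    nlinarith
  · have hcond : P[fun ω => (1 - l) * Y ω + γ | 𝓖] =ᵐ[P] fun ω => (1 - l) * (P[Y | 𝓖]) ω + γ := by
      have a1 := condExp_add (μ := P) (m := 𝓖) hi (integrable_const γ)
      have a2 := condExp_smul (μ := P) (1 - l) Y 𝓖
      filter_upwards [a1, a2] with ω b1 b2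
      have b1' : (P[fun ω => (1 - l) * Y ω + γ | 𝓖]) ω
          = (P[fun ω => (1 - l) * Y ω | 𝓖]) ω + (P[fun _ : Ω => γ | 𝓖]) ω := b1
      have b2' : (P[fun ω => (1 - l) * Y ω | 𝓖]) ω = (1 - l) * (P[Y | 𝓖]) ω := b2
      rw [b1', b2', condExp_const h𝓖]
    have hYc : 0 ≤ᵐ[P] P[Y | 𝓖] := condExp_nonneg (ae_of_all _ hY0)
    have hYZc : P[Y | 𝓖] ≤ᵐ[P] P[Z | 𝓖] := condExp_mono hYi hZi (ae_of_all _ hYZ)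
    have hpt : ∀ᵐ ω ∂P, ENNReal.ofReal (Φ ((P[fun ω => (1 - l) * Y ω + γ | 𝓖]) ω)) ≤
        ENNReal.ofReal (Φ ((P[Z | 𝓖]) ω)) + ENNReal.ofReal (ε / 2 + C *
          ((P[Z | 𝓖]) ω - (P[Y | 𝓖]) ω)) := by
      filter_upwards [hcond, hYc, hYZc] with ω a1 a2 a3
      have a2' : 0 ≤ (P[Y | 𝓖]) ω := a2
      have a4 := hmod _ _ a2 a3
      have a5 : γ / l ≤ 2 := by rw [div_le_iff₀ hl0]; linarith
      have a5' : 0 ≤ γ / l := by positivity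
      have a6 := hΦ.le_add a5' a5
      have a7 := hΦ.convex.2 (mem_Ici.2 a2') (mem_Ici.2 a5') (by linarith : 0 ≤ 1 - l) hl0.le
        (by ring)
      simp only [smul_eq_mul] at a7
      rw [mul_div_cancel₀ _ hl0.ne', ← a1] at a7
      have a8 := hΦ.nonneg _ a2'
      have a9 : l * Φ (γ / l) ≤ l * c := by gcongr
      refine (ENNReal.ofReal_le_ofReal ?_).trans (ENNReal.ofReal_add_le)
      nlinarith
    refine (lintegral_mono_ae hpt).trans ?_
    have hgm : Measurable[m] fun ω => ENNReal.ofReal (ε / 2 + C *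
          ((P[Z | 𝓖]) ω - (P[Y | 𝓖]) ω)) := by
      have m1 : Measurable[m] (P[Z | 𝓖]) := (stronglyMeasurable_condExp.mono h𝓖).measurable
      have m2 : Measurable[m] (P[Y | 𝓖]) := (stronglyMeasurable_condExp.mono h𝓖).measurable
      exact (((m1.sub m2).const_mul C).const_add _).ennreal_ofReal
    rw [lintegral_add_right _ hgm]
    gcongr
    have i2 : Integrable (fun ω => (P[Z | 𝓖]) ω - (P[Y | 𝓖]) ω) P :=
      integrable_condExp.sub integrable_condExp
    have i1 := (integrable_const (μ := P) (ε / 2)).fun_add (i2.const_mul C)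
    rw [← ofReal_integral_eq_lintegral_ofReal i1 (by
      filter_upwards [hYZc] with ω a3
      have := mul_nonneg hC (sub_nonneg.2 a3)
      simp only [Pi.zero_apply]; linarith)]
    refine ENNReal.ofReal_le_ofReal ?_
    rw [integral_add (integrable_const _) (i2.const_mul C), integral_const_mul,
      integral_sub integrable_condExp integrable_condExp, integral_condExp h𝓖,
      integral_condExp h𝓖, hE, hYE]
    simp only [integral_const, probReal_univ, one_smul]
    nlinarith

/-- Every density of the path of a Brownian motion is a limit in `L¹` of stochastic exponentials of
simple processes whose conditional penalties are larger by at most an arbitrarily small `ε`. -/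
lemma exists_stochExp_penalty_le [IsProbabilityMeasure P] {F : Filtration ℝ≥0 m}
    {B : ℝ≥0 → Ω → ℝ} (hB : IsFilteredBrownian P F B) {Φ : ℝ → ℝ} (hΦ : IsPenalty Φ) {T : ℝ≥0}
    {Z : Ω → ℝ} (hZ : Measurable[pathFiltration B hB.measurable T] Z) (hZ0 : ∀ ω, 0 ≤ Z ω)
    (hZi : Integrable Z P) (hE : ∫ ω, Z ω ∂P = 1) {ε : ℝ} (hε : 0 < ε) :
    ∃ H : SimpleProc (pathFiltration B hB.measurable), H.τ H.n = T ∧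
      Integrable (H.stochExp B T) P ∧ ∫ ω, |H.stochExp B T ω - Z ω| ∂P < ε ∧
      ∀ t, ∫⁻ ω, ENNReal.ofReal
          (Φ ((P[H.stochExp B T | pathFiltration B hB.measurable t]) ω)) ∂P ≤
        ∫⁻ ω, ENNReal.ofReal (Φ ((P[Z | pathFiltration B hB.measurable t]) ω)) ∂P
          + ENNReal.ofReal ε := by
  set 𝓖 := pathFiltration B hB.measurable with h𝓖
  obtain ⟨α, γ, M, hγ, hα0, hα1, hM, hhE, hhZ, hhp⟩ :=
    exists_bounded_density hΦ hZ0 hZi hE (ε := ε / 2) (by linarith)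
  set h : Ω → ℝ := fun ω => α * min (Z ω) M + γ with hh
  have hhm : Measurable[𝓖 T] h := ((hZ.min measurable_const).const_mul α).add_const γ
  have hhb : ∀ ω, h ω ∈ Icc γ (M + γ) := fun ω => by
    have h1 : 0 ≤ min (Z ω) M := le_min (hZ0 ω) (by linarith)
    have h2 : min (Z ω) M ≤ M := min_le_right _ _
    simp only [hh]
    constructor <;> nlinarith
  have hh2 : MemLp h 2 P := memLp_of_abs_le (hhm.mono (𝓖.le T) le_rfl) (κ := M + γ) (fun ω => by
    rw [abs_of_nonneg (hγ.le.trans (hhb ω).1)]; exact (hhb ω).2) 2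
  have hhi : Integrable h P := hh2.integrable one_le_two
  obtain ⟨L, hL, hloc⟩ := hΦ.local_bound (a := γ) (b := M + γ) hγ
  -- the elementary bound `|x| ≤ ζ + x² / ζ` reduces first moments to second moments
  set ζ := min (ε / 8) (ε / (8 * (L + 1))) with hζ
  have hζ0 : 0 < ζ := lt_min (by positivity) (by positivity)
  have hζ1 : ζ ≤ ε / 8 := min_le_left _ _
  have hζ2 : L * ζ ≤ ε / 8 := by
    have h1 : ζ ≤ ε / (8 * (L + 1)) := min_le_right _ _
    rw [le_div_iff₀ (by positivity)] at h1
    nlinarith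
  have habs : ∀ x : ℝ, |x| ≤ ζ + x ^ 2 / ζ := fun x => by
    rw [← sq_abs, ← sub_le_iff_le_add', le_div_iff₀ hζ0]
    nlinarith [sq_nonneg (|x| - ζ), sq_nonneg (|x|), abs_nonneg x]
  set K := 1 / ζ + 1 with hK
  have hK0 : 0 < K := by positivity
  obtain ⟨H, hHT, hH2, hHh⟩ := exists_stochExp_near hB hhm hγ hhb hhE
    (η := ε / (8 * (L + 1) * K)) (by positivity)
  rw [lt_div_iff₀ (by positivity)] at hHh
  set W := H.stochExp B T with hW
  have hWi : Integrable W P := hH2.integrable one_le_two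
  set d := ∫ ω, (W ω - h ω) ^ 2 ∂P with hd
  have hd0 : 0 ≤ d := integral_nonneg fun _ => sq_nonneg _
  have hdK : d * K ≤ ε / 8 := by nlinarith [mul_nonneg hd0 hK0.le]
  have hdLK : L * K * d ≤ ε / 8 := by nlinarith [mul_nonneg hd0 hK0.le]
  have hdiff : MemLp (fun ω => W ω - h ω) 2 P := hH2.sub hh2
  refine ⟨H, hHT, hWi, ?_, fun t => ?_⟩
  · have i1 : Integrable (fun ω => ζ + (W ω - h ω) ^ 2 / ζ) P :=
      (integrable_const _).add (hdiff.integrable_sq.div_const ζ)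
    have h1 := integral_mono (μ := P) (hWi.sub hZi).abs (i1.add (hhi.sub hZi).abs) (fun ω => by
      have h2 := habs (W ω - h ω)
      have h3 := abs_sub_le (W ω) (h ω) (Z ω)
      simp only [Pi.add_apply, Pi.sub_apply]
      linarith)
    rw [integral_add' i1 (hhi.sub hZi).abs,
      integral_add (integrable_const _) (hdiff.integrable_sq.div_const ζ), integral_div] at h1
    simp only [integral_const, probReal_univ, one_smul, Pi.sub_apply] at h1
    have h4 : d / ζ ≤ d * K := by rw [hK, mul_add, mul_one_div]; linarith
    linarith
  · have hc0 : 0 ≤ᵐ[P] P[W | 𝓖 t] := condExp_nonneg (ae_of_all _ fun ω => (Real.exp_pos _).le)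
    have hlo : (fun _ => γ) ≤ᵐ[P] P[h | 𝓖 t] := by
      have := condExp_mono (m := 𝓖 t) (integrable_const γ) hhi (ae_of_all P fun ω => (hhb ω).1)
      rwa [condExp_const (𝓖.le t)] at this
    have hhi' : P[h | 𝓖 t] ≤ᵐ[P] fun _ => M + γ := by
      have := condExp_mono (m := 𝓖 t) hhi (integrable_const (M + γ))
        (ae_of_all P fun ω => (hhb ω).2)
      rwa [condExp_const (𝓖.le t)] at this
    have hsub := condExp_sub (m := 𝓖 t) hWi hhi
    have hV := integral_sq_condExp_le (P := P) (𝓖 t) hdiff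
    set V := P[fun ω => W ω - h ω | 𝓖 t] with hVdef
    have hVm : Measurable V := stronglyMeasurable_condExp.measurable.mono (𝓖.le t) le_rfl
    have hpt : ∀ᵐ ω ∂P, ENNReal.ofReal (Φ ((P[W | 𝓖 t]) ω)) ≤
        ENNReal.ofReal (Φ ((P[h | 𝓖 t]) ω)) + ENNReal.ofReal (L * ζ + L * K * V ω ^ 2) := by
      filter_upwards [hc0, hlo, hhi', hsub] with ω a1 a2 a3 a4
      have a4' : V ω = (P[W | 𝓖 t]) ω - (P[h | 𝓖 t]) ω := a4
      have a5 := hloc _ ⟨a2, a3⟩ _ a1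
      rw [← a4'] at a5
      have a6 : L * (|V ω| + V ω ^ 2) ≤ L * (ζ + V ω ^ 2 / ζ + V ω ^ 2) := by
        gcongr; exact habs _
      have a7 : L * (ζ + V ω ^ 2 / ζ + V ω ^ 2) = L * ζ + L * K * V ω ^ 2 := by
        rw [hK]; ring
      refine (ENNReal.ofReal_le_ofReal ?_).trans (ENNReal.ofReal_add_le)
      linarith
    refine (lintegral_mono_ae hpt).trans ?_
    rw [lintegral_add_right _ (by fun_prop)]
    have i1 := (integrable_const (μ := P) (L * ζ)).fun_add (hV.1.integrable_sq.const_mul (L * K))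
    rw [← ofReal_integral_eq_lintegral_ofReal i1 (ae_of_all _ fun ω => by positivity)]
    have h5 : ∫ ω, (L * ζ + L * K * V ω ^ 2) ∂P ≤ ε / 2 := by
      have e : ∫ ω, L * K * V ω ^ 2 ∂P = L * K * ∫ ω, V ω ^ 2 ∂P := integral_const_mul _ _
      rw [integral_add (integrable_const _) (hV.1.integrable_sq.const_mul (L * K)), e]
      simp only [integral_const, probReal_univ, one_smul]
      have := mul_le_mul_of_nonneg_left hV.2 (by positivity : 0 ≤ L * K)
      linarith
    calc _ ≤ (∫⁻ ω, ENNReal.ofReal (Φ ((P[Z | 𝓖 t]) ω)) ∂P + ENNReal.ofReal (ε / 2))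
          + ENNReal.ofReal (ε / 2) := by gcongr; exact hhp _ (𝓖.le t)
      _ = _ := by
        rw [add_assoc, ← ENNReal.ofReal_add (by linarith) (by linarith), add_halves]

end Truncation

/-! ### Product densities and admissible controls of the maximizer -/

section ProdDensity

variable {Ω : Type u} {m : MeasurableSpace Ω} {κ : Type*} [Fintype κ] {E : κ → Type*}
  [∀ k, MeasurableSpace (E k)] {P : Measure Ω} {X : (k : κ) → Ω → E k} {w : (k : κ) → E k → ℝ≥0∞}

/-- The measure with density `∏ k, w k (X k)`. If the `X k` are independent, this changes their
marginal laws and keeps their independence. -/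
noncomputable def prodDensity (P : Measure Ω) (X : (k : κ) → Ω → E k)
    (w : (k : κ) → E k → ℝ≥0∞) : Measure Ω :=
  P.withDensity fun ω => ∏ k, w k (X k ω)

lemma prodDensity_inter (hX : ∀ k, Measurable (X k)) (hind : iIndepFun X P)
    (hw : ∀ k, Measurable (w k)) (hw1 : ∀ k, ∫⁻ ω, w k (X k ω) ∂P = 1) (s : Finset κ)
    {A : (k : κ) → Set (E k)} (hA : ∀ k ∈ s, MeasurableSet (A k)) :
    prodDensity P X w (⋂ k ∈ s, X k ⁻¹' A k) = ∏ k ∈ s, ∫⁻ ω in X k ⁻¹' A k, w k (X k ω) ∂P := by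
  classical
  -- the indices outside `s` contribute a factor one
  set A' : (k : κ) → Set (E k) := fun k => if k ∈ s then A k else univ with hA'
  have hA'm : ∀ k, MeasurableSet (A' k) := fun k => by
    by_cases hk : k ∈ s
    · simp only [hA', if_pos hk]; exact hA k hk
    · simp only [hA', if_neg hk]; exact MeasurableSet.univ
  have hset : MeasurableSet (⋂ k ∈ s, X k ⁻¹' A k) :=
    Finset.measurableSet_biInter s fun k hk => hX k (hA k hk)
  have e1 : ∀ ω, (⋂ k ∈ s, X k ⁻¹' A k).indicator (fun ω => ∏ k, w k (X k ω)) ω =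
      ∏ k, (A' k).indicator (w k) (X k ω) := by
    intro ω
    by_cases hω : ω ∈ ⋂ k ∈ s, X k ⁻¹' A k
    · rw [indicator_of_mem hω]
      refine Finset.prod_congr rfl fun k _ => ?_
      rw [indicator_of_mem]
      by_cases hk : k ∈ s
      · simp only [hA', if_pos hk]; exact mem_iInter₂.1 hω k hk
      · simp only [hA', if_neg hk, mem_univ]
    · rw [indicator_of_notMem hω]
      simp only [mem_iInter, not_forall] at hω
      obtain ⟨k, hk, hkω⟩ := hω
      have hk' : X k ω ∉ A' k := by simp only [hA', if_pos hk]; exact hkω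
      have h0 : (A' k).indicator (w k) (X k ω) = 0 := indicator_of_notMem hk' _
      exact (Finset.prod_eq_zero (Finset.mem_univ k) h0).symm
  have hi := lintegral_prod_eq_prod_lintegral_of_indepFun Finset.univ
    (fun k ω => (A' k).indicator (w k) (X k ω))
    (hind.comp (fun k => (A' k).indicator (w k)) fun k => (hw k).indicator (hA'm k))
    (fun k => ((hw k).indicator (hA'm k)).comp (hX k))
  have e2 : ∀ k, ∫⁻ ω, (A' k).indicator (w k) (X k ω) ∂P =
      if k ∈ s then ∫⁻ ω in X k ⁻¹' A k, w k (X k ω) ∂P else 1 := by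
    intro k
    by_cases hk : k ∈ s
    · simp only [hA', if_pos hk]
      rw [← lintegral_indicator (hX k (hA k hk))]
      rfl
    · simp only [hA', if_neg hk, indicator_univ, hw1]
  rw [prodDensity, withDensity_apply _ hset, ← lintegral_indicator hset]
  simp_rw [e1]
  rw [hi]
  simp_rw [e2]
  rw [Finset.prod_ite_mem, Finset.univ_inter]

lemma isProbabilityMeasure_prodDensity (hX : ∀ k, Measurable (X k)) (hind : iIndepFun X P)
    (hw : ∀ k, Measurable (w k)) (hw1 : ∀ k, ∫⁻ ω, w k (X k ω) ∂P = 1) :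
    IsProbabilityMeasure (prodDensity P X w) :=
  ⟨by simpa using prodDensity_inter hX hind hw hw1 ∅ (A := fun _ => univ) (by simp)⟩

lemma prodDensity_preimage (hX : ∀ k, Measurable (X k)) (hind : iIndepFun X P)
    (hw : ∀ k, Measurable (w k)) (hw1 : ∀ k, ∫⁻ ω, w k (X k ω) ∂P = 1) (k : κ) {A : Set (E k)}
    (hA : MeasurableSet A) :
    prodDensity P X w (X k ⁻¹' A) = ∫⁻ ω in X k ⁻¹' A, w k (X k ω) ∂P := by
  classical
  have := prodDensity_inter hX hind hw hw1 {k}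
    (A := fun j => if h : j = k then h ▸ A else univ) (by simpa using hA)
  simpa using this

lemma iIndepFun_prodDensity (hX : ∀ k, Measurable (X k)) (hind : iIndepFun X P)
    (hw : ∀ k, Measurable (w k)) (hw1 : ∀ k, ∫⁻ ω, w k (X k ω) ∂P = 1) :
    iIndepFun X (prodDensity P X w) := by
  rw [iIndepFun_iff_measure_inter_preimage_eq_mul]
  intro s A hA
  rw [prodDensity_inter hX hind hw hw1 s hA]
  exact Finset.prod_congr rfl fun k hk =>
    (prodDensity_preimage hX hind hw hw1 k (hA k hk)).symm

lemma lintegral_prodDensity (hX : ∀ k, Measurable (X k)) (hw : ∀ k, Measurable (w k))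
    {f : Ω → ℝ≥0∞} (hf : Measurable f) :
    ∫⁻ ω, f ω ∂(prodDensity P X w) = ∫⁻ ω, (∏ k, w k (X k ω)) * f ω ∂P :=
  lintegral_withDensity_eq_lintegral_mul _
    (Finset.measurable_fun_prod _ fun k _ => (hw k).comp (hX k)) hf

end ProdDensity

section Controls

variable {I : ℕ}

/-- The path of a process on the whole time axis. -/
def GameBasis.path (S : GameBasis.{u} I) (k : Source × Fin I) (ω : S.Ω) : ℝ≥0 → ℝ :=
  fun t => S.B k t ω

lemma GameBasis.measurable (S : GameBasis.{u} I) (k : Source × Fin I) (t : ℝ≥0) :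
    Measurable (S.B k t) := (S.brownian k).measurable t

lemma GameBasis.measurable_path (S : GameBasis.{u} I) (k : Source × Fin I) :
    Measurable (S.path k) := measurable_pi_lambda _ fun t => S.measurable k t

/-- The restriction of a path to `[0, t]`. -/
def restrictPath (t : ℝ≥0) (b : ℝ≥0 → ℝ) : Iic t → ℝ := fun s => b s

lemma measurable_restrictPath (t : ℝ≥0) : Measurable (restrictPath t) :=
  measurable_pi_lambda _ fun s => measurable_pi_apply (s : ℝ≥0)

/-- Stochastic exponentials of simple functionals of the separate Brownian motions define an
admissible control of the maximizer, by multiplication. -/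
lemma exists_maximizerControl (D : GameData I)
    (hϱ : ∫⁻ t, (D.ϱ t : ℝ≥0∞) ∂timeMeasure < ⊤) (S : GameBasis.{u} I) {T : ℝ≥0}
    (H : (k : Source × Fin I) → SimpleProc (pathFiltration (S.B k) (S.measurable k)))
    (hH : ∀ k, (H k).τ (H k).n ≤ T) :
    ∃ Q ∈ D.maximizerControls S,
      (∀ f : S.Ω → ℝ≥0∞, Measurable f → ∫⁻ ω, f ω ∂Q =
        ∫⁻ ω, (∏ k, ENNReal.ofReal ((H k).stochExp (S.B k) T ω)) * f ω ∂S.P) ∧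
      ∀ k t A, MeasurableSet[pathFiltration (S.B k) (S.measurable k) t] A →
        Q A = ∫⁻ ω in A, ENNReal.ofReal ((H k).stochExp (S.B k) T ω) ∂S.P := by
  have hBm : ∀ k, IsFilteredBrownian S.P (pathFiltration (S.B k) (S.measurable k)) (S.B k) :=
    fun k => (S.brownian k).toPath
  -- the exponentials as functionals of the paths
  have hw : ∀ k, ∃ w : (ℝ≥0 → ℝ) → ℝ≥0∞, Measurable w ∧
      ∀ ω, w (S.path k ω) = ENNReal.ofReal ((H k).stochExp (S.B k) T ω) := by
    intro k
    have h1 := ((H k).measurable_stochExp (hBm k).adapted T).ennreal_ofReal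
    obtain ⟨v, hv, hv'⟩ := Measurable.exists_eq_measurable_comp (f := pathUpTo (S.B k) T) h1
    exact ⟨v ∘ restrictPath T, hv.comp (measurable_restrictPath T), fun ω => (congrFun hv' ω).symm⟩
  choose w hwm hw using hw
  have hX := S.measurable_path
  have hind : iIndepFun S.path S.P := S.indep
  have hw1 : ∀ k, ∫⁻ ω, w k (S.path k ω) ∂S.P = 1 := fun k => by
    simp_rw [hw]; exact (H k).lintegral_stochExp (hBm k) T
  set Q := prodDensity S.P S.path w with hQ
  have hprob : IsProbabilityMeasure Q := isProbabilityMeasure_prodDensity hX hind hwm hw1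
  have hQA : ∀ k t A, MeasurableSet[pathFiltration (S.B k) (S.measurable k) t] A →
      Q A = ∫⁻ ω in A, ENNReal.ofReal ((H k).stochExp (S.B k) T ω) ∂S.P := by
    rintro k t A ⟨A', hA', rfl⟩
    simp_rw [← hw]
    exact prodDensity_preimage hX hind hwm hw1 k (A := restrictPath t ⁻¹' A')
      (measurable_restrictPath t hA')
  have hQt : ∀ k t A, MeasurableSet[pathFiltration (S.B k) (S.measurable k) t] A →
      Q A = ∫⁻ ω in A, ENNReal.ofReal ((H k).stochExp (S.B k) t ω) ∂S.P := by
    intro k t A hA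
    rw [hQA k t A hA]
    rcases le_total t T with htT | hTt
    · have hAm : MeasurableSet A := (pathFiltration (S.B k) (S.measurable k)).le t A hA
      have h1 := (H k).lintegral_mul_stochExp (hBm k) htT (X := A.indicator fun _ => 1)
        (measurable_const.indicator hA)
      rw [← lintegral_indicator hAm, ← lintegral_indicator hAm]
      have e : ∀ s ω, A.indicator (fun ω => ENNReal.ofReal ((H k).stochExp (S.B k) s ω)) ω =
          A.indicator (fun _ => 1) ω * ENNReal.ofReal ((H k).stochExp (S.B k) s ω) := by
        intro s ω
        by_cases hω : ω ∈ A <;> simp [hω]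
      simp_rw [e]
      exact h1
    · refine lintegral_congr fun ω => ?_
      rw [(H k).stochExp_of_le _ (hH k), (H k).stochExp_of_le _ ((hH k).trans hTt)]
  have hle : ∀ k t, pathFiltration (S.B k) (S.measurable k) t ≤ S.F t := fun k t =>
    pathFiltration_le (S.measurable k) (S.brownian k).adapted t
  refine ⟨Q, ⟨fun k => ((H k).ofLE (hle k)).eval, ?_⟩, fun f hf => ?_, hQA⟩
  · choose c hc0 hc1 hc2 using fun k => (H k).energy_eval_le
    have hdens : ∀ k t, lawUpTo Q (S.B k) t ≪ lawUpTo S.P (S.B k) t ∧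
        ∀ᵐ ω ∂S.P, pathDensity Q S.P (S.B k) t (pathUpTo (S.B k) t ω) =
          ENNReal.ofReal ((H k).stochExp (S.B k) t ω) := fun k t =>
      pathDensity_of_forall (S.measurable k)
        ((H k).measurable_stochExp (hBm k).adapted t).ennreal_ofReal (hQt k t)
    refine
      { isProb := hprob
        progressive := fun k => SimpleProc.isProgressive_eval _
        energy_finite := fun k t => ae_of_all _ fun ω =>
          (hc2 k t ω).trans_lt ENNReal.ofReal_lt_top
        absCont := fun k t => (hdens k t).1
        density := fun k t => ⟨((H k).ofLE (hle k)).integral (S.B k) t,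
          SimpleProc.isItoIntegral _ _ _ _, ?_⟩
        discounted_energy := fun k => ?_
        novikov := fun k t _ => ?_
        indep := iIndepFun_prodDensity hX hind hwm hw1 }
    · filter_upwards [(hdens k t).2] with ω hω
      rw [hω, (H k).stochExp_eq]
      rfl
    · have h1 : ∀ ω, ∫⁻ s, (D.ϱ s : ℝ≥0∞) * ENNReal.ofReal (((H k).ofLE (hle k)).eval s ω ^ 2)
          ∂timeMeasure ≤ (∫⁻ s, (D.ϱ s : ℝ≥0∞) ∂timeMeasure) * ENNReal.ofReal (c k) := by
        intro ω
        rw [← lintegral_mul_const' _ _ ENNReal.ofReal_ne_top]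
        refine lintegral_mono fun s => ?_
        gcongr
        exact hc1 k s ω
      refine (lintegral_mono h1).trans_lt ?_
      simp only [lintegral_const, measure_univ, mul_one]
      exact ENNReal.mul_lt_top hϱ ENNReal.ofReal_lt_top
    · have h1 : ∀ ω, ENNReal.ofReal (Real.exp ((1 / 2) *
          (energy ((H k).ofLE (hle k)).eval t ω).toReal)) ≤
          ENNReal.ofReal (Real.exp ((1 / 2) * c k)) := fun ω => by
        refine ENNReal.ofReal_le_ofReal (Real.exp_le_exp.2 ?_)
        have h2 : (energy ((H k).ofLE (hle k)).eval t ω).toReal ≤ c k :=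
          ENNReal.toReal_le_of_le_ofReal (hc0 k) (hc2 k t ω)
        linarith
      refine (lintegral_mono h1).trans_lt ?_
      simp
  · rw [hQ, lintegral_prodDensity hX hwm hf]
    simp_rw [hw]

lemma lintegral_discount_lt_top {ϱ : ℝ≥0 → ℝ≥0} (hϱ : Antitone ϱ) {p : ℝ} (hp : 0 ≤ p)
    (h : ∫⁻ t, (ϱ t : ℝ≥0∞) * (t : ℝ≥0∞) ^ p ∂timeMeasure < ⊤) :
    ∫⁻ t, (ϱ t : ℝ≥0∞) ∂timeMeasure < ⊤ := by
  have hle : ∀ t : ℝ≥0, (ϱ t : ℝ≥0∞) ≤ (Iic (1 : ℝ≥0)).indicator (fun _ => (ϱ 0 : ℝ≥0∞)) t +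
      (ϱ t : ℝ≥0∞) * (t : ℝ≥0∞) ^ p := by
    intro t
    rcases le_total t 1 with ht | ht
    · rw [indicator_of_mem (mem_Iic.2 ht)]
      exact le_add_right (by exact_mod_cast hϱ zero_le)
    · refine le_add_left ?_
      have : (1 : ℝ≥0∞) ≤ (t : ℝ≥0∞) ^ p := by
        simpa using ENNReal.rpow_le_rpow (by exact_mod_cast ht : (1 : ℝ≥0∞) ≤ t) hp
      calc (ϱ t : ℝ≥0∞) = ϱ t * 1 := (mul_one _).symm
        _ ≤ _ := by gcongr
  refine (lintegral_mono hle).trans_lt ?_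
  rw [lintegral_add_left (measurable_const.indicator measurableSet_Iic),
    lintegral_indicator_const measurableSet_Iic]
  refine ENNReal.add_lt_top.2 ⟨ENNReal.mul_lt_top ENNReal.coe_lt_top ?_, h⟩
  have e : (Iic (1 : ℝ≥0)) ⊆ {0} ∪ Ioc 0 1 := fun x hx => by
    rcases eq_or_ne x 0 with rfl | h0
    · simp
    · exact Or.inr ⟨pos_iff_ne_zero.2 h0, hx⟩
  refine (measure_mono e).trans_lt ((measure_union_le _ _).trans_lt ?_)
  rw [timeMeasure_singleton, timeMeasure_Ioc]
  simp

lemma GameData.Standing.lintegral_discount_lt_top {D : GameData I} (hD : D.Standing) :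
    ∫⁻ t, (D.ϱ t : ℝ≥0∞) ∂timeMeasure < ⊤ := by
  obtain ⟨p, q, -, -, -, -, hp, hpq, -, -, -, -, -, -, h⟩ := hD.growth
  exact _root_.lintegral_discount_lt_top hD.discount_anti (by linarith) h

end Controls

/-! ### The divergence as an integrated penalty -/

section Penalty

variable {Ω : Type u} {m : MeasurableSpace Ω} {P Q : Measure Ω} {B : ℝ≥0 → Ω → ℝ} {Φ : ℝ → ℝ}

/-- The expected penalty `E[Φ(dQ/dP)]` of the density of the path law up to time `t`. -/
noncomputable def penaltyAt (Φ : ℝ → ℝ) (Q P : Measure Ω) (B : ℝ≥0 → Ω → ℝ) (t : ℝ≥0) : ℝ≥0∞ :=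
  ∫⁻ w, ENNReal.ofReal (Φ (pathDensity Q P B t w).toReal) ∂(lawUpTo P B t)

lemma IsPenalty.measurable_comp_toReal (hΦ : IsPenalty Φ) :
    Measurable fun z : ℝ≥0∞ => ENNReal.ofReal (Φ z.toReal) := by
  have hc : Continuous fun x : ℝ => Φ (max x 0) :=
    hΦ.cont.comp_continuous (by fun_prop) fun x => mem_Ici.2 (le_max_right _ _)
  have e : (fun z : ℝ≥0∞ => ENNReal.ofReal (Φ z.toReal))
      = fun z => ENNReal.ofReal (Φ (max z.toReal 0)) := by
    funext z; rw [max_eq_left ENNReal.toReal_nonneg]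
  rw [e]
  exact (hc.measurable.comp ENNReal.measurable_toReal).ennreal_ofReal

lemma penaltyAt_eq_lintegral (hΦ : IsPenalty Φ) (hB : ∀ t, Measurable (B t)) (t : ℝ≥0) :
    penaltyAt Φ Q P B t =
      ∫⁻ ω, ENNReal.ofReal (Φ (pathDensity Q P B t (pathUpTo B t ω)).toReal) ∂P :=
  lintegral_map (hΦ.measurable_comp_toReal.comp (measurable_pathDensity t))
    (measurable_pathUpTo hB t)

lemma penaltyAt_eq_condExp [IsFiniteMeasure P] [IsFiniteMeasure Q] (hΦ : IsPenalty Φ)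
    (hB : ∀ t, Measurable (B t)) {t : ℝ≥0} {Z : Ω → ℝ} (hZ0 : ∀ ω, 0 ≤ Z ω)
    (hZ : Integrable Z P)
    (hQ : ∀ A, MeasurableSet[pathFiltration B hB t] A →
      Q A = ∫⁻ ω in A, ENNReal.ofReal (Z ω) ∂P) :
    penaltyAt Φ Q P B t =
      ∫⁻ ω, ENNReal.ofReal (Φ ((P[Z | pathFiltration B hB t]) ω)) ∂P := by
  rw [penaltyAt_eq_lintegral hΦ hB]
  have h0 : 0 ≤ᵐ[P] P[Z | pathFiltration B hB t] := condExp_nonneg (ae_of_all _ hZ0)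
  refine lintegral_congr_ae ?_
  filter_upwards [(pathDensity_eq_condExp hB hZ0 hZ hQ).2, h0] with ω h1 h2
  rw [h1, ENNReal.toReal_ofReal h2]

/-- Conditional Jensen inequality for penalty functions. -/
lemma IsPenalty.lintegral_condExp_le [IsFiniteMeasure P] (hΦ : IsPenalty Φ) {Z : Ω → ℝ}
    (hZ0 : ∀ ω, 0 ≤ Z ω) (hZ : Integrable Z P) (𝓖 : MeasurableSpace Ω) (h𝓖 : 𝓖 ≤ m) :
    ∫⁻ ω, ENNReal.ofReal (Φ ((P[Z | 𝓖]) ω)) ∂P ≤ ∫⁻ ω, ENNReal.ofReal (Φ (Z ω)) ∂P := by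
  by_cases htop : ∫⁻ ω, ENNReal.ofReal (Φ (Z ω)) ∂P = ⊤
  · rw [htop]; exact le_top
  have hc : Continuous fun x : ℝ => Φ (max x 0) :=
    hΦ.cont.comp_continuous (by fun_prop) fun x => mem_Ici.2 (le_max_right _ _)
  have hint : Integrable (Φ ∘ Z) P := by
    refine ⟨?_, ?_⟩
    · have e : Φ ∘ Z = fun ω => (fun x => Φ (max x 0)) (Z ω) := by
        funext ω; simp [max_eq_left (hZ0 ω)]
      rw [e]
      exact hc.comp_aestronglyMeasurable hZ.aestronglyMeasurable
    · change HasFiniteIntegral (fun ω => Φ (Z ω)) P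
      rw [hasFiniteIntegral_iff_ofReal (ae_of_all _ fun ω => hΦ.nonneg _ (hZ0 ω))]
      exact lt_top_iff_ne_top.2 htop
  have hJ := hΦ.convex.map_condExp_le h𝓖 hΦ.cont.lowerSemicontinuousOn
    (ae_of_all P hZ0) isClosed_Ici hZ hint
  have h0 : 0 ≤ᵐ[P] P[Φ ∘ Z | 𝓖] := condExp_nonneg (ae_of_all _ fun ω => hΦ.nonneg _ (hZ0 ω))
  calc ∫⁻ ω, ENNReal.ofReal (Φ ((P[Z | 𝓖]) ω)) ∂P
      ≤ ∫⁻ ω, ENNReal.ofReal ((P[Φ ∘ Z | 𝓖]) ω) ∂P := by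
        refine lintegral_mono_ae ?_
        filter_upwards [hJ] with ω hω using ENNReal.ofReal_le_ofReal hω
    _ = ENNReal.ofReal (∫ ω, (P[Φ ∘ Z | 𝓖]) ω ∂P) :=
        (ofReal_integral_eq_lintegral_ofReal integrable_condExp h0).symm
    _ = ENNReal.ofReal (∫ ω, (Φ ∘ Z) ω ∂P) := by rw [integral_condExp h𝓖]
    _ = _ := ofReal_integral_eq_lintegral_ofReal hint (ae_of_all _ fun ω => hΦ.nonneg _ (hZ0 ω))

/-- The density of the path law, as a real-valued random variable. -/
noncomputable def realDensity (Q P : Measure Ω) (B : ℝ≥0 → Ω → ℝ) (t : ℝ≥0) (ω : Ω) : ℝ :=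
  (pathDensity Q P B t (pathUpTo B t ω)).toReal

lemma lintegral_pathDensity [IsProbabilityMeasure P] [IsProbabilityMeasure Q]
    (hB : ∀ t, Measurable (B t)) {t : ℝ≥0} (hac : lawUpTo Q B t ≪ lawUpTo P B t) :
    ∫⁻ ω, pathDensity Q P B t (pathUpTo B t ω) ∂P = 1 := by
  have := measure_eq_setLIntegral_pathDensity hB hac (A := univ) MeasurableSet.univ
  rw [measure_univ, setLIntegral_univ] at this
  exact this.symm

lemma ofReal_realDensity [IsProbabilityMeasure P] [IsProbabilityMeasure Q]
    (hB : ∀ t, Measurable (B t)) {t : ℝ≥0} (hac : lawUpTo Q B t ≪ lawUpTo P B t) :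
    ∀ᵐ ω ∂P, ENNReal.ofReal (realDensity Q P B t ω) = pathDensity Q P B t (pathUpTo B t ω) := by
  have h1 : ∀ᵐ ω ∂P, pathDensity Q P B t (pathUpTo B t ω) < ⊤ := by
    refine ae_lt_top ((measurable_pathDensity t).comp (measurable_pathUpTo hB t)) ?_
    rw [lintegral_pathDensity hB hac]
    exact ENNReal.one_ne_top
  filter_upwards [h1] with ω hω
  exact ENNReal.ofReal_toReal hω.ne

lemma integrable_realDensity [IsProbabilityMeasure P] [IsProbabilityMeasure Q]
    (hB : ∀ t, Measurable (B t)) {t : ℝ≥0} (hac : lawUpTo Q B t ≪ lawUpTo P B t) :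
    Integrable (realDensity Q P B t) P := by
  refine integrable_toReal_of_lintegral_ne_top
    ((measurable_pathDensity t).comp (measurable_pathUpTo hB t)).aemeasurable ?_
  rw [lintegral_pathDensity hB hac]
  exact ENNReal.one_ne_top

lemma measure_eq_setLIntegral_realDensity [IsProbabilityMeasure P] [IsProbabilityMeasure Q]
    (hB : ∀ t, Measurable (B t)) {t : ℝ≥0} (hac : lawUpTo Q B t ≪ lawUpTo P B t) {A : Set Ω}
    (hA : MeasurableSet[pathFiltration B hB t] A) :
    Q A = ∫⁻ ω in A, ENNReal.ofReal (realDensity Q P B t ω) ∂P := by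
  rw [measure_eq_setLIntegral_pathDensity hB hac hA]
  refine setLIntegral_congr_fun_ae ((pathFiltration B hB).le t A hA) ?_
  filter_upwards [ofReal_realDensity hB hac] with ω hω _ using hω.symm

/-- The expected penalty increases in time, by Jensen's inequality. -/
lemma monotone_penaltyAt [IsProbabilityMeasure P] [IsProbabilityMeasure Q] (hΦ : IsPenalty Φ)
    (hB : ∀ t, Measurable (B t)) (hac : ∀ t, lawUpTo Q B t ≪ lawUpTo P B t) :
    Monotone (penaltyAt Φ Q P B) := by
  intro s t hst
  rw [penaltyAt_eq_condExp hΦ hB (Z := realDensity Q P B t) (fun _ => ENNReal.toReal_nonneg)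
    (integrable_realDensity hB (hac t)) fun A hA => measure_eq_setLIntegral_realDensity hB (hac t)
      ((pathFiltration B hB).mono hst A hA), penaltyAt_eq_lintegral hΦ hB t]
  exact hΦ.lintegral_condExp_le (fun _ => ENNReal.toReal_nonneg)
    (integrable_realDensity hB (hac t)) _ ((pathFiltration B hB).le s)

/-- The pointwise splitting of the divergence: adding the constant `2 K` turns it into a
nonnegative penalty. -/
lemma lintegral_divergence_add [IsProbabilityMeasure P] [IsProbabilityMeasure Q] {g : ℝ → ℝ}
    (hg : Measurable g) {K : ℝ} (hK : 0 ≤ K) (hΦ : IsPenalty (penaltyFn g K))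
    (hB : ∀ t, Measurable (B t)) {t : ℝ≥0} (hac : lawUpTo Q B t ≪ lawUpTo P B t) :
    (∫⁻ w, ENNReal.ofReal (g (Real.log (pathDensity Q P B t w).toReal)) ∂(lawUpTo Q B t)) +
        ENNReal.ofReal (2 * K) =
      penaltyAt (penaltyFn g K) Q P B t +
        ∫⁻ w, ENNReal.ofReal (-g (Real.log (pathDensity Q P B t w).toReal)) ∂(lawUpTo Q B t) ∧
    ∫⁻ w, ENNReal.ofReal (-g (Real.log (pathDensity Q P B t w).toReal)) ∂(lawUpTo Q B t) ≤
      ENNReal.ofReal (2 * K) := by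
  have hp := measurable_pathUpTo hB t
  have h1 : IsProbabilityMeasure (lawUpTo P B t) := Measure.isProbabilityMeasure_map hp.aemeasurable
  have h2 : IsProbabilityMeasure (lawUpTo Q B t) := Measure.isProbabilityMeasure_map hp.aemeasurable
  have hz := measurable_pathDensity (Q := Q) (P := P) (B := B) t
  set μ := lawUpTo P B t with hμ
  set z := pathDensity Q P B t with hzdef
  have hν : lawUpTo Q B t = μ.withDensity z := (Measure.withDensity_rnDeriv_eq _ _ hac).symm
  have hzi : ∫⁻ w, z w ∂μ = 1 := by
    have := congrArg (fun ν => ν univ) hν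
    simp only [measure_univ] at this
    rw [withDensity_apply _ MeasurableSet.univ, setLIntegral_univ] at this
    exact this.symm
  have hztop : ∀ᵐ w ∂μ, z w < ⊤ := ae_lt_top hz (by rw [hzi]; exact ENNReal.one_ne_top)
  have hconv : ∀ v : ℝ → ℝ, Measurable v →
      ∫⁻ w, ENNReal.ofReal (v (Real.log (z w).toReal)) ∂(lawUpTo Q B t) =
        ∫⁻ w, ENNReal.ofReal ((z w).toReal * v (Real.log (z w).toReal)) ∂μ := by
    intro v hv
    have hm : Measurable fun w => ENNReal.ofReal (v (Real.log (z w).toReal)) :=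
      (hv.comp (Real.measurable_log.comp (ENNReal.measurable_toReal.comp hz))).ennreal_ofReal
    rw [hν, lintegral_withDensity_eq_lintegral_mul _ hz hm]
    refine lintegral_congr_ae ?_
    filter_upwards [hztop] with w hw
    rw [Pi.mul_apply, ENNReal.ofReal_mul ENNReal.toReal_nonneg, ENNReal.ofReal_toReal hw.ne]
  have hmm : ∀ v : ℝ → ℝ, Measurable v →
      Measurable fun w => ENNReal.ofReal ((z w).toReal * v (Real.log (z w).toReal)) := fun v hv =>
    ((ENNReal.measurable_toReal.comp hz).mul
      (hv.comp (Real.measurable_log.comp (ENNReal.measurable_toReal.comp hz)))).ennreal_ofReal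
  have hKint : ∫⁻ w, ENNReal.ofReal (K * (1 + (z w).toReal)) ∂μ = ENNReal.ofReal (2 * K) := by
    have e : ∀ᵐ w ∂μ, ENNReal.ofReal (K * (1 + (z w).toReal)) = ENNReal.ofReal K * (1 + z w) := by
      filter_upwards [hztop] with w hw
      rw [ENNReal.ofReal_mul hK, ENNReal.ofReal_add zero_le_one ENNReal.toReal_nonneg,
        ENNReal.ofReal_toReal hw.ne, ENNReal.ofReal_one]
    rw [lintegral_congr_ae e, lintegral_const_mul _ (by fun_prop),
      lintegral_add_left measurable_const, hzi]
    simp only [lintegral_const, measure_univ, mul_one]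
    rw [mul_comm 2 K, ENNReal.ofReal_mul hK]
    norm_num
  have hneg := hconv (fun x => -g x) hg.neg
  rw [hconv g hg, hneg]
  constructor
  · have hpm : Measurable fun w => ENNReal.ofReal (penaltyFn g K (z w).toReal) :=
      hΦ.measurable_comp_toReal.comp hz
    rw [← hKint, ← lintegral_add_left (hmm g hg)]
    change _ = (∫⁻ w, ENNReal.ofReal (penaltyFn g K (z w).toReal) ∂μ) + _
    rw [← lintegral_add_left hpm]
    refine lintegral_congr fun w => ?_
    set x := (z w).toReal with hx
    have hx0 : 0 ≤ x := ENNReal.toReal_nonneg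
    have hΦx := hΦ.nonneg x hx0
    have hK' : 0 ≤ K * (1 + x) := by positivity
    simp only [penaltyFn] at hΦx ⊢
    rw [mul_neg]
    rcases le_total 0 (x * g (Real.log x)) with h | h
    · rw [ENNReal.ofReal_of_nonpos (neg_nonpos.2 h), add_zero, ← ENNReal.ofReal_add h hK']
    · rw [ENNReal.ofReal_of_nonpos h, zero_add, ← ENNReal.ofReal_add hΦx (neg_nonneg.2 h)]
      congr 1; ring
  · rw [← hKint]
    refine lintegral_mono fun w => ENNReal.ofReal_le_ofReal ?_
    have := hΦ.nonneg _ (ENNReal.toReal_nonneg (a := z w))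
    simp only [penaltyFn] at this
    linarith

lemma ereal_sub_eq_sub_of_add_eq_add {p q a c : ℝ≥0∞} (h : p + c = a + q) (hc : c ≠ ⊤)
    (hq : q ≠ ⊤) : (p : EReal) - q = a - ((c.toReal : ℝ) : EReal) := by
  lift c to ℝ≥0 using hc
  lift q to ℝ≥0 using hq
  by_cases ha : a = ⊤
  · rw [ha, top_add] at h
    have hp : p = ⊤ := by
      by_contra h'
      exact (ENNReal.add_lt_top.2 ⟨lt_top_iff_ne_top.2 h', ENNReal.coe_lt_top⟩).ne h
    rw [hp, ha]
    rfl
  · have hp : p ≠ ⊤ := fun h' => by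
      rw [h', top_add] at h
      exact (ENNReal.add_lt_top.2 ⟨lt_top_iff_ne_top.2 ha, ENNReal.coe_lt_top⟩).ne h.symm
    lift a to ℝ≥0 using ha
    lift p to ℝ≥0 using hp
    have h3 : (p : ℝ) + c = a + q := by exact_mod_cast h
    have h4 : (p : ℝ) - q = a - c := by linarith
    rw [ENNReal.coe_toReal]
    exact congrArg (fun x : ℝ => (x : EReal)) h4

/-- Up to a finite constant, the divergence is the discounted integral of the expected penalty. -/
lemma divergence_eq [IsProbabilityMeasure P] [IsProbabilityMeasure Q] {g : ℝ → ℝ}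
    (hg : Measurable g) {K : ℝ} (hK : 0 ≤ K) (hΦ : IsPenalty (penaltyFn g K))
    (hB : ∀ t, Measurable (B t)) (hac : ∀ t, lawUpTo Q B t ≪ lawUpTo P B t)
    {ϱ : ℝ≥0 → ℝ≥0} (hϱm : Measurable ϱ) (hϱ : ∫⁻ t, (ϱ t : ℝ≥0∞) ∂timeMeasure < ⊤) :
    divergence ϱ g Q P B =
      ((∫⁻ t, (ϱ t : ℝ≥0∞) * penaltyAt (penaltyFn g K) Q P B t ∂timeMeasure : ℝ≥0∞) : EReal) -
        ((2 * K * (∫⁻ t, (ϱ t : ℝ≥0∞) ∂timeMeasure).toReal : ℝ) : EReal) := by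
  have hAm : Measurable fun t => (ϱ t : ℝ≥0∞) * penaltyAt (penaltyFn g K) Q P B t :=
    hϱm.coe_nnreal_ennreal.mul (monotone_penaltyAt hΦ hB hac).measurable
  have hst := fun t => lintegral_divergence_add hg hK hΦ hB (hac t)
  unfold divergence
  set p : ℝ≥0 → ℝ≥0∞ := fun t =>
    ∫⁻ w, ENNReal.ofReal (g (Real.log (pathDensity Q P B t w).toReal)) ∂(lawUpTo Q B t)
  set q : ℝ≥0 → ℝ≥0∞ := fun t =>
    ∫⁻ w, ENNReal.ofReal (-g (Real.log (pathDensity Q P B t w).toReal)) ∂(lawUpTo Q B t)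
  set A := penaltyAt (penaltyFn g K) Q P B
  set r := ∫⁻ t, (ϱ t : ℝ≥0∞) ∂timeMeasure
  have h1 : (∫⁻ t, (ϱ t : ℝ≥0∞) * p t ∂timeMeasure) + r * ENNReal.ofReal (2 * K) =
      (∫⁻ t, (ϱ t : ℝ≥0∞) * A t ∂timeMeasure) + ∫⁻ t, (ϱ t : ℝ≥0∞) * q t ∂timeMeasure := by
    rw [← lintegral_mul_const' _ _ ENNReal.ofReal_ne_top,
      ← lintegral_add_right _ (hϱm.coe_nnreal_ennreal.mul_const _), ← lintegral_add_left hAm]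
    refine lintegral_congr fun t => ?_
    rw [← mul_add, ← mul_add, (hst t).1]
  have h2 : ∫⁻ t, (ϱ t : ℝ≥0∞) * q t ∂timeMeasure ≤ r * ENNReal.ofReal (2 * K) := by
    rw [← lintegral_mul_const' _ _ ENNReal.ofReal_ne_top]
    exact lintegral_mono fun t => mul_le_mul_right (hst t).2 _
  have hfin : r * ENNReal.ofReal (2 * K) ≠ ⊤ := (ENNReal.mul_lt_top hϱ ENNReal.ofReal_lt_top).ne
  have hqfin : ∫⁻ t, (ϱ t : ℝ≥0∞) * q t ∂timeMeasure ≠ ⊤ := ne_top_of_le_ne_top hfin h2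
  have hc : 2 * K * r.toReal = (r * ENNReal.ofReal (2 * K)).toReal := by
    rw [ENNReal.toReal_mul, ENNReal.toReal_ofReal (by positivity), mul_comm]
  rw [hc]
  exact ereal_sub_eq_sub_of_add_eq_add h1 hfin hqfin

end Penalty

/-! ### Transfer of controls between filtered probability spaces -/

section Transfer

/-- All Brownian motions have the same law on path space. -/
lemma map_path_eq_map_path {Ω Ω' : Type*} {m : MeasurableSpace Ω} {m' : MeasurableSpace Ω'}
    {P : Measure Ω} {P' : Measure Ω'} {B : ℝ≥0 → Ω → ℝ} {B' : ℝ≥0 → Ω' → ℝ}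
    (hB : IsBrownianReal B P) (hB' : IsBrownianReal B' P') (hm : ∀ t, Measurable (B t))
    (hm' : ∀ t, Measurable (B' t)) :
    P.map (fun ω t => B t ω) = P'.map (fun ω t => B' t ω) := by
  have h1 : Measurable fun ω t => B t ω := measurable_pi_lambda _ hm
  have h2 : Measurable fun ω t => B' t ω := measurable_pi_lambda _ hm'
  refine IsProjectiveLimit.unique (P := BrownianReal.projectiveFamily) (fun J => ?_) fun J => ?_
  · rw [Measure.map_map (Finset.measurable_restrict J) h1]
    exact (hB.toIsPreBrownianReal.hasLaw J).map_eq
  · rw [Measure.map_map (Finset.measurable_restrict J) h2]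
    exact (hB'.toIsPreBrownianReal.hasLaw J).map_eq

variable {I : ℕ}

lemma GameBasis.lawUpTo_eq_map (S : GameBasis.{u} I) (Q : Measure S.Ω) (k : Source × Fin I)
    (t : ℝ≥0) : lawUpTo Q (S.B k) t = (Q.map (S.path k)).map (restrictPath t) := by
  rw [Measure.map_map (measurable_restrictPath t) (S.measurable_path k)]
  rfl

lemma GameBasis.lawUpTo_eq_lawUpTo (S S' : GameBasis.{u} I) (k : Source × Fin I) (t : ℝ≥0) :
    lawUpTo S'.P (S'.B k) t = lawUpTo S.P (S.B k) t := by
  rw [S.lawUpTo_eq_map, S'.lawUpTo_eq_map]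
  congr 1
  exact map_path_eq_map_path (S'.brownian k).brownian (S.brownian k).brownian (S'.measurable k)
    (S.measurable k)

lemma lawUpTo_map_restrict {Ω : Type u} {m : MeasurableSpace Ω} {B : ℝ≥0 → Ω → ℝ}
    (hB : ∀ t, Measurable (B t)) (Q : Measure Ω) {s t : ℝ≥0} (hst : s ≤ t) :
    (lawUpTo Q B t).map (fun w (r : Iic s) => w ⟨r, r.2.trans hst⟩) = lawUpTo Q B s := by
  rw [lawUpTo, Measure.map_map (measurable_pi_lambda _ fun r => measurable_pi_apply _)
    (measurable_pathUpTo hB t)]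
  rfl

lemma GameBasis.map_pathUpTo_eq_pi (S : GameBasis.{u} I) {Q : Measure S.Ω}
    [IsProbabilityMeasure Q] (hind : iIndepFun S.path Q) (T : ℝ≥0) :
    Q.map (fun ω k => pathUpTo (S.B k) T ω) = Measure.pi fun k => lawUpTo Q (S.B k) T := by
  have h1 : iIndepFun (fun k => pathUpTo (S.B k) T) Q :=
    hind.comp (fun _ => restrictPath T) fun _ => measurable_restrictPath T
  exact (iIndepFun_iff_map_fun_eq_pi_map fun k =>
    (measurable_pathUpTo (S.measurable k) T).aemeasurable).1 h1

/-- A control of the maximizer on one space, observed up to time `T`, is reproduced on every other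
space by a product of densities of the separate Brownian paths, with at most the same penalties. -/
lemma exists_transfer (S S' : GameBasis.{u} I) {Q : Measure S.Ω} [IsProbabilityMeasure Q]
    (hac : ∀ k t, lawUpTo Q (S.B k) t ≪ lawUpTo S.P (S.B k) t) (hind : iIndepFun S.path Q)
    (T : ℝ≥0) :
    ∃ Z : Source × Fin I → S'.Ω → ℝ, (∀ k ω, 0 ≤ Z k ω) ∧
      (∀ k, Measurable[pathFiltration (S'.B k) (S'.measurable k) T] (Z k)) ∧
      (∀ k, Integrable (Z k) S'.P) ∧ (∀ k, ∫ ω, Z k ω ∂S'.P = 1) ∧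
      (∀ f : (Source × Fin I → Iic T → ℝ) → ℝ≥0∞, Measurable f →
        ∫⁻ ω, f (fun k => pathUpTo (S.B k) T ω) ∂Q =
          ∫⁻ ω, (∏ k, ENNReal.ofReal (Z k ω)) * f (fun k => pathUpTo (S'.B k) T ω) ∂S'.P) ∧
      ∀ Φ, IsPenalty Φ → ∀ k t,
        ∫⁻ ω, ENNReal.ofReal (Φ ((S'.P[Z k | pathFiltration (S'.B k) (S'.measurable k) t]) ω))
          ∂S'.P ≤ penaltyAt Φ Q S.P (S.B k) t := by
  have hp := fun k => measurable_pathUpTo (S.measurable k) T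
  have hp' := fun k => measurable_pathUpTo (S'.measurable k) T
  set z : (k : Source × Fin I) → (Iic T → ℝ) → ℝ≥0∞ := fun k => pathDensity Q S.P (S.B k) T with hz
  have hzm : ∀ k, Measurable (z k) := fun k => measurable_pathDensity T
  have hprobS : ∀ k, IsProbabilityMeasure (lawUpTo S.P (S.B k) T) := fun k =>
    Measure.isProbabilityMeasure_map (hp k).aemeasurable
  have hprobQ : ∀ k, IsProbabilityMeasure (lawUpTo Q (S.B k) T) := fun k =>
    Measure.isProbabilityMeasure_map (hp k).aemeasurable
  have hν : ∀ k, (lawUpTo S.P (S.B k) T).withDensity (z k) = lawUpTo Q (S.B k) T := fun k =>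
    Measure.withDensity_rnDeriv_eq _ _ (hac k T)
  have hz1 : ∀ k, ∫⁻ w, z k w ∂(lawUpTo S.P (S.B k) T) = 1 := fun k => by
    have := congrArg (fun ν => ν univ) (hν k)
    simp only [measure_univ] at this
    rwa [withDensity_apply _ MeasurableSet.univ, setLIntegral_univ] at this
  have hztop : ∀ k, ∀ᵐ w ∂(lawUpTo S.P (S.B k) T), ENNReal.ofReal (z k w).toReal = z k w :=
    fun k => by
      filter_upwards [ae_lt_top (hzm k) (by rw [hz1]; exact ENNReal.one_ne_top)] with w hw
      exact ENNReal.ofReal_toReal hw.ne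
  have hlaw := fun k => S.lawUpTo_eq_lawUpTo S' k T
  set Z : Source × Fin I → S'.Ω → ℝ := fun k ω => (z k (pathUpTo (S'.B k) T ω)).toReal with hZ
  have hZm : ∀ k, Measurable[pathFiltration (S'.B k) (S'.measurable k) T] (Z k) := fun k =>
    ENNReal.measurable_toReal.comp ((hzm k).comp (comap_measurable _))
  have hset : ∀ k {A : Set (Iic T → ℝ)}, MeasurableSet A →
      ∫⁻ ω in pathUpTo (S'.B k) T ⁻¹' A, ENNReal.ofReal (Z k ω) ∂S'.P
        = lawUpTo Q (S.B k) T A := by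
    intro k A hA
    rw [← hν k, withDensity_apply _ hA, ← setLIntegral_congr_fun_ae hA
      ((hztop k).mono fun w hw _ => hw), ← hlaw k, lawUpTo]
    have hmf : Measurable fun w => ENNReal.ofReal (z k w).toReal :=
      (ENNReal.measurable_toReal.comp (hzm k)).ennreal_ofReal
    exact (setLIntegral_map hA hmf (hp' k)).symm
  have hZ1 : ∀ k, ∫⁻ ω, ENNReal.ofReal (Z k ω) ∂S'.P = 1 := fun k => by
    have := hset k MeasurableSet.univ
    rwa [preimage_univ, setLIntegral_univ, measure_univ] at this
  have hZ0 : ∀ k ω, 0 ≤ Z k ω := fun k ω => ENNReal.toReal_nonneg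
  have hZm' : ∀ k, Measurable (Z k) := fun k =>
    (hZm k).mono ((pathFiltration (S'.B k) (S'.measurable k)).le T) le_rfl
  have hZi : ∀ k, Integrable (Z k) S'.P := fun k => by
    refine ⟨(hZm' k).aestronglyMeasurable, ?_⟩
    rw [hasFiniteIntegral_iff_ofReal (ae_of_all _ (hZ0 k)), hZ1]
    exact ENNReal.one_lt_top
  -- the product measure on the second space
  set w : (k : Source × Fin I) → (ℝ≥0 → ℝ) → ℝ≥0∞ := fun k b =>
    ENNReal.ofReal (z k (restrictPath T b)).toReal with hw
  have hwm : ∀ k, Measurable (w k) := fun k =>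
    (ENNReal.measurable_toReal.comp ((hzm k).comp (measurable_restrictPath T))).ennreal_ofReal
  have hX := S'.measurable_path
  have hind' : iIndepFun S'.path S'.P := S'.indep
  set R := prodDensity S'.P S'.path w with hR
  have hRp : IsProbabilityMeasure R := isProbabilityMeasure_prodDensity hX hind' hwm hZ1
  have hRA : ∀ k {A : Set (ℝ≥0 → ℝ)}, MeasurableSet A →
      R (S'.path k ⁻¹' A) = ∫⁻ ω in S'.path k ⁻¹' A, ENNReal.ofReal (Z k ω) ∂S'.P :=
    fun k A hA => prodDensity_preimage hX hind' hwm hZ1 k hA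
  -- the marginal path laws up to time `T` agree, hence by independence so do the joint ones
  have hRT : ∀ k, lawUpTo R (S'.B k) T = lawUpTo Q (S.B k) T := by
    intro k
    ext A hA
    rw [← hset k hA, lawUpTo, Measure.map_apply (hp' k) hA]
    exact hRA k (measurable_restrictPath T hA)
  have hRt : ∀ k, ∀ t ≤ T, lawUpTo R (S'.B k) t = lawUpTo Q (S.B k) t := fun k t ht => by
    rw [← lawUpTo_map_restrict (S'.measurable k) R ht, hRT,
      lawUpTo_map_restrict (S.measurable k) Q ht]
  refine ⟨Z, hZ0, hZm, hZi, fun k => ?_, fun f hf => ?_, fun Φ hΦ k t => ?_⟩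
  · rw [integral_eq_lintegral_of_nonneg_ae (ae_of_all _ (hZ0 k)) (hZm' k).aestronglyMeasurable, hZ1]
    rfl
  · have h1 := S.map_pathUpTo_eq_pi hind T
    have h2 := S'.map_pathUpTo_eq_pi (iIndepFun_prodDensity hX hind' hwm hZ1) T
    have hpm : Measurable fun ω k => pathUpTo (S.B k) T ω := measurable_pi_lambda _ hp
    have hpm' : Measurable fun ω k => pathUpTo (S'.B k) T ω := measurable_pi_lambda _ hp'
    have h3 : Q.map (fun ω k => pathUpTo (S.B k) T ω) = R.map fun ω k => pathUpTo (S'.B k) T ω := by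
      have e : (fun k => lawUpTo Q (S.B k) T) = fun k => lawUpTo R (S'.B k) T :=
        funext fun k => (hRT k).symm
      rw [h1, e]
      exact h2.symm
    rw [← lintegral_map hf hpm, h3, lintegral_map hf hpm']
    exact lintegral_prodDensity hX hwm (hf.comp hpm')
  · have key : ∀ t ≤ T, ∫⁻ ω, ENNReal.ofReal
        (Φ ((S'.P[Z k | pathFiltration (S'.B k) (S'.measurable k) t]) ω)) ∂S'.P
        = penaltyAt Φ Q S.P (S.B k) t := by
      intro t ht
      rw [← penaltyAt_eq_condExp (Q := R) hΦ (S'.measurable k) (hZ0 k) (hZi k)]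
      · unfold penaltyAt pathDensity
        rw [hRt k t ht, S.lawUpTo_eq_lawUpTo S' k t]
      · rintro A ⟨A', hA', rfl⟩
        exact hRA k (A := restrictPath t ⁻¹' A') (measurable_restrictPath t hA')
    -- after time `T` the penalty of the stopped density stays constant, while that of `Q` increases
    rcases le_total t T with ht | ht
    · exact (key t ht).le
    · refine le_trans (le_of_eq ?_)
        ((key T le_rfl).le.trans (monotone_penaltyAt hΦ (S.measurable k) (hac k) ht))
      rw [condExp_of_stronglyMeasurable ((pathFiltration (S'.B k) (S'.measurable k)).le t)
          ((hZm k).mono ((pathFiltration (S'.B k) (S'.measurable k)).mono ht)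
            le_rfl).stronglyMeasurable (hZi k),
        condExp_of_stronglyMeasurable ((pathFiltration (S'.B k) (S'.measurable k)).le T)
          (hZm k).stronglyMeasurable (hZi k)]

/-- Convergence in mean at a geometric rate implies almost sure convergence. -/
lemma ae_tendsto_of_integral_abs_sub_lt {Ω : Type*} {m : MeasurableSpace Ω} {P : Measure Ω}
    {W : ℕ → Ω → ℝ} {Z : Ω → ℝ} (hW : ∀ n, Integrable (W n) P) (hZ : Integrable Z P)
    (h : ∀ n, ∫ ω, |W n ω - Z ω| ∂P ≤ (1 / 2) ^ n) :
    ∀ᵐ ω ∂P, Tendsto (fun n => W n ω) atTop (𝓝 (Z ω)) := by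
  have hd : ∀ n, Integrable (fun ω => |W n ω - Z ω|) P := fun n => ((hW n).sub hZ).abs
  have h1 : ∫⁻ ω, ∑' n, ENNReal.ofReal |W n ω - Z ω| ∂P ≠ ⊤ := by
    rw [lintegral_tsum fun n => (hd n).aestronglyMeasurable.aemeasurable.ennreal_ofReal]
    have h2 : ∀ n, ∫⁻ ω, ENNReal.ofReal |W n ω - Z ω| ∂P ≤ ENNReal.ofReal ((1 / 2) ^ n) := by
      intro n
      rw [← ofReal_integral_eq_lintegral_ofReal (hd n) (ae_of_all _ fun _ => abs_nonneg _)]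
      exact ENNReal.ofReal_le_ofReal (h n)
    refine ne_top_of_le_ne_top ?_ (ENNReal.tsum_le_tsum h2)
    rw [← ENNReal.ofReal_tsum_of_nonneg (fun n => by positivity) summable_geometric_two]
    exact ENNReal.ofReal_ne_top
  have h3 := ae_lt_top' (AEMeasurable.tsum fun n =>
    (hd n).aestronglyMeasurable.aemeasurable.ennreal_ofReal) h1
  filter_upwards [h3] with ω hω
  have h4 := ENNReal.tendsto_atTop_zero_of_tsum_ne_top hω.ne
  rw [tendsto_iff_dist_tendsto_zero]
  have h5 := (ENNReal.tendsto_toReal ENNReal.zero_ne_top).comp h4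
  refine h5.congr fun n => ?_
  simp [Real.dist_eq]

/-- Product densities are limits of admissible controls of the maximizer whose penalties are larger
by at most `ε`. -/
lemma exists_controls_approx (D : GameData I) (hϱ : ∫⁻ t, (D.ϱ t : ℝ≥0∞) ∂timeMeasure < ⊤)
    (S : GameBasis.{u} I) {T : ℝ≥0} {Z : Source × Fin I → S.Ω → ℝ} (hZ0 : ∀ k ω, 0 ≤ Z k ω)
    (hZm : ∀ k, Measurable[pathFiltration (S.B k) (S.measurable k) T] (Z k))
    (hZi : ∀ k, Integrable (Z k) S.P) (hZ1 : ∀ k, ∫ ω, Z k ω ∂S.P = 1)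
    {Φ : Source × Fin I → ℝ → ℝ} (hΦ : ∀ k, IsPenalty (Φ k)) {ε : ℝ} (hε : 0 < ε) :
    ∃ Q : ℕ → Measure S.Ω, (∀ n, Q n ∈ D.maximizerControls S) ∧
      (∀ n k t, penaltyAt (Φ k) (Q n) S.P (S.B k) t ≤
        ∫⁻ ω, ENNReal.ofReal (Φ k ((S.P[Z k | pathFiltration (S.B k) (S.measurable k) t]) ω)) ∂S.P
          + ENNReal.ofReal ε) ∧
      ∀ f : S.Ω → ℝ≥0∞, Measurable f →
        ∫⁻ ω, (∏ k, ENNReal.ofReal (Z k ω)) * f ω ∂S.P ≤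
          liminf (fun n => ∫⁻ ω, f ω ∂(Q n)) atTop := by
  have hmin : ∀ n : ℕ, 0 < min ε ((1 / 2) ^ n) := fun n => lt_min hε (by positivity)
  choose H hHT hHi hHZ hHp using fun n k =>
    exists_stochExp_penalty_le (S.brownian k) (hΦ k) (hZm k) (hZ0 k) (hZi k) (hZ1 k) (hmin n)
  choose Q hQ hQf hQA using fun n =>
    exists_maximizerControl D hϱ S (T := T) (fun k => H n k) (fun k => (hHT n k).le)
  have hpos : ∀ n k ω, 0 ≤ (H n k).stochExp (S.B k) T ω := fun n k ω => (Real.exp_pos _).le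
  refine ⟨Q, hQ, fun n k t => ?_, fun f hf => ?_⟩
  · obtain ⟨ψ, hψ⟩ := hQ n
    have := hψ.isProb
    rw [penaltyAt_eq_condExp (hΦ k) (S.measurable k) (hpos n k) (hHi n k) (hQA n k t)]
    refine (hHp n k t).trans ?_
    gcongr
    exact min_le_left _ _
  · have hlim : ∀ᵐ ω ∂S.P, ∀ k, Tendsto (fun n => (H n k).stochExp (S.B k) T ω) atTop
        (𝓝 (Z k ω)) := ae_all_iff.2 fun k =>
      ae_tendsto_of_integral_abs_sub_lt (fun n => hHi n k) (hZi k) fun n =>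
        (hHZ n k).le.trans (min_le_right _ _)
    have hmeas : ∀ n, Measurable fun ω =>
        (∏ k, ENNReal.ofReal ((H n k).stochExp (S.B k) T ω)) * f ω := fun n =>
      (Finset.measurable_fun_prod _ fun k _ => (((H n k).measurable_stochExp
        (S.brownian k).toPath.adapted T).mono ((pathFiltration (S.B k) (S.measurable k)).le T)
          le_rfl).ennreal_ofReal).mul hf
    have hle : ∀ᵐ ω ∂S.P, (∏ k, ENNReal.ofReal (Z k ω)) * f ω ≤
        liminf (fun n => (∏ k, ENNReal.ofReal ((H n k).stochExp (S.B k) T ω)) * f ω) atTop := by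
      filter_upwards [hlim] with ω hω
      -- `f ω` may be infinite, so multiplication by it is continuous only away from `0`
      rcases eq_or_ne (∏ k, ENNReal.ofReal (Z k ω)) 0 with h0 | h0
      · rw [h0, zero_mul]; exact zero_le
      · refine le_of_eq (Tendsto.liminf_eq ?_).symm
        refine ENNReal.Tendsto.mul_const ?_ (Or.inl h0)
        rw [← ENNReal.ofReal_prod_of_nonneg fun k _ => hZ0 k ω]
        simp_rw [← ENNReal.ofReal_prod_of_nonneg fun k (_ : k ∈ Finset.univ) => hpos _ k ω]
        exact (ENNReal.continuous_ofReal.tendsto _).comp (tendsto_finsetProd _ fun k _ => hω k)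
    calc _ ≤ _ := lintegral_mono_ae hle
      _ ≤ _ := lintegral_liminf_le hmeas
      _ = _ := by simp_rw [hQf _ f hf]

end Transfer

/-! ### The minimizing curve -/

section Curve

variable {I : ℕ} {D : GameData I}

lemma GameData.Standing.θ_pos (hD : D.Standing) (i : Fin I) : 0 < D.θ i :=
  inv_pos.2 (hD.mu_pos i)

lemma GameData.Standing.cost_continuousOn (hD : D.Standing) :
    ContinuousOn D.C {q | ∀ i, 0 ≤ q i} := by
  unfold GameData.C
  exact continuousOn_finsetSum _ fun i _ => (hD.cost_C1 i).continuousOn.comp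
    (continuous_apply i).continuousOn fun q hq => hq i

lemma GameData.Standing.cost_mono (hD : D.Standing) {q r : Fin I → ℝ} (hq : ∀ i, 0 ≤ q i)
    (hqr : ∀ i, q i ≤ r i) : D.C q ≤ D.C r :=
  Finset.sum_le_sum fun i _ =>
    (hD.cost_strictMono i).monotoneOn (hq i) ((hq i).trans (hqr i)) (hqr i)

/-- The states of workload `w`. -/
def GameData.level (D : GameData I) (w : ℝ) : Set (Fin I → ℝ) :=
  {q | (∀ i, 0 ≤ q i) ∧ D.θ ⬝ᵥ q = w}

lemma GameData.Standing.strictConvexOn_cost (hD : D.Standing) (w : ℝ) :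
    StrictConvexOn ℝ (D.level w) D.C := by
  refine ⟨fun q hq r hr a b ha hb hab => ⟨fun i => ?_, ?_⟩, fun q hq r hr hqr a b ha hb hab => ?_⟩
  · have h1 := hq.1 i
    have h2 := hr.1 i
    simp only [Pi.add_apply, Pi.smul_apply, smul_eq_mul]
    positivity
  · rw [dotProduct_add, dotProduct_smul, dotProduct_smul, hq.2, hr.2, ← add_smul, hab, one_smul]
  · obtain ⟨i, hi⟩ := Function.ne_iff.1 hqr
    unfold GameData.C
    rw [smul_eq_mul, smul_eq_mul, Finset.mul_sum, Finset.mul_sum, ← Finset.sum_add_distrib]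
    refine Finset.sum_lt_sum (fun j _ => ?_) ⟨i, Finset.mem_univ i, ?_⟩
    · exact (hD.cost_strictConvex j).convexOn.2 (hq.1 j) (hr.1 j) ha.le hb.le hab
    · exact (hD.cost_strictConvex i).2 (hq.1 i) (hr.1 i) hi ha hb hab

lemma GameData.Standing.mem_Icc_of_mem_level (hD : D.Standing) {w : ℝ} {q : Fin I → ℝ}
    (hq : q ∈ D.level w) : q ∈ Icc (0 : Fin I → ℝ) fun i => w / D.θ i := by
  refine ⟨hq.1, fun i => ?_⟩
  rw [le_div_iff₀ (hD.θ_pos i), mul_comm, ← hq.2]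
  exact Finset.single_le_sum (f := fun j => D.θ j * q j)
    (fun j _ => mul_nonneg (hD.θ_pos j).le (hq.1 j)) (Finset.mem_univ i)

lemma continuous_dotProduct_const (v : Fin I → ℝ) : Continuous fun q : Fin I → ℝ => v ⬝ᵥ q := by
  unfold dotProduct; fun_prop

lemma GameData.Standing.isCompact_level (hD : D.Standing) (w : ℝ) : IsCompact (D.level w) := by
  refine isCompact_Icc.of_isClosed_subset ?_ fun q hq => hD.mem_Icc_of_mem_level hq
  have e : D.level w = (⋂ i, {q : Fin I → ℝ | 0 ≤ q i}) ∩ {q | D.θ ⬝ᵥ q = w} := by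
    ext q; simp [GameData.level]
  rw [e]
  exact (isClosed_iInter fun i => isClosed_le continuous_const (continuous_apply i)).inter
    (isClosed_eq (continuous_dotProduct_const _) continuous_const)

lemma GameData.Standing.level_nonempty (hD : D.Standing) {w : ℝ} (hw : 0 ≤ w) :
    (D.level w).Nonempty := by
  have : Nonempty (Fin I) := by
    by_contra h
    rw [not_nonempty_iff] at h
    have := hD.critical
    simp at this
  obtain ⟨i⟩ := this
  refine ⟨Pi.single i (w / D.θ i), fun j => ?_, ?_⟩
  · by_cases hj : j = i
    · subst hj; simp only [Pi.single_eq_same]; exact div_nonneg hw (hD.θ_pos j).le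
    · simp [Pi.single_eq_of_ne hj]
  · rw [dotProduct_single, mul_div_cancel₀ _ (hD.θ_pos i).ne']

lemma smul_mem_level {w c : ℝ} {q : Fin I → ℝ} (hq : q ∈ D.level w) (hc : 0 ≤ c) :
    c • q ∈ D.level (c * w) := by
  refine ⟨fun i => mul_nonneg hc (hq.1 i), ?_⟩
  rw [dotProduct_smul, hq.2, smul_eq_mul]

lemma GameData.Standing.eq_zero_of_mem_level (hD : D.Standing) {q : Fin I → ℝ}
    (hq : q ∈ D.level 0) : q = 0 := by
  have h := hD.mem_Icc_of_mem_level hq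
  funext i
  have := h.2 i
  simp only [zero_div] at this
  exact le_antisymm this (h.1 i)

/-- Continuity of the minimizer: a limit point of minimizers has the limiting workload and, by
scaling competitors, minimal cost. -/
lemma GameData.Standing.exists_isMinimizingCurve (hD : D.Standing) :
    ∃ f, D.IsMinimizingCurve f := by
  have hmin : ∀ w, 0 ≤ w → ∃ q ∈ D.level w, IsMinOn D.C (D.level w) q := fun w hw =>
    (hD.isCompact_level w).exists_isMinOn (hD.level_nonempty hw)
      (hD.cost_continuousOn.mono fun q hq => hq.1)
  choose! f hf hfmin using hmin
  refine ⟨f, fun w hw => ?_, fun w hw => (hf w hw).1, fun w hw => (hf w hw).2, fun w hw => ?_⟩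
  · have hw0 : 0 ≤ w := hw
    refine tendsto_of_seq_tendsto fun u hu => tendsto_of_subseq_tendsto fun ns hns => ?_
    have hu' : Tendsto (fun n => u (ns n)) atTop (𝓝[Ici 0] w) := hu.comp hns
    have huw : Tendsto (fun n => u (ns n)) atTop (𝓝 w) := hu'.mono_right nhdsWithin_le_nhds
    have hev : ∀ᶠ n in atTop, 0 ≤ u (ns n) := hu'.eventually self_mem_nhdsWithin
    have hev2 : ∀ᶠ n in atTop, u (ns n) ≤ w + 1 := huw.eventually_le_const (by linarith)
    have hbd : ∃ᶠ n in atTop, f (u (ns n)) ∈ Icc (0 : Fin I → ℝ) fun i => (w + 1) / D.θ i := by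
      refine Eventually.frequently ?_
      filter_upwards [hev, hev2] with n h1 h2
      have h3 := hD.mem_Icc_of_mem_level (hf _ h1)
      refine ⟨h3.1, fun i => (h3.2 i).trans ?_⟩
      have := (hD.θ_pos i).le
      simp only
      gcongr
    obtain ⟨q, -, ms, hms, hq⟩ := isCompact_Icc.tendsto_subseq' hbd
    refine ⟨ms, ?_⟩
    have hms' := hms.tendsto_atTop
    have hev' : ∀ᶠ n in atTop, 0 ≤ u (ns (ms n)) := hms'.eventually hev
    have huw' : Tendsto (fun n => u (ns (ms n))) atTop (𝓝 w) := huw.comp hms'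
    have hqn : ∀ i, 0 ≤ q i := fun i =>
      ge_of_tendsto (((continuous_apply i).tendsto q).comp hq) (hev'.mono fun n hn => (hf _ hn).1 i)
    have hqw : q ∈ D.level w := by
      refine ⟨hqn, ?_⟩
      refine tendsto_nhds_unique (((continuous_dotProduct_const D.θ).tendsto q).comp hq)
        (huw'.congr' ?_)
      filter_upwards [hev'] with n hn using (hf _ hn).2.symm
    suffices h : q = f w by rw [← h]; exact hq
    -- competitors are scaled by `u / w`, which needs `w ≠ 0`
    rcases hw0.eq_or_lt with h0 | h0
    · subst h0
      rw [hD.eq_zero_of_mem_level hqw, hD.eq_zero_of_mem_level (hf 0 le_rfl)]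
    refine (hD.strictConvexOn_cost w).eq_of_isMinOn (isMinOn_iff.2 fun p hp => ?_) (hfmin w hw0)
      hqw (hf w hw0)
    have hC1 : Tendsto (fun n => D.C (f (u (ns (ms n))))) atTop (𝓝 (D.C q)) :=
      (hD.cost_continuousOn q hqn).tendsto.comp
        (tendsto_nhdsWithin_iff.2 ⟨hq, hev'.mono fun n hn => (hf _ hn).1⟩)
    have hsc : Tendsto (fun n => (u (ns (ms n)) / w) • p) atTop (𝓝 p) := by
      have := (huw'.div_const w).smul_const p
      rwa [div_self h0.ne', one_smul] at this
    have hpn : ∀ᶠ n in atTop, (u (ns (ms n)) / w) • p ∈ D.level (u (ns (ms n))) := by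
      filter_upwards [hev'] with n hn
      have := smul_mem_level hp (div_nonneg hn hw0)
      rwa [div_mul_cancel₀ _ h0.ne'] at this
    have hC2 : Tendsto (fun n => D.C ((u (ns (ms n)) / w) • p)) atTop (𝓝 (D.C p)) :=
      (hD.cost_continuousOn p hp.1).tendsto.comp
        (tendsto_nhdsWithin_iff.2 ⟨hsc, hpn.mono fun n hn => hn.1⟩)
    refine le_of_tendsto_of_tendsto hC1 hC2 ?_
    filter_upwards [hev', hpn] with n h1 h2 using hfmin _ h1 h2
  · exact IsLeast.isGLB ⟨⟨f w, hf w hw, rfl⟩, by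
      rintro _ ⟨q, hq, rfl⟩; exact hfmin w hw hq⟩

lemma GameData.IsMinimizingCurve.cost_le {f : ℝ → Fin I → ℝ} (hf : D.IsMinimizingCurve f)
    {q : Fin I → ℝ} (hq : ∀ i, 0 ≤ q i) (hθ : 0 ≤ D.θ ⬝ᵥ q) : D.C (f (D.θ ⬝ᵥ q)) ≤ D.C q :=
  (hf.minimal _ hθ).1 ⟨q, ⟨hq, rfl⟩, rfl⟩

/-- The minimal holding cost increases with the workload. -/
lemma GameData.IsMinimizingCurve.cost_mono (hD : D.Standing) {f : ℝ → Fin I → ℝ}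
    (hf : D.IsMinimizingCurve f) {v w : ℝ} (hv : 0 ≤ v) (hvw : v ≤ w) :
    D.C (f v) ≤ D.C (f w) := by
  rcases hvw.eq_or_lt with rfl | hlt
  · exact le_rfl
  have hw : 0 < w := hv.trans_lt hlt
  have hc0 : 0 ≤ v / w := by positivity
  have hc1 : v / w ≤ 1 := (div_le_one hw).2 hvw
  have h1 := smul_mem_level (D := D) ⟨hf.nonneg w hw.le, hf.workload w hw.le⟩ hc0
  rw [div_mul_cancel₀ _ hw.ne'] at h1
  have h2 : D.C (f v) ≤ D.C ((v / w) • f w) := (hf.minimal v hv).1 ⟨_, h1, rfl⟩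
  refine h2.trans (hD.cost_mono h1.1 fun i => ?_)
  exact mul_le_of_le_one_left (hf.nonneg w hw.le i) hc1

end Curve

/-! ### The Skorokhod map -/

section Skorokhod

variable {l : ℝ≥0 → ℝ}

lemma image_Iic_eq_image_Icc (φ : ℝ≥0 → ℝ) (t : ℝ≥0) :
    φ '' Iic t = (fun r => φ (r * t)) '' Icc (0 : ℝ≥0) 1 := by
  ext x
  constructor
  · rintro ⟨s, hs, rfl⟩
    rcases eq_or_ne t 0 with rfl | ht
    · exact ⟨0, ⟨le_rfl, zero_le_one⟩, by simp [le_antisymm (mem_Iic.1 hs) zero_le]⟩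
    · exact ⟨s / t, ⟨zero_le, div_le_one_of_le₀ hs zero_le⟩, by simp [div_mul_cancel₀ _ ht]⟩
  · rintro ⟨r, hr, rfl⟩
    exact ⟨r * t, mul_le_of_le_one_left zero_le hr.2, rfl⟩

lemma bddBelow_min_image (hl : Continuous l) (t : ℝ≥0) :
    BddBelow ((fun s => min (l s) 0) '' Iic t) := by
  rw [image_Iic_eq_image_Icc]
  exact (isCompact_Icc.image (by fun_prop)).bddBelow

lemma continuous_skorokhodMap (hl : Continuous l) : Continuous (skorokhodMap l) := by
  unfold skorokhodMap
  refine hl.sub ?_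
  have e : (fun t => sInf ((fun s => min (l s) 0) '' Iic t)) =
      fun t => sInf ((fun t r => min (l (r * t)) 0) t '' Icc (0 : ℝ≥0) 1) := by
    funext t; rw [image_Iic_eq_image_Icc]
  rw [e]
  refine isCompact_Icc.continuous_sInf ?_
  change Continuous fun p : ℝ≥0 × ℝ≥0 => min (l (p.2 * p.1)) 0
  fun_prop

lemma skorokhodMap_nonneg (hl : Continuous l) (t : ℝ≥0) : 0 ≤ skorokhodMap l t := by
  have := csInf_le (bddBelow_min_image hl t) ⟨t, mem_Iic.2 le_rfl, rfl⟩
  unfold skorokhodMap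
  have h2 := min_le_left (l t) 0
  simp only at this
  linarith

lemma skorokhodMap_sub_nonneg (hl : Continuous l) (t : ℝ≥0) : 0 ≤ skorokhodMap l t - l t := by
  have := csInf_le (bddBelow_min_image hl t) ⟨t, mem_Iic.2 le_rfl, rfl⟩
  unfold skorokhodMap
  have h2 := min_le_right (l t) 0
  simp only at this
  linarith

lemma monotone_skorokhodMap_sub (hl : Continuous l) :
    Monotone fun t => skorokhodMap l t - l t := by
  intro s t hst
  have hne : ((fun s => min (l s) 0) '' Iic s).Nonempty := ⟨_, s, mem_Iic.2 le_rfl, rfl⟩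
  have := csInf_le_csInf (bddBelow_min_image hl t) hne (image_mono (Iic_subset_Iic.2 hst))
  simp only [skorokhodMap]
  linarith

/-- Minimality of the Skorokhod reflection among all nondecreasing regulators. -/
lemma skorokhodMap_le {y : ℝ≥0 → ℝ} (hy0 : ∀ t, 0 ≤ y t) (hy : Monotone y)
    (hly : ∀ t, 0 ≤ l t + y t) (t : ℝ≥0) : skorokhodMap l t ≤ l t + y t := by
  have : -y t ≤ sInf ((fun s => min (l s) 0) '' Iic t) := by
    refine le_csInf ⟨_, t, mem_Iic.2 le_rfl, rfl⟩ ?_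
    rintro _ ⟨s, hs, rfl⟩
    have h1 := hy (mem_Iic.1 hs)
    have h2 := hly s
    exact le_min (by linarith) (by linarith [hy0 t])
  unfold skorokhodMap
  linarith

/-- A dense sequence in `[0, 1]`. -/
noncomputable def unitSeq (n : ℕ) : ℝ≥0 :=
  haveI : Nonempty (Icc (0 : ℝ≥0) 1) := ⟨⟨0, le_rfl, zero_le_one⟩⟩
  (TopologicalSpace.denseSeq (Icc (0 : ℝ≥0) 1) n : ℝ≥0)

lemma unitSeq_le_one (n : ℕ) : unitSeq n ≤ 1 := (Subtype.prop _ : _ ∈ Icc (0 : ℝ≥0) 1).2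

/-- The running infimum of a continuous function is an infimum over countably many times. -/
lemma skorokhodMap_eq_iInf (hl : Continuous l) (t : ℝ≥0) :
    skorokhodMap l t = l t - ⨅ n, min (l (unitSeq n * t)) 0 := by
  have hb := bddBelow_min_image hl t
  have hmem : ∀ n, min (l (unitSeq n * t)) 0 ∈ (fun s => min (l s) 0) '' Iic t := fun n =>
    ⟨unitSeq n * t, mul_le_of_le_one_left zero_le (unitSeq_le_one n), rfl⟩
  have hb' : BddBelow (range fun n => min (l (unitSeq n * t)) 0) :=
    hb.mono (range_subset_iff.2 hmem)
  unfold skorokhodMap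
  congr 1
  refine le_antisymm (le_ciInf fun n => csInf_le hb (hmem n)) ?_
  refine le_csInf ⟨_, t, mem_Iic.2 le_rfl, rfl⟩ ?_
  rw [image_Iic_eq_image_Icc]
  rintro _ ⟨r, hr, rfl⟩
  have : Nonempty (Icc (0 : ℝ≥0) 1) := ⟨⟨0, le_rfl, zero_le_one⟩⟩
  have hc : IsClosed {r : Icc (0 : ℝ≥0) 1 |
      ⨅ n, min (l (unitSeq n * t)) 0 ≤ min (l ((r : ℝ≥0) * t)) 0} :=
    isClosed_le continuous_const (by fun_prop)
  have hd := (TopologicalSpace.denseRange_denseSeq (Icc (0 : ℝ≥0) 1)).closure_eq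
  have hsub := closure_minimal (s := range (TopologicalSpace.denseSeq (Icc (0 : ℝ≥0) 1)))
    (range_subset_iff.2 fun n => ciInf_le hb' n) hc
  rw [hd] at hsub
  exact hsub (mem_univ ⟨r, hr⟩)

end Skorokhod

/-! ### The reflecting control -/

section Reflecting

variable {I : ℕ} {D : GameData I} {f : ℝ → Fin I → ℝ}

lemma GameData.free_apply (D : GameData I) (S : GameBasis.{u} I) (t : ℝ≥0) (ω : S.Ω) (i : Fin I) :
    D.free S t ω i = D.x₀ i + t * D.drift i +
      Real.sqrt (D.lam i) * (S.B (.A, i) t ω - S.B (.S, i) t ω) := by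
  simp [GameData.free, GameData.σ, Matrix.mulVec_diagonal]

lemma GameData.continuous_free (D : GameData I) (S : GameBasis.{u} I) (ω : S.Ω) :
    Continuous fun t => D.free S t ω := by
  refine continuous_pi fun i => ?_
  simp_rw [D.free_apply]
  have h := fun k => (S.brownian k).continuous_path ω
  exact (continuous_const.add (NNReal.continuous_coe.mul continuous_const)).add
    (continuous_const.mul ((h _).sub (h _)))

lemma GameData.measurable_free (D : GameData I) (S : GameBasis.{u} I) {s t : ℝ≥0} (hst : s ≤ t) :
    Measurable[S.F t] (D.free S s) := by
  have h : ∀ k, Measurable[S.F t] (S.B k s) := fun k =>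
    ((S.brownian k).adapted s).mono (S.F.mono hst) le_rfl
  refine @measurable_pi_lambda _ _ _ (S.F t) _ _ fun i => ?_
  simp_rw [D.free_apply]
  exact (((h _).sub (h _)).const_mul _).const_add _

lemma GameData.continuous_freeWorkload (D : GameData I) (S : GameBasis.{u} I) (ω : S.Ω) :
    Continuous fun t => D.θ ⬝ᵥ D.free S t ω :=
  (continuous_dotProduct_const D.θ).comp (D.continuous_free S ω)

lemma GameData.IsMinimizingCurve.continuous_max (hf : D.IsMinimizingCurve f) :
    Continuous fun w => f (max w 0) :=
  hf.continuousOn.comp_continuous (by fun_prop) fun _ => mem_Ici.2 (le_max_right _ _)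

lemma GameData.state_reflectingControl (D : GameData I) (f : ℝ → Fin I → ℝ) (S : GameBasis.{u} I)
    (t : ℝ≥0) (ω : S.Ω) :
    D.state S (D.reflectingControl S f) t ω = D.reflectedState S f t ω :=
  add_sub_cancel _ _

lemma GameData.reflectedState_eq (D : GameData I) (f : ℝ → Fin I → ℝ) (S : GameBasis.{u} I)
    (t : ℝ≥0) (ω : S.Ω) :
    D.reflectedState S f t ω =
      f (max (skorokhodMap (fun s => D.θ ⬝ᵥ D.free S s ω) t) 0) := by
  rw [max_eq_left (skorokhodMap_nonneg (D.continuous_freeWorkload S ω) t)]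
  rfl

lemma GameData.IsMinimizingCurve.continuous_reflectedState (hf : D.IsMinimizingCurve f)
    (S : GameBasis.{u} I) (ω : S.Ω) : Continuous fun t => D.reflectedState S f t ω := by
  simp_rw [D.reflectedState_eq]
  exact hf.continuous_max.comp (continuous_skorokhodMap (D.continuous_freeWorkload S ω))

lemma GameData.dotProduct_reflectingControl (hf : D.IsMinimizingCurve f) (S : GameBasis.{u} I)
    (t : ℝ≥0) (ω : S.Ω) :
    D.θ ⬝ᵥ D.reflectingControl S f t ω =
      skorokhodMap (fun s => D.θ ⬝ᵥ D.free S s ω) t - D.θ ⬝ᵥ D.free S t ω := by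
  unfold GameData.reflectingControl GameData.reflectedState
  rw [dotProduct_sub, hf.workload _ (skorokhodMap_nonneg (D.continuous_freeWorkload S ω) t)]

/-- Continuous paths are right-continuous with left limits. -/
lemma Continuous.isRCLL {E : Type*} [TopologicalSpace E] {x : ℝ≥0 → E} (hx : Continuous x) :
    IsRCLL x := fun t => ⟨hx.continuousWithinAt, x t, hx.continuousWithinAt⟩

/-- The reflecting control is admissible. -/
lemma GameData.IsMinimizingCurve.isMinimizerControl (hf : D.IsMinimizingCurve f)
    (S : GameBasis.{u} I) : D.IsMinimizerControl S (D.reflectingControl S f) where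
  adapted t := by
    have h1 : Measurable[S.F t] fun ω => skorokhodMap (fun s => D.θ ⬝ᵥ D.free S s ω) t := by
      simp_rw [fun ω => skorokhodMap_eq_iInf (D.continuous_freeWorkload S ω) t]
      have h2 : ∀ s ≤ t, Measurable[S.F t] fun ω => D.θ ⬝ᵥ D.free S s ω := fun s hs =>
        (continuous_dotProduct_const D.θ).measurable.comp (D.measurable_free S hs)
      exact (h2 t le_rfl).sub (Measurable.iInf fun n =>
        (h2 _ (mul_le_of_le_one_left zero_le (unitSeq_le_one n))).min measurable_const)
    have h3 : Measurable[S.F t] (D.reflectedState S f t) := by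
      have e : D.reflectedState S f t = fun ω =>
          f (max (skorokhodMap (fun s => D.θ ⬝ᵥ D.free S s ω) t) 0) :=
        funext fun ω => D.reflectedState_eq f S t ω
      rw [e]
      exact hf.continuous_max.measurable.comp h1
    exact h3.sub (D.measurable_free S le_rfl)
  rcll ω := ((hf.continuous_reflectedState S ω).sub (D.continuous_free S ω)).isRCLL
  workload_nonneg ω t := by
    rw [GameData.dotProduct_reflectingControl hf]
    exact skorokhodMap_sub_nonneg (D.continuous_freeWorkload S ω) t
  workload_mono ω := by
    simp_rw [GameData.dotProduct_reflectingControl hf]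
    exact monotone_skorokhodMap_sub (D.continuous_freeWorkload S ω)
  state_nonneg ω t i := by
    rw [D.state_reflectingControl]
    exact hf.nonneg _ (skorokhodMap_nonneg (D.continuous_freeWorkload S ω) t) i

/-- On a given space the reflecting control has at every time the smallest holding cost among all
admissible controls. -/
lemma GameData.IsMinimizingCurve.cost_reflecting_le (hD : D.Standing)
    (hf : D.IsMinimizingCurve f) (S : GameBasis.{u} I) {Y : ℝ≥0 → S.Ω → Fin I → ℝ}
    (hY : D.IsMinimizerControl S Y) (t : ℝ≥0) (ω : S.Ω) :
    D.C (D.state S (D.reflectingControl S f) t ω) ≤ D.C (D.state S Y t ω) := by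
  have hθ : ∀ s, D.θ ⬝ᵥ D.state S Y s ω = D.θ ⬝ᵥ D.free S s ω + D.θ ⬝ᵥ Y s ω := fun s =>
    dotProduct_add _ _ _
  have hpos : ∀ s, 0 ≤ D.θ ⬝ᵥ D.state S Y s ω := fun s =>
    Finset.sum_nonneg fun i _ => mul_nonneg (hD.θ_pos i).le (hY.state_nonneg ω s i)
  have h1 := skorokhodMap_le (l := fun s => D.θ ⬝ᵥ D.free S s ω) (hY.workload_nonneg ω)
    (hY.workload_mono ω) (fun s => by have := hpos s; rwa [hθ] at this) t
  rw [← hθ] at h1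
  rw [D.state_reflectingControl]
  exact (hf.cost_mono hD (skorokhodMap_nonneg (D.continuous_freeWorkload S ω) t) h1).trans
    (hf.cost_le (hY.state_nonneg ω t) (hpos t))

lemma GameData.IsMinimizingCurve.worstCost_reflecting_le (hD : D.Standing)
    (hf : D.IsMinimizingCurve f) (S : GameBasis.{u} I) {Y : ℝ≥0 → S.Ω → Fin I → ℝ}
    (hY : D.IsMinimizerControl S Y) :
    D.worstCost S (D.reflectingControl S f) ≤ D.worstCost S Y := by
  refine iSup₂_mono fun Q _ => EReal.sub_le_sub ?_ le_rfl
  refine EReal.coe_ennreal_le_coe_ennreal_iff.2 (lintegral_mono fun ω => lintegral_mono fun t => ?_)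
  simp only
  gcongr
  exact hf.cost_reflecting_le hD S hY t ω

/-! ### The holding cost as a functional of the driving paths -/

/-- The workload of the uncontrolled process driven by the paths `b`. -/
noncomputable def freeWorkload (D : GameData I) (b : Source × Fin I → ℝ≥0 → ℝ) (t : ℝ≥0) : ℝ :=
  D.θ ⬝ᵥ (D.x₀ + (t : ℝ) • D.drift + D.σ *ᵥ fun i => b (.A, i) t - b (.S, i) t)

/-- The holding cost at time `t` of the reflected process driven by the paths `b`. The running
infimum is taken over countably many times, which makes this a measurable functional. -/
noncomputable def reflectedCost (D : GameData I) (f : ℝ → Fin I → ℝ)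
    (b : Source × Fin I → ℝ≥0 → ℝ) (t : ℝ≥0) : ℝ≥0∞ :=
  ENNReal.ofReal (D.C (f (max (freeWorkload D b t -
    ⨅ n, min (freeWorkload D b (unitSeq n * t)) 0) 0)))

lemma reflectedCost_path (D : GameData I) (f : ℝ → Fin I → ℝ) (S : GameBasis.{u} I) (t : ℝ≥0)
    (ω : S.Ω) : reflectedCost D f (fun k => S.path k ω) t =
      ENNReal.ofReal (D.C (D.state S (D.reflectingControl S f) t ω)) := by
  rw [D.state_reflectingControl, D.reflectedState_eq,
    skorokhodMap_eq_iInf (D.continuous_freeWorkload S ω)]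
  rfl

lemma reflectedCost_congr (D : GameData I) (f : ℝ → Fin I → ℝ)
    {b b' : Source × Fin I → ℝ≥0 → ℝ} {t : ℝ≥0} (h : ∀ k, ∀ s ≤ t, b k s = b' k s) :
    reflectedCost D f b t = reflectedCost D f b' t := by
  have h1 : ∀ s ≤ t, freeWorkload D b s = freeWorkload D b' s := fun s hs => by
    unfold freeWorkload; simp_rw [fun k => h k s hs]
  unfold reflectedCost
  simp_rw [h1 t le_rfl, fun n => h1 (unitSeq n * t)
    (mul_le_of_le_one_left zero_le (unitSeq_le_one n))]

lemma GameData.IsMinimizingCurve.continuous_cost (hD : D.Standing) (hf : D.IsMinimizingCurve f) :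
    Continuous fun w => D.C (f (max w 0)) :=
  hD.cost_continuousOn.comp_continuous hf.continuous_max fun _ =>
    hf.nonneg _ (le_max_right _ _)

lemma measurable_reflectedCost (hD : D.Standing) (hf : D.IsMinimizingCurve f) (t : ℝ≥0) :
    Measurable fun b => reflectedCost D f b t := by
  have h1 : ∀ s, Measurable fun b => freeWorkload D b s := fun s => by
    refine (continuous_dotProduct_const D.θ).measurable.comp (measurable_pi_lambda _ fun i => ?_)
    simp only [GameData.σ, Matrix.mulVec_diagonal, Pi.add_apply, Pi.smul_apply, smul_eq_mul]
    fun_prop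
  exact ((hf.continuous_cost hD).measurable.comp ((h1 t).sub (Measurable.iInf fun n =>
    (h1 _).min measurable_const))).ennreal_ofReal

lemma measurable_reflectedCost_path (hD : D.Standing) (hf : D.IsMinimizingCurve f)
    (S : GameBasis.{u} I) :
    Measurable fun p : ℝ≥0 × S.Ω => reflectedCost D f (fun k => S.path k p.2) p.1 := by
  refine measurable_uncurry_of_continuous_of_measurable
    (u := fun t ω => reflectedCost D f (fun k => S.path k ω) t) (fun ω => ?_) fun t => ?_
  · simp_rw [reflectedCost_path, D.state_reflectingControl, D.reflectedState_eq]
    exact ENNReal.continuous_ofReal.comp ((hf.continuous_cost hD).comp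
      (continuous_skorokhodMap (D.continuous_freeWorkload S ω)))
  · exact (measurable_reflectedCost hD hf t).comp (measurable_pi_lambda _ S.measurable_path)

/-- The cost at time `t ≤ T` is a measurable functional of the driving paths up to time `T`, the
same one on every space. -/
lemma exists_measurable_pathUpTo_reflectedCost (hD : D.Standing) (hf : D.IsMinimizingCurve f)
    {t T : ℝ≥0} (ht : t ≤ T) :
    ∃ F : (Source × Fin I → Iic T → ℝ) → ℝ≥0∞, Measurable F ∧
      ∀ (S : GameBasis.{u} I) ω, F (fun k => pathUpTo (S.B k) T ω) =
        reflectedCost D f (fun k => S.path k ω) t := by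
  -- a path up to time `T` is continued by its value at time `T`
  let ext : (Source × Fin I → Iic T → ℝ) → Source × Fin I → ℝ≥0 → ℝ := fun w k s =>
    w k ⟨min s T, mem_Iic.2 (min_le_right _ _)⟩
  have hext : Measurable ext :=
    measurable_pi_lambda _ fun k => measurable_pi_lambda _ fun s =>
      (measurable_pi_apply _).comp (measurable_pi_apply k)
  refine ⟨fun w => reflectedCost D f (ext w) t, (measurable_reflectedCost hD hf t).comp hext,
    fun S ω => reflectedCost_congr D f fun k s hs => ?_⟩
  simp only [ext, pathUpTo, min_eq_left (hs.trans ht), GameBasis.path]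

end Reflecting

/-! ### Comparison of the worst-case costs on two spaces -/

section Comparison

lemma ereal_sum_sub {ι : Type*} (s : Finset ι) (a : ι → ℝ≥0∞) (c : ι → ℝ) :
    ∑ k ∈ s, ((a k : EReal) - (c k : EReal)) =
      ((∑ k ∈ s, a k : ℝ≥0∞) : EReal) - ((∑ k ∈ s, c k : ℝ) : EReal) := by
  classical
  induction s using Finset.induction_on with
  | empty => simp
  | insert i s hi ih =>
    rw [Finset.sum_insert hi, Finset.sum_insert hi, Finset.sum_insert hi, ih]
    generalize ∑ k ∈ s, a k = A
    generalize ∑ k ∈ s, c k = C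
    generalize a i = a
    generalize c i = c
    induction a with
    | top =>
      rw [top_add, EReal.coe_ennreal_top, EReal.top_sub_coe, EReal.top_sub_coe]
      refine EReal.top_add_of_ne_bot ?_
      induction A with
      | top => rw [EReal.coe_ennreal_top, EReal.top_sub_coe]; exact top_ne_bot
      | coe A => exact EReal.coe_ne_bot ((A : ℝ) - C)
    | coe a =>
      induction A with
      | top =>
        rw [add_top, EReal.coe_ennreal_top, EReal.top_sub_coe, EReal.top_sub_coe]
        exact EReal.add_top_of_ne_bot (EReal.coe_ne_bot ((a : ℝ) - c))
      | coe A =>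
        have h : ((a : ℝ) - c) + (A - C) = ((a + A : ℝ≥0) : ℝ) - (c + C) := by
          push_cast; ring
        exact congrArg (fun x : ℝ => (x : EReal)) h

lemma ereal_sub_le_coe_iff {G A : ℝ≥0∞} (hA : A ≠ ⊤) (C x : ℝ) :
    (G : EReal) - ((A : EReal) - (C : EReal)) ≤ (x : EReal) ↔
      0 ≤ x + A.toReal - C ∧ G ≤ ENNReal.ofReal (x + A.toReal - C) := by
  lift A to ℝ≥0 using hA
  have e : ((A : ℝ≥0∞) : EReal) - (C : EReal) = (((A : ℝ) - C : ℝ) : EReal) := rfl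
  rw [e]
  induction G with
  | top =>
    rw [EReal.coe_ennreal_top, EReal.top_sub_coe]
    simp
  | coe G =>
    have e2 : ((G : ℝ≥0∞) : EReal) - (((A : ℝ) - C : ℝ) : EReal)
        = (((G : ℝ) - (A - C) : ℝ) : EReal) := rfl
    have hG : (0 : ℝ) ≤ G := G.2
    rw [e2, EReal.coe_le_coe_iff, ENNReal.coe_toReal]
    constructor
    · intro h
      refine ⟨by linarith, ?_⟩
      rw [← ENNReal.ofReal_coe_nnreal]
      exact ENNReal.ofReal_le_ofReal (by linarith)
    · rintro ⟨h0, h⟩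
      rw [← ENNReal.ofReal_coe_nnreal, ENNReal.ofReal_le_ofReal_iff h0] at h
      linarith

variable {I : ℕ} {D : GameData I} {f : ℝ → Fin I → ℝ}

lemma cost_reflecting_eq (hD : D.Standing) (hf : D.IsMinimizingCurve f)
    {K : Source × Fin I → ℝ} (hK : ∀ k, 0 ≤ K k)
    (hΦ : ∀ k, IsPenalty (penaltyFn (D.g k) (K k))) (S : GameBasis.{u} I) {Q : Measure S.Ω}
    (hQ : Q ∈ D.maximizerControls S) :
    D.cost S (D.reflectingControl S f) Q =
      ((∫⁻ t, (D.ϱ t : ℝ≥0∞) * ∫⁻ ω, reflectedCost D f (fun k => S.path k ω) t ∂Q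
        ∂timeMeasure : ℝ≥0∞) : EReal) -
      (((∑ k, ∫⁻ t, (D.ϱ t : ℝ≥0∞) * penaltyAt (penaltyFn (D.g k) (K k)) Q S.P (S.B k) t
        ∂timeMeasure : ℝ≥0∞) : EReal) -
        ((∑ k, 2 * K k * (∫⁻ t, (D.ϱ t : ℝ≥0∞) ∂timeMeasure).toReal : ℝ) : EReal)) := by
  obtain ⟨ψ, hψ⟩ := hQ
  have := hψ.isProb
  have hϱm : Measurable D.ϱ := hD.discount_anti.measurable
  unfold GameData.cost
  have h1 : ∀ k, divergence D.ϱ (D.g k) Q S.P (S.B k) = _ := fun k =>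
    divergence_eq (hD.g_mono k).measurable (hK k) (hΦ k) (S.measurable k) (hψ.absCont k) hϱm
      hD.lintegral_discount_lt_top
  simp_rw [h1, ereal_sum_sub, ← reflectedCost_path]
  congr 2
  have hm := measurable_reflectedCost_path hD hf S
  rw [lintegral_lintegral_swap]
  · refine lintegral_congr fun t => ?_
    rw [lintegral_const_mul']
    exact ENNReal.coe_ne_top
  · exact ((hϱm.coe_nnreal_ennreal.comp measurable_snd).mul
      (hm.comp measurable_swap)).aemeasurable

/-- The worst-case cost of the reflecting control does not depend on the space: every control of
the maximizer on one space is matched, up to an arbitrarily small loss, on any other. -/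
lemma worstCost_reflecting_le_worstCost (hD : D.Standing) (hf : D.IsMinimizingCurve f)
    (S S' : GameBasis.{u} I) :
    D.worstCost S (D.reflectingControl S f) ≤ D.worstCost S' (D.reflectingControl S' f) := by
  have hϱm : Measurable D.ϱ := hD.discount_anti.measurable
  have hϱ := hD.lintegral_discount_lt_top
  obtain ⟨_, _, _, _, _, c, -, -, -, -, -, -, hg, -, -⟩ := hD.growth
  choose K hK hΦ using fun k => isPenalty_penaltyFn (hD.g_convex k) (hD.g_mono k) (hg k)
  refine iSup₂_le fun Q hQ => ?_
  have hQ' := hQ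
  obtain ⟨ψ, hψ⟩ := hQ
  have hprob := hψ.isProb
  rw [cost_reflecting_eq hD hf hK hΦ S hQ']
  set r := ∫⁻ t, (D.ϱ t : ℝ≥0∞) ∂timeMeasure with hr
  set A := ∑ k, ∫⁻ t, (D.ϱ t : ℝ≥0∞) * penaltyAt (penaltyFn (D.g k) (K k)) Q S.P (S.B k) t
    ∂timeMeasure with hA
  set C := ∑ k, 2 * K k * r.toReal with hC
  rcases eq_or_ne A ⊤ with hAtop | hAtop
  -- an infinite penalty makes the cost `-∞`, whatever the gain
  · rw [hAtop, EReal.coe_ennreal_top, EReal.top_sub_coe, EReal.sub_top]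
    exact bot_le
  rw [← EReal.le_of_forall_lt_iff_le]
  intro x hx
  -- the cost is at most `x` exactly if the gain is at most `y`
  set y := x + A.toReal - C with hy
  rw [ereal_sub_le_coe_iff hAtop]
  -- the bound up to time `T`, with an error `e`
  have key : ∀ T : ℝ≥0, ∀ e : ℝ, 0 < e → 0 ≤ y + e ∧
      ∫⁻ t in Iic T, (D.ϱ t : ℝ≥0∞) * ∫⁻ ω, reflectedCost D f (fun k => S.path k ω) t ∂Q
        ∂timeMeasure ≤ ENNReal.ofReal (y + e) := by
    intro T e he
    obtain ⟨Z, hZ0, hZm, hZi, hZ1, hZf, hZΦ⟩ := exists_transfer S S' hψ.absCont hψ.indep T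
    set N : ℝ := (Fintype.card (Source × Fin I) : ℝ) with hN
    have hN0 : 0 ≤ N := Nat.cast_nonneg _
    set ε := e / (N * r.toReal + 1) with hε
    have hr0 : 0 ≤ r.toReal := ENNReal.toReal_nonneg
    have hε0 : 0 < ε := by positivity
    have hεe : N * (r.toReal * ε) ≤ e := by
      rw [hε, ← mul_assoc, mul_div_assoc', div_le_iff₀ (by positivity)]
      nlinarith
    obtain ⟨R, hR, hRΦ, hRf⟩ := exists_controls_approx D hϱ S' hZ0 hZm hZi hZ1 hΦ hε0
    have hA' : ∀ n, ∑ k, ∫⁻ t, (D.ϱ t : ℝ≥0∞) *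
        penaltyAt (penaltyFn (D.g k) (K k)) (R n) S'.P (S'.B k) t ∂timeMeasure ≤
        A + ENNReal.ofReal e := by
      intro n
      have h1 : ∀ k, ∫⁻ t, (D.ϱ t : ℝ≥0∞) *
          penaltyAt (penaltyFn (D.g k) (K k)) (R n) S'.P (S'.B k) t ∂timeMeasure ≤
          ∫⁻ t, (D.ϱ t : ℝ≥0∞) * penaltyAt (penaltyFn (D.g k) (K k)) Q S.P (S.B k) t
            ∂timeMeasure + r * ENNReal.ofReal ε := by
        intro k
        rw [hr, ← lintegral_mul_const' _ _ ENNReal.ofReal_ne_top,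
          ← lintegral_add_right _ (hϱm.coe_nnreal_ennreal.mul_const _)]
        refine lintegral_mono fun t => ?_
        rw [← mul_add]
        gcongr
        refine (hRΦ n k t).trans ?_
        gcongr
        exact hZΦ _ (hΦ k) k t
      refine (Finset.sum_le_sum fun k _ => h1 k).trans ?_
      rw [Finset.sum_add_distrib, Finset.sum_const, nsmul_eq_mul]
      refine add_le_add le_rfl ?_
      have h2 : ((Finset.univ : Finset (Source × Fin I)).card : ℝ≥0∞) * (r * ENNReal.ofReal ε) =
          ENNReal.ofReal (N * (r.toReal * ε)) := by
        rw [ENNReal.ofReal_mul hN0, ENNReal.ofReal_mul hr0, ENNReal.ofReal_toReal hϱ.ne, hN,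
          ENNReal.ofReal_natCast, Finset.card_univ]
      rw [h2]
      exact ENNReal.ofReal_le_ofReal hεe
    have hG : ∀ n, 0 ≤ y + e ∧ ∫⁻ t, (D.ϱ t : ℝ≥0∞) *
        ∫⁻ ω, reflectedCost D f (fun k => S'.path k ω) t ∂(R n) ∂timeMeasure ≤
        ENNReal.ofReal (y + e) := by
      intro n
      have hfin : A + ENNReal.ofReal e ≠ ⊤ := ENNReal.add_ne_top.2 ⟨hAtop, ENNReal.ofReal_ne_top⟩
      have h1 : D.cost S' (D.reflectingControl S' f) (R n) ≤ x :=
        (le_iSup₂ (f := fun Q _ => D.cost S' (D.reflectingControl S' f) Q) (R n) (hR n)).trans hx.le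
      rw [cost_reflecting_eq hD hf hK hΦ S' (hR n),
        ereal_sub_le_coe_iff (ne_top_of_le_ne_top hfin (hA' n))] at h1
      have h2 := ENNReal.toReal_mono hfin (hA' n)
      rw [ENNReal.toReal_add hAtop ENNReal.ofReal_ne_top, ENNReal.toReal_ofReal he.le] at h2
      refine ⟨by linarith [h1.1], h1.2.trans (ENNReal.ofReal_le_ofReal ?_)⟩
      linarith
    refine ⟨(hG 0).1, ?_⟩
    have hmc := measurable_reflectedCost_path hD hf S'
    have hprobR : ∀ n, IsProbabilityMeasure (R n) := fun n => (hR n).choose_spec.isProb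
    have hRm : ∀ n, Measurable fun t => (D.ϱ t : ℝ≥0∞) *
        ∫⁻ ω, reflectedCost D f (fun k => S'.path k ω) t ∂(R n) := fun n =>
      hϱm.coe_nnreal_ennreal.mul hmc.lintegral_prod_right'
    have hpt : ∀ t ≤ T, ∫⁻ ω, reflectedCost D f (fun k => S.path k ω) t ∂Q ≤
        liminf (fun n => ∫⁻ ω, reflectedCost D f (fun k => S'.path k ω) t ∂(R n)) atTop := by
      intro t ht
      obtain ⟨F, hF, hFc⟩ := exists_measurable_pathUpTo_reflectedCost.{u} hD hf ht
      have h1 := hZf F hF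
      simp_rw [hFc] at h1
      rw [h1]
      exact hRf (fun ω => reflectedCost D f (fun k => S'.path k ω) t)
        ((measurable_reflectedCost hD hf t).comp (measurable_pi_lambda _ S'.measurable_path))
    calc ∫⁻ t in Iic T, (D.ϱ t : ℝ≥0∞) * ∫⁻ ω, reflectedCost D f (fun k => S.path k ω) t ∂Q
          ∂timeMeasure
        ≤ ∫⁻ t in Iic T, liminf (fun n => (D.ϱ t : ℝ≥0∞) *
            ∫⁻ ω, reflectedCost D f (fun k => S'.path k ω) t ∂(R n)) atTop ∂timeMeasure := by
          refine setLIntegral_mono' measurableSet_Iic fun t ht => ?_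
          rw [ENNReal.liminf_const_mul_of_ne_top ENNReal.coe_ne_top]
          gcongr
          exact hpt t ht
      _ ≤ liminf (fun n => ∫⁻ t in Iic T, (D.ϱ t : ℝ≥0∞) *
            ∫⁻ ω, reflectedCost D f (fun k => S'.path k ω) t ∂(R n) ∂timeMeasure) atTop :=
          lintegral_liminf_le hRm
      _ ≤ ENNReal.ofReal (y + e) := by
          refine (liminf_le_liminf (v := fun _ => ENNReal.ofReal (y + e))
            (Eventually.of_forall fun n => ?_)).trans_eq (liminf_const _)
          exact (setLIntegral_le_lintegral _ _).trans (hG n).2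
  refine ⟨le_of_forall_pos_le_add fun e he => (key 0 e he).1, ?_⟩
  have hy0 : 0 ≤ y := le_of_forall_pos_le_add fun e he => (key 0 e he).1
  have hT : ∀ n : ℕ, ∫⁻ t in Iic (n : ℝ≥0), (D.ϱ t : ℝ≥0∞) *
      ∫⁻ ω, reflectedCost D f (fun k => S.path k ω) t ∂Q ∂timeMeasure ≤ ENNReal.ofReal y := by
    intro n
    refine ENNReal.le_of_forall_pos_le_add fun e he _ => ?_
    refine (key n e he).2.trans (ENNReal.ofReal_add_le.trans ?_)
    rw [ENNReal.ofReal_coe_nnreal]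
  have hU : (⋃ n : ℕ, Iic (n : ℝ≥0)) = univ :=
    eq_univ_of_forall fun t => mem_iUnion.2 (exists_nat_ge t)
  rw [← setLIntegral_univ, ← hU, setLIntegral_iUnion_of_directed]
  · exact iSup_le hT
  · exact Monotone.directed_le (f := fun n : ℕ => Iic (n : ℝ≥0)) fun i j hij =>
      Iic_subset_Iic.2 (by exact_mod_cast hij)

end Comparison

/-- A minimizing curve exists, and for every minimizing curve `f` and every filtered probability
space with Brownian motions, the `f`-reflecting control is admissible and optimal. -/
theorem proposition3p1 {I : ℕ} (D : GameData I) (hD : D.Standing) :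
    (∃ f, D.IsMinimizingCurve f) ∧
    ∀ f, D.IsMinimizingCurve f → ∀ S : GameBasis.{u} I,
      D.IsMinimizerControl S (D.reflectingControl S f) ∧
      GameData.value.{u} D =
        ⨆ Q ∈ D.maximizerControls S, D.cost S (D.reflectingControl S f) Q := by
  refine ⟨hD.exists_isMinimizingCurve, fun f hf S =>
    ⟨hf.isMinimizerControl S, le_antisymm ?_ ?_⟩⟩
  · exact iInf_le_of_le S (iInf_le_of_le _ (iInf_le_of_le (hf.isMinimizerControl S) le_rfl))
  · exact le_iInf fun S' => le_iInf fun Y => le_iInf fun hY =>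
      (worstCost_reflecting_le_worstCost hD hf S S').trans (hf.worstCost_reflecting_le hD S' hY)
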